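/- Let $(M^n,g)$ be a compact Hermitian manifold of complex dimension $n$ with Kähler form $\omega$. There is a unique $(1,0)$-form $\eta$ on $M$ with $\partial(\omega^{n-1})=-\eta\wedge\omega^{n-1}$; it is called Gauduchon's torsion $1$-form of $g$, and $g$ is called balanced if $\eta=0$. (i) If for some real constant $a$ the equation $$\sqrt{-1}\,\bigl(\partial\overline{\eta}-\overline{\partial}\eta-\eta\wedge\overline{\eta}\bigr)=a\,\omega$$ holds on $M$, then $\eta=0$. (ii) If $g$ is a critical point of the Gauduchon functional $$\mathcal G(g)=V^{\frac{1-n}{n}}\int_M|\eta|^2\,dv,\qquad dv=\frac{\omega^n}{n!},\quad V=\int_M dv,$$ on the space of all Hermitian metrics on the complex manifold $M$, then $g$ is balanced. Here $g$ is a critical point if $\frac{d}{dt}\big|_{t=0}\mathcal G(g+th)=0$ for every smooth symmetric $2$-tensor $h$ on $M$ invariant under the complex structure. -/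

import Mathlib

open scoped Manifold ContDiff Topology Nat

noncomputable section

namespace HermitianGeometry

/-! ### Multilinear algebra -/

section Algebra

variable {V : Type*} [AddCommGroup V] [Module ℝ V] [TopologicalSpace V]

/-- The product `(v₁, …, v_{k+l}) ↦ α (v₁, …, v_k) * β (v_{k+1}, …, v_{k+l})` of two complex
valued alternating maps, as a continuous multilinear map. -/
def tensorMul {k l : ℕ} (α : V [⋀^Fin k]→L[ℝ] ℂ) (β : V [⋀^Fin l]→L[ℝ] ℂ) :
    ContinuousMultilinearMap ℝ (fun _ : Fin (k + l) => V) ℂ where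
  toMultilinearMap := (LinearMap.mul' ℝ ℂ).compMultilinearMap
    ((α.toMultilinearMap.domCoprod β.toMultilinearMap).domDomCongr finSumFinEquiv)
  cont := by
    have h : Continuous fun v : Fin (k + l) → V =>
        α (fun i => v (Fin.castAdd l i)) * β (fun j => v (Fin.natAdd k j)) :=
      (α.cont.comp (by fun_prop)).mul (β.cont.comp (by fun_prop))
    convert h using 2 with v
    simp [MultilinearMap.domCoprod_apply]

theorem tensorMul_apply {k l : ℕ} (α : V [⋀^Fin k]→L[ℝ] ℂ) (β : V [⋀^Fin l]→L[ℝ] ℂ)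
    (v : Fin (k + l) → V) :
    tensorMul α β v = α (fun i => v (Fin.castAdd l i)) * β (fun j => v (Fin.natAdd k j)) := by
  change (LinearMap.mul' ℝ ℂ) (((α.toMultilinearMap.domCoprod
    β.toMultilinearMap).domDomCongr finSumFinEquiv) v) = _
  simp [MultilinearMap.domCoprod_apply]

/-- The wedge product of two complex valued alternating forms, with the normalization
`(α ∧ β) (v) = 1 / (k! l!) ∑_σ sign σ • α (v_{σ 1}, …, v_{σ k}) β (v_{σ (k+1)}, …, v_{σ (k+l)})`,
so that `(α ∧ β) (u, v) = α u * β v - α v * β u` for 1-forms. -/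
def wedge {k l : ℕ} (α : V [⋀^Fin k]→L[ℝ] ℂ) (β : V [⋀^Fin l]→L[ℝ] ℂ) :
    V [⋀^Fin (k + l)]→L[ℝ] ℂ :=
  ((k ! : ℂ) * (l ! : ℂ))⁻¹ • (tensorMul α β).alternatization

/-- The powers `β ^ k = β ∧ ⋯ ∧ β` of a 2-form; `β ^ 0` is the constant `1`. -/
def wedgePow (β : V [⋀^Fin 2]→L[ℝ] ℂ) : (k : ℕ) → V [⋀^Fin (2 * k)]→L[ℝ] ℂ
  | 0 => ContinuousAlternatingMap.constOfIsEmpty ℝ V (Fin 0) (1 : ℂ)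
  | k + 1 => wedge (wedgePow β k) β

end Algebra

/-! ### Complex manifolds and differential forms -/

/-- The model space `ℂⁿ` of complex manifolds of dimension `n`. -/
abbrev Model (n : ℕ) : Type := EuclideanSpace ℂ (Fin n)

variable {n : ℕ} {M : Type*} [TopologicalSpace M] [ChartedSpace (Model n) M]

/-- A complex manifold of dimension `n` is a smooth real manifold, with the same charts. -/
instance isManifold_real [IsManifold 𝓘(ℂ, Model n) ω M] : IsManifold 𝓘(ℝ, Model n) ∞ M := by
  refine isManifold_of_contDiffOn _ _ _ fun e e' he he' => ?_
  have h := (mem_groupoid_of_pregroupoid.1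
    (HasGroupoid.compatible (G := contDiffGroupoid ω 𝓘(ℂ, Model n)) he he')).1
  exact (ContDiffOn.restrict_scalars ℝ h).of_le le_top

variable (n) in
/-- Multiplication by `√-1` on `ℂⁿ`, as a real linear map. -/
def mulI : Model n →L[ℝ] Model n :=
  (Complex.I • ContinuousLinearMap.id ℂ (Model n)).restrictScalars ℝ

theorem mulI_apply (v : Model n) : mulI n v = Complex.I • v := rfl

variable (n) in
/-- The complex structure `J` of a complex manifold on its real tangent spaces. (Mathlib
identifies the tangent space at `x` with `ℂⁿ` through the preferred chart at `x`; as coordinate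
changes are holomorphic, `J` does not depend on the chart.) -/
def tangentJ (x : M) : TangentSpace 𝓘(ℝ, Model n) x →L[ℝ] TangentSpace 𝓘(ℝ, Model n) x :=
  mulI n

theorem tangentJ_tangentJ (x : M) (v : TangentSpace 𝓘(ℝ, Model n) x) :
    tangentJ n x (tangentJ n x v) = -v := by
  have h (w : Model n) : mulI n (mulI n w) = -w := by
    rw [mulI_apply, mulI_apply, smul_smul, Complex.I_mul_I, neg_one_smul]
  exact h v

variable (n M) in
/-- Complex valued differential forms of degree `k` (no regularity imposed). -/
abbrev Form (k : ℕ) : Type _ :=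
  (x : M) → (TangentSpace 𝓘(ℝ, Model n) x) [⋀^Fin k]→L[ℝ] ℂ

namespace Form

variable {k l : ℕ}

/-- The expression of the form `α` in the chart `e`, i.e. the pullback of `α` under `e⁻¹`. -/
def inChart (e : OpenPartialHomeomorph M (Model n)) (α : Form n M k) (y : Model n) :
    (Model n) [⋀^Fin k]→L[ℝ] ℂ :=
  (α (e.symm y)).compContinuousLinearMap (mfderiv 𝓘(ℝ, Model n) 𝓘(ℝ, Model n) e.symm y)

/-- The exterior derivative: at `x`, it is the pullback under the chart `e` at `x` of the exterior
derivative on `ℂⁿ` of the expression of the form in that chart. -/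
def d (α : Form n M k) : Form n M (k + 1) := fun x =>
  (extDeriv (inChart (chartAt (Model n) x) α) (chartAt (Model n) x x)).compContinuousLinearMap
    (mfderiv 𝓘(ℝ, Model n) 𝓘(ℝ, Model n) (chartAt (Model n) x) x)

/-- The action of the complex structure, `(J α) (v₁, …, v_k) = α (J v₁, …, J v_k)`. It is
multiplication by `(√-1) ^ (p - q)` on forms of type `(p, q)`. -/
def J (α : Form n M k) : Form n M k := fun x => (α x).compContinuousLinearMap (tangentJ n x)

/-- The inverse of `Form.J`. -/
def Jinv (α : Form n M k) : Form n M k := fun x => (α x).compContinuousLinearMap (-tangentJ n x)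

/-- `d^c = J⁻¹ d J = √-1 (∂bar - ∂)`. -/
def dc (α : Form n M k) : Form n M (k + 1) := Jinv (d (J α))

/-- The operator `∂ = (d + √-1 d^c) / 2`. On forms of type `(p, q)` it is the component of type
`(p + 1, q)` of `d`. -/
def del (α : Form n M k) : Form n M (k + 1) := (1 / 2 : ℂ) • (d α + Complex.I • dc α)

/-- The operator `∂bar = (d - √-1 d^c) / 2`. On forms of type `(p, q)` it is the component of type
`(p, q + 1)` of `d`. -/
def delbar (α : Form n M k) : Form n M (k + 1) := (1 / 2 : ℂ) • (d α - Complex.I • dc α)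

/-- Complex conjugation of forms. -/
def conj (α : Form n M k) : Form n M k := fun x =>
  (Complex.conjCLE : ℂ →L[ℝ] ℂ).compContinuousAlternatingMap (α x)

/-- The wedge product of differential forms. -/
def wedge (α : Form n M k) (β : Form n M l) : Form n M (k + l) := fun x =>
  HermitianGeometry.wedge (α x) (β x)

/-- The powers of a differential form of degree two. -/
def pow (β : Form n M 2) (k : ℕ) : Form n M (2 * k) := fun x => wedgePow (β x) k

/-- A form of degree `k` as a form of degree `l`, when `k = l`. -/
def cast (h : k = l) (α : Form n M k) : Form n M l := fun x =>
  { (α x).toContinuousMultilinearMap.domDomCongr (finCongr h) with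
    map_eq_zero_of_eq' := fun v i j hv hij =>
      (α x).map_eq_zero_of_eq (fun i => v (finCongr h i)) (i := (finCongr h).symm i)
        (j := (finCongr h).symm j) (by simpa using hv) (by simpa using hij) }

/-- A 1-form is of type `(1, 0)` if it is complex linear on the tangent spaces. -/
def IsType10 (α : Form n M 1) : Prop :=
  ∀ (x : M) (v : TangentSpace 𝓘(ℝ, Model n) x),
    α x (fun _ => tangentJ n x v) = Complex.I * α x (fun _ => v)

end Form

/-! ### Integration of top degree forms -/

variable (n) in
/-- The positively oriented real basis `e₁, √-1 e₁, …, eₙ, √-1 eₙ` of `ℂⁿ`. -/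
def realFrame (k : Fin (2 * n)) : Model n :=
  EuclideanSpace.single (⟨k / 2, by omega⟩ : Fin n)
    (if (k : ℕ) % 2 = 0 then (1 : ℂ) else Complex.I)

variable (n M) in
theorem exists_partitionOfUnity [CompactSpace M] [T2Space M] :
    ∃ ρ : PartitionOfUnity M M, ρ.IsSubordinate fun c => (chartAt (Model n) c).source :=
  PartitionOfUnity.exists_isSubordinate isClosed_univ _
    (fun c => (chartAt (Model n) c).open_source)
    fun x _ => Set.mem_iUnion.2 ⟨x, mem_chart_source _ x⟩

variable (n M) in
/-- A continuous partition of unity subordinate to the charts `chartAt c`, `c : M`. -/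
def chartPartition [CompactSpace M] [T2Space M] : PartitionOfUnity M M :=
  (exists_partitionOfUnity n M).choose

/-- The integral of a (continuous) form of degree `2 n` over a compact complex manifold of
dimension `n` with its complex orientation: cut the form into pieces supported in charts by a
partition of unity, and integrate the coefficient of each piece in its chart with respect to
Lebesgue measure. (All but finitely many of the functions of the partition vanish identically,
and the result does not depend on the partition.) -/
def Form.integral [CompactSpace M] [T2Space M] (τ : Form n M (2 * n)) : ℂ :=
  ∑ᶠ c : M, ∫ y in (chartAt (Model n) c).target,
    (chartPartition n M c ((chartAt (Model n) c).symm y) : ℂ) *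
      τ.inChart (chartAt (Model n) c) y (realFrame n)

/-! ### Hermitian metrics -/

variable (n M) in
/-- A Hermitian metric on a complex manifold: a smooth Riemannian metric for which the complex
structure is an isometry. -/
structure HermitianMetric [IsManifold 𝓘(ℂ, Model n) ω M] extends
    Bundle.ContMDiffRiemannianMetric 𝓘(ℝ, Model n) ∞ (Model n)
      (fun x : M => TangentSpace 𝓘(ℝ, Model n) x) where
  inner_J : ∀ (x : M) (u v : TangentSpace 𝓘(ℝ, Model n) x),
    inner x (tangentJ n x u) (tangentJ n x v) = inner x u v

namespace HermitianMetric

variable [IsManifold 𝓘(ℂ, Model n) ω M]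

/-- The Kähler form `ω (u, v) = g (J u, v)` of a Hermitian metric, i.e. `√-1 ∑ φᵢ ∧ conj φᵢ` in
a unitary coframe `φᵢ`. -/
def kahlerForm (g : HermitianMetric n M) : Form n M 2 := fun x =>
  { toFun := fun v => (g.inner x (tangentJ n x (v 0)) (v 1) : ℂ)
    map_update_add' := by
      intro _ v i a b
      fin_cases i <;> simp [Function.update]
    map_update_smul' := by
      intro _ v i c a
      fin_cases i <;> simp [Function.update]
    cont := by
      have h : Continuous fun v : Fin 2 → TangentSpace 𝓘(ℝ, Model n) x =>
          g.inner x (tangentJ n x (v 0)) (v 1) := by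
        have h1 : Continuous fun v : Fin 2 → Model n =>
            (g.inner x : Model n →L[ℝ] Model n →L[ℝ] ℝ) (mulI n (v 0)) :=
          (g.inner x : Model n →L[ℝ] Model n →L[ℝ] ℝ).continuous.comp (by fun_prop)
        have h2 : Continuous fun v : Fin 2 → Model n => v 1 := continuous_apply 1
        exact h1.clm_apply h2
      exact Complex.continuous_ofReal.comp h
    map_eq_zero_of_eq' := by
      intro v i j hv hij
      have h01 : v 0 = v 1 := by fin_cases i <;> fin_cases j <;> simp_all
      have h1 := g.inner_J x (tangentJ n x (v 1)) (v 1)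
      rw [tangentJ_tangentJ, map_neg, neg_apply, g.symm x (v 1)] at h1
      have h2 : g.inner x (tangentJ n x (v 1)) (v 1) = 0 := by linarith
      simp [h01, h2] }

/-- `η` is Gauduchon's torsion 1-form of `g`: the form of type `(1, 0)` such that
`∂ (ω ^ (n - 1)) = - η ∧ ω ^ (n - 1)`. -/
def IsTorsionForm (g : HermitianMetric n M) (η : Form n M 1) : Prop :=
  η.IsType10 ∧ (g.kahlerForm.pow (n - 1)).del =
    -((η.wedge (g.kahlerForm.pow (n - 1))).cast (Nat.add_comm _ _))

/-- Gauduchon's torsion 1-form `η` of a Hermitian metric. -/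
def torsionForm (g : HermitianMetric n M) : Form n M 1 :=
  Classical.epsilon g.IsTorsionForm

/-- A Hermitian metric is balanced if its torsion 1-form vanishes. -/
def IsBalanced (g : HermitianMetric n M) : Prop := g.torsionForm = 0

/-- The equation `√-1 (∂ (conj η) - ∂bar η - η ∧ conj η) = a ω`. -/
def GauduchonEquation (g : HermitianMetric n M) (a : ℝ) : Prop :=
  Complex.I • (g.torsionForm.conj.del - g.torsionForm.delbar -
    g.torsionForm.wedge g.torsionForm.conj) = (a : ℂ) • g.kahlerForm

/-- The Gram matrix of the metric in the real frame of the tangent space at `x`. -/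
def gram (g : HermitianMetric n M) (x : M) : Matrix (Fin (2 * n)) (Fin (2 * n)) ℝ :=
  Matrix.of fun i j => g.inner x (realFrame n i) (realFrame n j)

/-- The squared norm `∑ gⁱʲ αᵢ (conj αⱼ)` of a 1-form at the point `x`. It equals `∑ |αᵢ|²` if
`α = ∑ αᵢ φᵢ` is of type `(1, 0)` and `φᵢ` is a unitary coframe. -/
def normSq (g : HermitianMetric n M) (α : Form n M 1) (x : M) : ℝ :=
  (∑ i, ∑ j, ((g.gram x)⁻¹ i j : ℂ) * α x (fun _ => realFrame n i) *
    (starRingEnd ℂ) (α x (fun _ => realFrame n j))).re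

/-- The volume form `dv = ωⁿ / n!`. -/
def volumeForm (g : HermitianMetric n M) : Form n M (2 * n) :=
  ((n ! : ℂ)⁻¹) • g.kahlerForm.pow n

/-- The metric `g` is a critical point of the functional `F` on the space of all Hermitian metrics,
which is an open convex cone in the space of smooth symmetric `J`-invariant 2-tensors: for every
such tensor `h`, the derivative of `t ↦ F (g + t h)` at `t = 0` vanishes. Here `γ t` is `g + t h`
when `|t|` is small; in particular `γ 0 = g`, and `h` is smooth, symmetric and `J`-invariant. -/
def IsCriticalPoint (F : HermitianMetric n M → ℝ) (g : HermitianMetric n M) : Prop :=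
  ∀ (γ : ℝ → HermitianMetric n M)
    (h : (x : M) → TangentSpace 𝓘(ℝ, Model n) x → TangentSpace 𝓘(ℝ, Model n) x → ℝ),
    (∀ᶠ t in 𝓝 (0 : ℝ), ∀ x u v, (γ t).inner x u v = g.inner x u v + t * h x u v) →
    HasDerivAt (fun t => F (γ t)) 0 0

variable [CompactSpace M] [T2Space M]

/-- The integral `∫ f dv` of a real function. -/
def integral (g : HermitianMetric n M) (f : M → ℝ) : ℝ :=
  (Form.integral fun x => (f x : ℂ) • g.volumeForm x).re

/-- The volume `V = ∫ dv`. -/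
def volume (g : HermitianMetric n M) : ℝ := g.integral fun _ => 1

/-- The Gauduchon functional `𝒢 (g) = V ^ ((1 - n) / n) ∫ |η|² dv`. -/
def gauduchonFunctional (g : HermitianMetric n M) : ℝ :=
  g.volume ^ ((1 - n : ℝ) / n) * g.integral (g.normSq g.torsionForm)

end HermitianMetric

end HermitianGeometry

end

open HermitianGeometry

/-!
Differential forms of all degrees are handled inside one ring: the value of a form at a point is a
function of lists of vectors (`LForm`), and the wedge product becomes the signed shuffle product,
which is associative on the nose. A form on the manifold is then a function `M → LForm (Model n)`,
and wedge products, `d`, `J`, contractions and conjugation obey their usual identities in this ring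
(`toL_wedge`, `fieldD_mul`, `fieldD_fieldD`).

Write `w` for the Kähler form and `θ` for the real 1-form with `d (w ^ (n - 1)) = -θ ∧ w ^ (n - 1)`,
the Lee form. It exists and is unique because the wedge product with `w ^ (n - 1)` is injective on
1-forms. The torsion 1-form is `η = (θ - √-1 J θ) / 2`, so `η = 0` if and only if `θ = 0`, and
`√-1 (∂ (conj η) - ∂bar η - η ∧ conj η) = (θ ∧ J θ - d (J θ) - J d (J θ)) / 2`, the torsion field.

*The equation (i).* The wedge product with `w ^ (n - 1)` followed by integration (Stokes) turns the
equation into `a ∫ w ^ n = -½ ∫ θ ∧ J θ ∧ w ^ (n - 1)`, and the right side is a positive multiple of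
`∫ |θ|² dv`. Hence `a ≥ 0`, and `a = 0` gives `θ = 0`. If `a > 0`, then the equation says that the
exact form `Φ = -d (J θ)` has `Φ (v, J v) > 0` for all `v ≠ 0`. A form with this property has
positive top power (it is nondegenerate, and it can be deformed linearly into the standard Kähler
form through forms of the same kind), while `∫ Φ ^ n = 0` by Stokes (`lee_eq_zero_of_torsion`).

*Critical points (ii).* For a metric with Kähler form `w'` and Lee form `θ'`, expanding
`|θ' - θ|² ≥ 0` gives `-∫ θ' ∧ J θ' ∧ w' ^ (n - 1) ≥ ∫ (θ ∧ J θ - 2 d (J θ)) ∧ w' ^ (n - 1)`,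
with equality for `w' = w` (`le_fieldInt_norm_lee`). Along `w' = w + t χ` the right side is a
polynomial in `t`, so the functional is bounded below by an explicit differentiable function that
it touches at `t = 0`; the derivatives agree, and no derivative of `θ'` in `t` is needed. The
outcome is that the difference `Ψ` of the torsion field and a constant multiple of `w` satisfies
`∫ Ψ ∧ w ^ (n - 2) ∧ χ = 0` for all real `J`-invariant `χ`. With `Ψ ∧ w ^ (n - 1) = f w ^ n`, the
choice `χ = 2 f w - Ψ` makes the integrand pointwise nonnegative: this is the Hodge-Riemann
inequality for the primitive form `Ψ - f w`. It follows that `Ψ = 0`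
(`eq_zero_of_fieldInt_pairing`), which is the equation in (i), and therefore `θ = 0`.
-/

noncomputable section

namespace HermitianGeometry

/-! ### The signed shuffle algebra -/

/-- Complex valued functions of finitely many vectors, of all degrees at once. Alternating forms
of all degrees embed into this type, and with the signed shuffle product below the wedge product
becomes an honest associative ring multiplication, without casts between degrees. -/
structure LForm (V : Type*) where
  /-- The values of the form. -/
  toFun : List V → ℂ

namespace LForm

variable {V W : Type*}

instance : FunLike (LForm V) (List V) ℂ where
  coe := toFun
  coe_injective := fun f g h => by cases f; cases g; congr

@[ext] theorem ext {f g : LForm V} (h : ∀ l, f l = g l) : f = g := DFunLike.ext f g h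

@[simp] theorem mk_apply (f : List V → ℂ) (l : List V) : (⟨f⟩ : LForm V) l = f l := rfl

instance : Zero (LForm V) := ⟨⟨0⟩⟩
instance : Add (LForm V) := ⟨fun f g => ⟨f + g⟩⟩
instance : Neg (LForm V) := ⟨fun f => ⟨-f⟩⟩
instance : Sub (LForm V) := ⟨fun f g => ⟨f - g⟩⟩
instance : SMul ℂ (LForm V) := ⟨fun c f => ⟨c • f⟩⟩

@[simp] theorem add_apply (f g : LForm V) (l : List V) : (f + g) l = f l + g l := rfl
@[simp] theorem sub_apply (f g : LForm V) (l : List V) : (f - g) l = f l - g l := rfl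
@[simp] theorem neg_apply (f : LForm V) (l : List V) : (-f) l = -f l := rfl
@[simp] theorem zero_apply (l : List V) : (0 : LForm V) l = 0 := rfl
@[simp] theorem smul_apply (c : ℂ) (f : LForm V) (l : List V) : (c • f) l = c * f l := rfl

instance : AddCommGroup (LForm V) where
  add_assoc f g h := by ext l; simp [add_assoc]
  zero_add f := by ext l; simp
  add_zero f := by ext l; simp
  add_comm f g := by ext l; simp [add_comm]
  neg_add_cancel f := by ext l; simp
  sub_eq_add_neg f g := by ext l; simp [sub_eq_add_neg]
  nsmul := nsmulRec
  zsmul := zsmulRec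

instance : Module ℂ (LForm V) where
  one_smul f := by ext l; simp
  mul_smul c d f := by ext l; simp [mul_assoc]
  smul_zero c := by ext l; simp
  smul_add c f g := by ext l; simp [mul_add]
  add_smul c d f := by ext l; simp [add_mul]
  zero_smul f := by ext l; simp

/-- The interior product: insertion of `v` as the first argument. -/
def ι (v : V) (f : LForm V) : LForm V := ⟨fun l => f (v :: l)⟩

/-- The grading involution, `(-1) ^ k` in degree `k`. -/
def hat (f : LForm V) : LForm V := ⟨fun l => (-1) ^ l.length * f l⟩

theorem ι_apply (v : V) (f : LForm V) (l : List V) : ι v f l = f (v :: l) := rfl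
theorem hat_apply (f : LForm V) (l : List V) : hat f l = (-1) ^ l.length * f l := rfl

@[simp] theorem ι_add (v : V) (f g : LForm V) : ι v (f + g) = ι v f + ι v g := rfl
@[simp] theorem ι_neg (v : V) (f : LForm V) : ι v (-f) = -ι v f := rfl
@[simp] theorem ι_zero (v : V) : ι v (0 : LForm V) = 0 := rfl
@[simp] theorem ι_smul (v : V) (c : ℂ) (f : LForm V) : ι v (c • f) = c • ι v f := rfl

@[simp] theorem hat_add (f g : LForm V) : hat (f + g) = hat f + hat g := by
  ext l; simp [hat_apply, mul_add]
@[simp] theorem hat_smul (c : ℂ) (f : LForm V) : hat (c • f) = c • hat f := by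
  ext l; simp [hat_apply]; ring
@[simp] theorem hat_hat (f : LForm V) : hat (hat f) = f := by
  ext l
  rw [hat_apply, hat_apply, ← mul_assoc, ← mul_pow]
  simp
theorem ι_hat (v : V) (f : LForm V) : ι v (hat f) = -hat (ι v f) := by
  ext l; simp [ι_apply, hat_apply, pow_succ]

/-- The signed shuffle product, by recursion on the list of arguments: the interior product is an
antiderivation. -/
def mulAux : List V → LForm V → LForm V → ℂ
  | [], f, g => f [] * g []
  | v :: l, f, g => mulAux l (ι v f) g + mulAux l (hat f) (ι v g)

instance : Mul (LForm V) := ⟨fun f g => ⟨fun l => mulAux l f g⟩⟩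
instance : One (LForm V) := ⟨⟨fun l => if l = [] then 1 else 0⟩⟩

@[simp] theorem mul_nil (f g : LForm V) : (f * g) [] = f [] * g [] := rfl

theorem mul_cons (f g : LForm V) (v : V) (l : List V) :
    (f * g) (v :: l) = (ι v f * g) l + (hat f * ι v g) l := rfl

theorem ι_mul (v : V) (f g : LForm V) : ι v (f * g) = ι v f * g + hat f * ι v g := rfl

@[simp] theorem one_nil : (1 : LForm V) [] = 1 := rfl
@[simp] theorem one_cons (v : V) (l : List V) : (1 : LForm V) (v :: l) = 0 := rfl
@[simp] theorem ι_one (v : V) : ι v (1 : LForm V) = 0 := rfl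
@[simp] theorem hat_one : hat (1 : LForm V) = 1 := by
  ext l; cases l <;> simp [hat_apply]

theorem add_mul_apply (l : List V) : ∀ f g h : LForm V,
    ((f + g) * h) l = (f * h) l + (g * h) l := by
  induction l with
  | nil => intro f g h; simp [add_mul]
  | cons v l ih => intro f g h; simp only [mul_cons, ι_add, hat_add, ih]; ring

theorem mul_add_apply (l : List V) : ∀ f g h : LForm V,
    (f * (g + h)) l = (f * g) l + (f * h) l := by
  induction l with
  | nil => intro f g h; simp [mul_add]
  | cons v l ih => intro f g h; simp only [mul_cons, ι_add, ih]; ring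

theorem smul_mul_apply (c : ℂ) (l : List V) : ∀ f g : LForm V,
    ((c • f) * g) l = c * (f * g) l := by
  induction l with
  | nil => intro f g; simp [mul_assoc]
  | cons v l ih => intro f g; simp only [mul_cons, ι_smul, hat_smul, ih]; ring

theorem mul_smul_apply (c : ℂ) (l : List V) : ∀ f g : LForm V,
    (f * (c • g)) l = c * (f * g) l := by
  induction l with
  | nil => intro f g; simp; ring
  | cons v l ih => intro f g; simp only [mul_cons, ι_smul, ih]; ring

theorem zero_mul_apply (l : List V) (f : LForm V) : (0 * f : LForm V) l = 0 := by
  have h := smul_mul_apply 0 l (0 : LForm V) f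
  rwa [zero_smul, zero_mul] at h

theorem mul_zero_apply (l : List V) (f : LForm V) : (f * 0 : LForm V) l = 0 := by
  have h := mul_smul_apply 0 l f (0 : LForm V)
  rwa [zero_smul, zero_mul] at h

theorem one_mul_apply (l : List V) : ∀ f : LForm V, (1 * f : LForm V) l = f l := by
  induction l with
  | nil => intro f; simp
  | cons v l ih => intro f; rw [mul_cons, ι_one, hat_one, ih, zero_mul_apply, zero_add]; rfl

theorem mul_one_apply (l : List V) : ∀ f : LForm V, (f * 1 : LForm V) l = f l := by
  induction l with
  | nil => intro f; simp
  | cons v l ih => intro f; rw [mul_cons, ι_one, ih, mul_zero_apply, add_zero]; rfl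

theorem hat_mul_apply (l : List V) : ∀ f g : LForm V,
    hat (f * g) l = (hat f * hat g) l := by
  induction l with
  | nil => intro f g; simp [hat_apply]
  | cons v l ih =>
    intro f g
    have h : hat (f * g) (v :: l) = -hat (ι v (f * g)) l :=
      DFunLike.congr_fun (ι_hat v (f * g)) l
    have h1 (a b : LForm V) : (-a * b) l = -(a * b) l := by
      rw [← neg_one_smul ℂ a, smul_mul_apply, neg_one_mul]
    have h2 (a b : LForm V) : (a * -b) l = -(a * b) l := by
      rw [← neg_one_smul ℂ b, mul_smul_apply, neg_one_mul]
    rw [h, ι_mul, hat_add, add_apply, ih, ih, mul_cons, ι_hat, ι_hat, h1, h2]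
    ring

theorem mul_assoc_apply (l : List V) : ∀ f g h : LForm V,
    (f * g * h) l = (f * (g * h)) l := by
  induction l with
  | nil => intro f g h; simp [mul_assoc]
  | cons v l ih =>
    intro f g h
    have hfg : hat (f * g) = hat f * hat g := by ext l; exact hat_mul_apply l f g
    simp only [mul_cons, ι_mul, add_mul_apply, mul_add_apply, ih, hfg]
    ring

instance : Ring (LForm V) :=
  { (inferInstance : AddCommGroup (LForm V)), (inferInstance : Mul (LForm V)),
    (inferInstance : One (LForm V)) with
    left_distrib := fun f g h => by ext l; exact mul_add_apply l f g h
    right_distrib := fun f g h => by ext l; exact add_mul_apply l f g h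
    zero_mul := fun f => by ext l; exact zero_mul_apply l f
    mul_zero := fun f => by ext l; exact mul_zero_apply l f
    mul_assoc := fun f g h => by ext l; exact mul_assoc_apply l f g h
    one_mul := fun f => by ext l; exact one_mul_apply l f
    mul_one := fun f => by ext l; exact mul_one_apply l f }

instance : Algebra ℂ (LForm V) :=
  Algebra.ofModule (fun c f g => by ext l; exact smul_mul_apply c l f g)
    (fun c f g => by ext l; exact mul_smul_apply c l f g)

theorem hat_mul (f g : LForm V) : hat (f * g) = hat f * hat g := by
  ext l; exact hat_mul_apply l f g

theorem sum_apply {κ : Type*} (s : Finset κ) (f : κ → LForm V) (l : List V) :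
    (∑ i ∈ s, f i) l = ∑ i ∈ s, f i l := by
  classical
  induction s using Finset.induction_on with
  | empty => simp
  | insert a s ha ih => rw [Finset.sum_insert ha, Finset.sum_insert ha, add_apply, ih]

theorem comm_apply (l : List V) : ∀ f g : LForm V,
    (hat f = f → (f * g) l = (g * f) l) ∧ (hat f = -f → (f * g) l = (hat g * f) l) := by
  induction l with
  | nil => intro f g; simp [hat_apply, mul_comm]
  | cons v l ih =>
    intro f g
    refine ⟨fun hf => ?_, fun hf => ?_⟩
    · have h1 : hat (ι v f) = -ι v f := by rw [← neg_eq_iff_eq_neg, ← ι_hat, hf]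
      rw [mul_cons, mul_cons, (ih _ g).2 h1, hf, (ih f _).1 hf, add_comm]
    · have h1 : hat (ι v f) = ι v f := by
        have := ι_hat v f
        rw [hf, ι_neg, neg_inj] at this
        exact this.symm
      rw [mul_cons, mul_cons, (ih _ g).1 h1, hf, hat_hat, ι_hat, neg_mul, neg_mul, neg_apply,
        neg_apply, (ih f _).2 hf, add_comm]

/-- Even elements are central. -/
theorem mul_comm_of_even {f : LForm V} (hf : hat f = f) (g : LForm V) : f * g = g * f := by
  ext l; exact (comm_apply l f g).1 hf

theorem mul_comm_of_odd {f : LForm V} (hf : hat f = -f) (g : LForm V) : f * g = hat g * f := by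
  ext l; exact (comm_apply l f g).2 hf

theorem hat_pow_of_even {f : LForm V} (hf : hat f = f) (k : ℕ) : hat (f ^ k) = f ^ k := by
  induction k with
  | zero => simp
  | succ k ih => rw [pow_succ, hat_mul, ih, hf]

theorem mul_self_of_odd {f : LForm V} (hf : hat f = -f) : f * f = 0 := by
  have h := mul_comm_of_odd hf f
  rw [hf, neg_mul] at h
  ext l
  have := DFunLike.congr_fun h l
  exact self_eq_neg.1 this

theorem ι_pow {f : LForm V} (hf : hat f = f) (v : V) (k : ℕ) :
    ι v (f ^ (k + 1)) = (k + 1 : ℂ) • (ι v f * f ^ k) := by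
  induction k with
  | zero => simp
  | succ k ih =>
    rw [pow_succ f (k + 1), ι_mul, ih, hat_pow_of_even hf,
      mul_comm_of_even (hat_pow_of_even hf (k + 1)), smul_mul_assoc, mul_assoc, ← pow_succ]
    push_cast
    module

/-! #### Degrees and functoriality -/

/-- `f` is homogeneous of degree `k`. -/
def HasDegree (k : ℕ) (f : LForm V) : Prop := ∀ l, l.length ≠ k → f l = 0

theorem HasDegree.hat_eq {k : ℕ} {f : LForm V} (hf : HasDegree k f) : hat f = (-1 : ℂ) ^ k • f := by
  ext l
  by_cases h : l.length = k
  · simp [hat_apply, h]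
  · simp [hat_apply, hf l h]

theorem HasDegree.hat_of_even {k : ℕ} {f : LForm V} (hf : HasDegree k f) (hk : Even k) :
    hat f = f := by rw [hf.hat_eq, hk.neg_one_pow, one_smul]

theorem HasDegree.hat_of_odd {k : ℕ} {f : LForm V} (hf : HasDegree k f) (hk : Odd k) :
    hat f = -f := by rw [hf.hat_eq, hk.neg_one_pow, neg_one_smul]

theorem HasDegree.ext {k : ℕ} {f g : LForm V} (hf : f.HasDegree k) (hg : g.HasDegree k)
    (h : ∀ v : Fin k → V, f (List.ofFn v) = g (List.ofFn v)) : f = g := by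
  ext l
  by_cases hl : l.length = k
  · subst hl
    simpa using h l.get
  · rw [hf l hl, hg l hl]

theorem HasDegree.mul {k l : ℕ} {f g : LForm V} (hf : f.HasDegree k) (hg : g.HasDegree l) :
    (f * g).HasDegree (k + l) := by
  intro L
  induction L generalizing f g k l with
  | nil =>
    intro h
    rw [mul_nil]
    by_cases hk : k = 0
    · rw [hg [] (by simp at h ⊢; omega), mul_zero]
    · rw [hf [] (by simp; omega), zero_mul]
  | cons v L ih =>
    intro h
    have h1 {f : LForm V} {k : ℕ} (hf : f.HasDegree (k + 1)) : (ι v f).HasDegree k :=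
      fun l' hl' => hf _ (by simpa using hl')
    have h2 : (hat f).HasDegree k := fun l' hl' => by
      rw [hat_apply, hf l' hl', mul_zero]
    have h3 {f : LForm V} (hf : f.HasDegree 0) : ι v f = 0 := by
      ext l'; exact hf _ (by simp)
    rw [mul_cons]
    have e1 : (ι v f * g) L = 0 := by
      cases k with
      | zero => rw [h3 hf, zero_mul]; rfl
      | succ k => exact ih (h1 hf) hg (by simp at h; omega)
    have e2 : (hat f * ι v g) L = 0 := by
      cases l with
      | zero => rw [h3 hg, mul_zero]; rfl
      | succ l => exact ih h2 (h1 hg) (by simp at h; omega)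
    rw [e1, e2, add_zero]

/-- A form of degree one that vanishes on all arguments kills every product with it. -/
theorem mul_apply_eq_zero {f : LForm V} (hf : HasDegree 1 f) :
    ∀ (l : List V), (∀ v ∈ l, f [v] = 0) → ∀ g, (f * g) l = 0 := by
  intro l
  induction l with
  | nil => intro _ g; simp [hf [] (by simp)]
  | cons v l ih =>
    intro h g
    have h1 : ι v f = 0 := by
      ext l'
      cases l' with
      | nil => exact h v (by simp)
      | cons w l' => exact hf _ (by simp)
    rw [mul_cons, h1, zero_mul, hf.hat_of_odd odd_one, neg_mul, neg_apply,
      ih (fun w hw => h w (by simp [hw]))]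
    simp

theorem ι_of_degree_one {f : LForm V} (hf : HasDegree 1 f) (v : V) :
    ι v f = f [v] • (1 : LForm V) := by
  ext l
  cases l with
  | nil => simp [ι_apply]
  | cons w l => simpa [ι_apply] using hf _ (by simp)

/-- The pullback of a form under a map of vectors. -/
def map (A : V → W) (f : LForm W) : LForm V := ⟨fun l => f (l.map A)⟩

theorem map_apply (A : V → W) (f : LForm W) (l : List V) : map A f l = f (l.map A) := rfl

theorem map_mul_apply (A : V → W) (l : List V) : ∀ f g : LForm W,
    map A (f * g) l = (map A f * map A g) l := by
  induction l with
  | nil => intro f g; rfl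
  | cons v l ih =>
    intro f g
    have h1 (f : LForm W) : ι v (map A f) = map A (ι (A v) f) := rfl
    have h2 : hat (map A f) = map A (hat f) := by ext l; simp [hat_apply, map_apply]
    rw [mul_cons, h1, h1, h2, ← ih, ← ih]
    rfl

/-- The pullback as a homomorphism of algebras. -/
def mapHom (A : V → W) : LForm W →ₐ[ℂ] LForm V where
  toFun := map A
  map_one' := by ext l; cases l <;> rfl
  map_mul' f g := by ext l; exact map_mul_apply A l f g
  map_zero' := rfl
  map_add' f g := rfl
  commutes' c := by
    rw [Algebra.algebraMap_eq_smul_one, Algebra.algebraMap_eq_smul_one]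
    ext l; cases l <;> rfl

@[simp] theorem mapHom_apply (A : V → W) (f : LForm W) (l : List V) :
    mapHom A f l = f (l.map A) := rfl

theorem hat_mapHom (A : V → W) (f : LForm W) : hat (mapHom A f) = mapHom A (hat f) := by
  ext l; simp [hat_apply]

/-- Complex conjugation of the values, as a ring homomorphism. -/
def conjHom : LForm V →+* LForm V where
  toFun f := ⟨fun l => starRingEnd ℂ (f l)⟩
  map_one' := by ext l; cases l <;> simp
  map_zero' := by ext l; simp
  map_add' f g := by ext l; exact map_add (starRingEnd ℂ) (f l) (g l)
  map_mul' f g := by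
    ext l
    induction l generalizing f g with
    | nil => simp
    | cons v l ih =>
      have h : hat (⟨fun l => starRingEnd ℂ (f l)⟩ : LForm V) =
          ⟨fun l => starRingEnd ℂ (hat f l)⟩ := by ext l; simp [hat_apply]
      simp only [mk_apply] at ih
      rw [mk_apply, mul_cons, mul_cons, map_add, ih, ih, h]
      rfl

@[simp] theorem conjHom_apply (f : LForm V) (l : List V) :
    conjHom f l = starRingEnd ℂ (f l) := rfl

/-- If the values of two families of forms on every list lie in a subring of the ring of functions
of the parameter, then so do the values of the product. -/
theorem mul_apply_mem {S : Type*} (A : Subring (S → ℂ)) (l : List V) : ∀ f g : S → LForm V,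
    (∀ l, (fun s => f s l) ∈ A) → (∀ l, (fun s => g s l) ∈ A) → (fun s => (f s * g s) l) ∈ A := by
  induction l with
  | nil => intro f g hf hg; exact A.mul_mem (hf []) (hg [])
  | cons v l ih =>
    intro f g hf hg
    refine A.add_mem (ih _ _ (fun l => hf (v :: l)) hg) (ih _ _ (fun l => ?_) fun l => hg (v :: l))
    have h : (fun s => hat (f s) l) = (-1) ^ l.length * fun s => f s l := by
      funext s; simp [hat_apply]
    rw [h]
    exact A.mul_mem (A.pow_mem (A.neg_mem A.one_mem) _) (hf l)

theorem pow_apply_mem {S : Type*} (A : Subring (S → ℂ)) (f : S → LForm V)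
    (hf : ∀ l, (fun s => f s l) ∈ A) (k : ℕ) (l : List V) : (fun s => (f s ^ k) l) ∈ A := by
  induction k generalizing l with
  | zero =>
    cases l with
    | nil => exact A.one_mem
    | cons v l => exact A.zero_mem
  | succ k ih =>
    simp_rw [pow_succ]
    exact mul_apply_mem A l _ _ ih hf

end LForm

/-! ### Alternating forms as elements of the shuffle algebra -/

theorem sum_perm_succ {m : ℕ} (f : Equiv.Perm (Fin (m + 1)) → ℂ) :
    ∑ σ, f σ = ∑ i : Fin (m + 1), ∑ τ : Equiv.Perm (Fin m),
      f (Equiv.Perm.decomposeFin.symm (0, τ) * i.cycleRange) := by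
  have h0 (τ : Equiv.Perm (Fin m)) : Equiv.Perm.decomposeFin.symm (0, τ) 0 = 0 := by simp
  rw [← Fintype.sum_prod_type']
  symm
  refine Function.Bijective.sum_comp
    (e := fun q : Fin (m + 1) × Equiv.Perm (Fin m) =>
      Equiv.Perm.decomposeFin.symm (0, q.2) * q.1.cycleRange) ?_ f
  rw [Fintype.bijective_iff_injective_and_card]
  constructor
  · rintro ⟨i, τ⟩ ⟨j, ρ⟩ h
    simp only at h
    have hij : i = j := by
      have h1 := congrArg (fun σ : Equiv.Perm (Fin (m + 1)) => σ i) h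
      simp only [Equiv.Perm.mul_apply, Fin.cycleRange_self, h0] at h1
      have h2 : j.cycleRange i = 0 := by
        apply (Equiv.Perm.decomposeFin.symm (0, ρ)).injective
        rw [← h1, h0]
      have h3 : j.cycleRange i = j.cycleRange j := by rw [h2, Fin.cycleRange_self]
      exact j.cycleRange.injective h3
    subst hij
    have h2 := Equiv.Perm.decomposeFin.symm.injective (mul_right_cancel h)
    simpa using h2
  · simp [Fintype.card_perm, Nat.factorial_succ]

section

variable {V : Type*} [AddCommGroup V] [Module ℝ V] [TopologicalSpace V] {k l : ℕ}

/-- An alternating form of degree `k` as an element of the shuffle algebra. -/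
def toL (α : V [⋀^Fin k]→L[ℝ] ℂ) : LForm V :=
  ⟨fun l => if h : l.length = k then α fun i => l.get (i.cast h.symm) else 0⟩

theorem toL_hasDegree (α : V [⋀^Fin k]→L[ℝ] ℂ) : (toL α).HasDegree k := fun l hl => by
  simp [toL, hl]

theorem toL_ofFn (α : V [⋀^Fin k]→L[ℝ] ℂ) (v : Fin k → V) : toL α (List.ofFn v) = α v := by
  have h : (List.ofFn v).length = k := by simp
  simp only [toL, LForm.mk_apply, dif_pos h]
  congr 1
  ext i
  simp

theorem LForm.ι_toL_succ (α : V [⋀^Fin (k + 1)]→L[ℝ] ℂ) (v : V) (w : Fin k → V) :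
    LForm.ι v (toL α) (List.ofFn w) = α (Matrix.vecCons v w) := by
  rw [LForm.ι_apply, ← toL_ofFn α, List.ofFn_succ]
  rfl

/-- The contraction of a form with a vector. -/
def curryVec (α : V [⋀^Fin (k + 1)]→L[ℝ] ℂ) (v : V) : V [⋀^Fin k]→L[ℝ] ℂ :=
  { α.toAlternatingMap.curryLeft v with
    cont := α.cont.comp (by
      refine continuous_pi fun i => ?_
      refine Fin.cases ?_ (fun j => ?_) i
      · exact continuous_const
      · exact continuous_apply j) }

theorem curryVec_apply (α : V [⋀^Fin (k + 1)]→L[ℝ] ℂ) (v : V) (w : Fin k → V) :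
    curryVec α v w = α (Matrix.vecCons v w) := rfl

theorem ι_toL (α : V [⋀^Fin (k + 1)]→L[ℝ] ℂ) (v : V) : LForm.ι v (toL α) = toL (curryVec α v) := by
  refine LForm.HasDegree.ext (k := k) (fun l' hl' => ?_) (toL_hasDegree _) fun w => ?_
  · exact toL_hasDegree α _ (by simpa using hl')
  · rw [LForm.ι_toL_succ, toL_ofFn, curryVec_apply]

theorem ι_toL_zero (α : V [⋀^Fin 0]→L[ℝ] ℂ) (v : V) : LForm.ι v (toL α) = 0 := by
  ext l'; exact toL_hasDegree α (v :: l') (by simp)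

theorem map_insertNth' (α : V [⋀^Fin (k + 1)]→L[ℝ] ℂ) (p : Fin (k + 1)) (x : V) (v : Fin k → V) :
    α (p.insertNth x v) = (-1) ^ (p : ℕ) * α (Matrix.vecCons x v) := by
  have h := α.toAlternatingMap.map_insertNth p x v
  simpa [zsmul_eq_mul] using h

/-- The expansion of the shuffle product of two alternating forms over permutations. The induction
follows the recursion of the shuffle product: permutations are sorted by the position at which the
first vector ends up, among the arguments of `α` or among those of `β`. -/
theorem toL_mul_toL_apply : ∀ (m k l : ℕ) (h : k + l = m) (α : V [⋀^Fin k]→L[ℝ] ℂ)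
    (β : V [⋀^Fin l]→L[ℝ] ℂ) (v : Fin m → V),
    (k ! : ℂ) * l ! * (toL α * toL β) (List.ofFn v) =
      ∑ σ : Equiv.Perm (Fin m), ((Equiv.Perm.sign σ : ℤ) : ℂ) *
        (α (fun i => v (σ (Fin.cast h (Fin.castAdd l i)))) *
          β (fun j => v (σ (Fin.cast h (Fin.natAdd k j))))) := by
  intro m
  induction m with
  | zero =>
    intro k l h α β v
    obtain ⟨rfl, rfl⟩ : k = 0 ∧ l = 0 := by omega
    have h1 (α : V [⋀^Fin 0]→L[ℝ] ℂ) (w : Fin 0 → V) : toL α [] = α w := by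
      rw [← toL_ofFn α w, List.ofFn_zero]
    simp [h1 α (fun i => v (Fin.cast h (Fin.castAdd 0 i))),
      h1 β (fun i => v (Fin.cast h (Fin.natAdd 0 i)))]
  | succ m ih =>
    intro k l h α β v
    rw [sum_perm_succ]
    have hsign (i : Fin (m + 1)) (τ : Equiv.Perm (Fin m)) :
        ((Equiv.Perm.sign (Equiv.Perm.decomposeFin.symm (0, τ) * i.cycleRange) : ℤ) : ℂ) =
          (-1) ^ (i : ℕ) * ((Equiv.Perm.sign τ : ℤ) : ℂ) := by
      rw [Equiv.Perm.sign_mul, Fin.sign_cycleRange]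
      simp [mul_comm]
    have harg (i : Fin (m + 1)) (τ : Equiv.Perm (Fin m)) :
        (fun q => v ((Equiv.Perm.decomposeFin.symm (0, τ) * i.cycleRange) q)) =
          i.insertNth (α := fun _ => V) (v 0) (fun j => v (τ j).succ) := by
      funext q
      refine Fin.succAboveCases i ?_ (fun j => ?_) q
      · simp
      · simp
    have hsum (F : Fin (m + 1) → ℂ) :
        ∑ i, F i = (∑ p : Fin k, F (Fin.cast h (Fin.castAdd l p))) +
          ∑ p : Fin l, F (Fin.cast h (Fin.natAdd k p)) := by
      rw [← Fin.sum_univ_add (fun i => F (Fin.cast h i))]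
      exact (Equiv.sum_comp (finCongr h) F).symm
    rw [hsum]
    have e1 : (∑ p : Fin k, ∑ τ : Equiv.Perm (Fin m),
        ((Equiv.Perm.sign (Equiv.Perm.decomposeFin.symm (0, τ) *
          (Fin.cast h (Fin.castAdd l p)).cycleRange) : ℤ) : ℂ) *
        (α (fun i => v ((Equiv.Perm.decomposeFin.symm (0, τ) *
          (Fin.cast h (Fin.castAdd l p)).cycleRange) (Fin.cast h (Fin.castAdd l i)))) *
          β (fun j => v ((Equiv.Perm.decomposeFin.symm (0, τ) *
          (Fin.cast h (Fin.castAdd l p)).cycleRange) (Fin.cast h (Fin.natAdd k j)))))) =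
        (k ! : ℂ) * l ! * (LForm.ι (v 0) (toL α) * toL β) (List.ofFn fun j => v j.succ) := by
      cases k with
      | zero => rw [ι_toL_zero]; simp
      | succ k =>
        have h' : k + l = m := by omega
        rw [ι_toL]
        have ih' := ih k l h' (curryVec α (v 0)) β (fun j => v j.succ)
        rw [Nat.factorial_succ, Nat.cast_mul, mul_assoc ((k + 1 : ℕ) : ℂ), mul_assoc, ih',
          ← nsmul_eq_mul]
        have hc (x : ℂ) : (k + 1) • x = ∑ _p : Fin (k + 1), x := by simp
        rw [hc]
        refine Finset.sum_congr rfl fun p _ => Finset.sum_congr rfl fun τ _ => ?_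
        rw [hsign]
        have a1 : (fun i => v ((Equiv.Perm.decomposeFin.symm (0, τ) *
            (Fin.cast h (Fin.castAdd l p)).cycleRange) (Fin.cast h (Fin.castAdd l i)))) =
            p.insertNth (α := fun _ => V) (v 0)
              (fun j => v (τ (Fin.cast h' (Fin.castAdd l j))).succ) := by
          funext q
          refine (congrFun (harg (Fin.cast h (Fin.castAdd l p)) τ)
            (Fin.cast h (Fin.castAdd l q))).trans ?_
          refine Fin.succAboveCases p ?_ (fun j => ?_) q
          · simp
          · have : Fin.cast h (Fin.castAdd l (p.succAbove j)) =
                (Fin.cast h (Fin.castAdd l p)).succAbove (Fin.cast h' (Fin.castAdd l j)) := by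
              ext; simp [Fin.succAbove, Fin.lt_def]; split_ifs <;> simp
            rw [this]; simp
        have a2 : (fun j => v ((Equiv.Perm.decomposeFin.symm (0, τ) *
            (Fin.cast h (Fin.castAdd l p)).cycleRange) (Fin.cast h (Fin.natAdd (k + 1) j)))) =
            (fun j => v (τ (Fin.cast h' (Fin.natAdd k j))).succ) := by
          funext q
          refine (congrFun (harg (Fin.cast h (Fin.castAdd l p)) τ)
            (Fin.cast h (Fin.natAdd (k + 1) q))).trans ?_
          have : Fin.cast h (Fin.natAdd (k + 1) q) =
                (Fin.cast h (Fin.castAdd l p)).succAbove (Fin.cast h' (Fin.natAdd k q)) := by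
              ext; simp [Fin.succAbove, Fin.lt_def]; split_ifs <;> simp <;> omega
          rw [this]; simp
        rw [a1, a2, map_insertNth', curryVec_apply]
        -- The sign of the permutation cancels the sign of moving `v 0` to the front.
        have : ((-1 : ℂ) ^ (p : ℕ)) * (-1) ^ (p : ℕ) = 1 := by rw [← mul_pow]; simp
        simp only [Fin.val_cast, Fin.val_castAdd]
        linear_combination (((Equiv.Perm.sign τ : ℤ) : ℂ) * (α (Matrix.vecCons (v 0)
          fun j => v (τ (Fin.cast h' (Fin.castAdd l j))).succ) *
            β fun j => v (τ (Fin.cast h' (Fin.natAdd k j))).succ)) * this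
    have e2 : (∑ p : Fin l, ∑ τ : Equiv.Perm (Fin m),
        ((Equiv.Perm.sign (Equiv.Perm.decomposeFin.symm (0, τ) *
          (Fin.cast h (Fin.natAdd k p)).cycleRange) : ℤ) : ℂ) *
        (α (fun i => v ((Equiv.Perm.decomposeFin.symm (0, τ) *
          (Fin.cast h (Fin.natAdd k p)).cycleRange) (Fin.cast h (Fin.castAdd l i)))) *
          β (fun j => v ((Equiv.Perm.decomposeFin.symm (0, τ) *
          (Fin.cast h (Fin.natAdd k p)).cycleRange) (Fin.cast h (Fin.natAdd k j)))))) =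
        (k ! : ℂ) * l ! * (LForm.hat (toL α) * LForm.ι (v 0) (toL β))
          (List.ofFn fun j => v j.succ) := by
      rw [(toL_hasDegree α).hat_eq, smul_mul_assoc, LForm.smul_apply]
      cases l with
      | zero => rw [ι_toL_zero]; simp
      | succ l =>
        have h' : k + l = m := by omega
        rw [ι_toL]
        have ih' := ih k l h' α (curryVec β (v 0)) (fun j => v j.succ)
        have e3 : (k ! : ℂ) * ((l + 1) ! : ℕ) * ((-1) ^ k * (toL α * toL (curryVec β (v 0)))
            (List.ofFn fun j => v j.succ)) = ((l + 1 : ℕ) : ℂ) * ((-1) ^ k * ((k ! : ℂ) * l ! *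
              (toL α * toL (curryVec β (v 0))) (List.ofFn fun j => v j.succ))) := by
          rw [Nat.factorial_succ, Nat.cast_mul]; ring
        rw [e3, ih', ← nsmul_eq_mul]
        have hc (x : ℂ) : (l + 1) • x = ∑ _p : Fin (l + 1), x := by simp
        rw [hc]
        refine Finset.sum_congr rfl fun p _ => ?_
        rw [Finset.mul_sum]
        refine Finset.sum_congr rfl fun τ _ => ?_
        rw [hsign]
        have a1 : (fun j => v ((Equiv.Perm.decomposeFin.symm (0, τ) *
            (Fin.cast h (Fin.natAdd k p)).cycleRange) (Fin.cast h (Fin.natAdd k j)))) =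
            p.insertNth (α := fun _ => V) (v 0)
              (fun j => v (τ (Fin.cast h' (Fin.natAdd k j))).succ) := by
          funext q
          refine (congrFun (harg (Fin.cast h (Fin.natAdd k p)) τ)
            (Fin.cast h (Fin.natAdd k q))).trans ?_
          refine Fin.succAboveCases p ?_ (fun j => ?_) q
          · simp
          · have : Fin.cast h (Fin.natAdd k (p.succAbove j)) =
                (Fin.cast h (Fin.natAdd k p)).succAbove (Fin.cast h' (Fin.natAdd k j)) := by
              ext; simp [Fin.succAbove, Fin.lt_def]; split_ifs <;> simp; omega
            rw [this]; simp
        have a2 : (fun i => v ((Equiv.Perm.decomposeFin.symm (0, τ) *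
            (Fin.cast h (Fin.natAdd k p)).cycleRange) (Fin.cast h (Fin.castAdd (l + 1) i)))) =
            (fun j => v (τ (Fin.cast h' (Fin.castAdd l j))).succ) := by
          funext q
          refine (congrFun (harg (Fin.cast h (Fin.natAdd k p)) τ)
            (Fin.cast h (Fin.castAdd (l + 1) q))).trans ?_
          have : Fin.cast h (Fin.castAdd (l + 1) q) =
                (Fin.cast h (Fin.natAdd k p)).succAbove (Fin.cast h' (Fin.castAdd l q)) := by
              ext; simp [Fin.succAbove, Fin.lt_def]; split_ifs <;> simp; omega
          rw [this]; simp
        rw [a1, a2, map_insertNth', curryVec_apply]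
        -- The sign of the permutation cancels the sign of moving `v 0` to the front.
        have : ((-1 : ℂ) ^ (p : ℕ)) * (-1) ^ (p : ℕ) = 1 := by rw [← mul_pow]; simp
        simp only [Fin.val_cast, Fin.val_natAdd, pow_add]
        linear_combination ((-1) ^ k * ((Equiv.Perm.sign τ : ℤ) : ℂ) *
          (β (Matrix.vecCons (v 0) fun j => v (τ (Fin.cast h' (Fin.natAdd k j))).succ) *
            α fun j => v (τ (Fin.cast h' (Fin.castAdd l j))).succ)) * this
    rw [e1, e2, List.ofFn_succ, LForm.mul_cons]
    ring

/-- The wedge product corresponds to the product of the shuffle algebra. -/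
theorem toL_wedge (α : V [⋀^Fin k]→L[ℝ] ℂ) (β : V [⋀^Fin l]→L[ℝ] ℂ) :
    toL (wedge α β) = toL α * toL β := by
  refine LForm.HasDegree.ext (toL_hasDegree _) ((toL_hasDegree α).mul (toL_hasDegree β))
    fun v => ?_
  have h := toL_mul_toL_apply (k + l) k l rfl α β v
  have hk : ((k ! : ℂ) * (l ! : ℂ)) ≠ 0 := by
    exact_mod_cast mul_ne_zero (Nat.factorial_ne_zero k) (Nat.factorial_ne_zero l)
  rw [toL_ofFn, ← mul_right_inj' hk, h, wedge]
  simp only [ContinuousAlternatingMap.smul_apply, smul_eq_mul]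
  rw [mul_inv_cancel_left₀ hk]
  simp only [ContinuousMultilinearMap.alternatization_apply_apply, tensorMul_apply]
  refine Finset.sum_congr rfl fun σ _ => ?_
  rw [Units.smul_def, zsmul_eq_mul]
  simp

theorem toL_wedgePow (β : V [⋀^Fin 2]→L[ℝ] ℂ) (k : ℕ) : toL (wedgePow β k) = toL β ^ k := by
  induction k with
  | zero =>
    refine LForm.HasDegree.ext (k := 0) (toL_hasDegree _) (fun l hl => ?_) fun v => ?_
    · cases l with
      | nil => simp at hl
      | cons v l => rfl
    · rw [toL_ofFn, List.ofFn_zero]; rfl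
  | succ k ih => rw [pow_succ, ← ih, ← toL_wedge]; rfl

theorem toL_injective : Function.Injective (toL : V [⋀^Fin k]→L[ℝ] ℂ → LForm V) := by
  intro α β h
  ext v
  rw [← toL_ofFn, h, toL_ofFn]

end

section

variable {V : Type*} [AddCommGroup V] [Module ℝ V] [TopologicalSpace V]
variable {W : Type*} [AddCommGroup W] [Module ℝ W] [TopologicalSpace W] {k l : ℕ}

theorem toL_add (α β : V [⋀^Fin k]→L[ℝ] ℂ) : toL (α + β) = toL α + toL β :=
  ((toL_hasDegree _).ext (fun l hl => by
    simp [toL_hasDegree α l hl, toL_hasDegree β l hl])) fun v => by simp [toL_ofFn]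

theorem toL_smul (c : ℂ) (α : V [⋀^Fin k]→L[ℝ] ℂ) : toL (c • α) = c • toL α :=
  ((toL_hasDegree _).ext (fun l hl => by simp [toL_hasDegree α l hl])) fun v => by simp [toL_ofFn]

theorem toL_neg (α : V [⋀^Fin k]→L[ℝ] ℂ) : toL (-α) = -toL α := by
  have h : -α = (-1 : ℂ) • α := by ext; simp
  rw [h, toL_smul]; simp

theorem toL_zero : toL (0 : V [⋀^Fin k]→L[ℝ] ℂ) = 0 :=
  ((toL_hasDegree _).ext (fun l hl => by simp)) fun v => by simp [toL_ofFn]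

theorem toL_comp (α : W [⋀^Fin k]→L[ℝ] ℂ) (A : V →L[ℝ] W) :
    toL (α.compContinuousLinearMap A) = LForm.mapHom A (toL α) :=
  ((toL_hasDegree _).ext (fun l hl => by
    rw [LForm.mapHom_apply, toL_hasDegree α _ (by simpa using hl)])) fun v => by
      rw [toL_ofFn, LForm.mapHom_apply, List.map_ofFn, toL_ofFn]; rfl

theorem toL_conj (α : V [⋀^Fin k]→L[ℝ] ℂ) :
    toL ((Complex.conjCLE : ℂ →L[ℝ] ℂ).compContinuousAlternatingMap α) = LForm.conjHom (toL α) :=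
  ((toL_hasDegree _).ext (fun l hl => by
    rw [LForm.conjHom_apply, toL_hasDegree α _ hl, map_zero])) fun v => by
      rw [toL_ofFn, LForm.conjHom_apply, toL_ofFn]; rfl

/-- The elements of the shuffle algebra that come from an alternating form of degree `k`. This is
stronger than `LForm.HasDegree`, which demands neither linearity nor antisymmetry. -/
def IsAlt (k : ℕ) (f : LForm V) : Prop := ∃ α : V [⋀^Fin k]→L[ℝ] ℂ, toL α = f

theorem isAlt_toL (α : V [⋀^Fin k]→L[ℝ] ℂ) : IsAlt k (toL α) := ⟨α, rfl⟩

variable {f g : LForm V}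

theorem IsAlt.hasDegree (hf : IsAlt k f) : f.HasDegree k := by
  obtain ⟨α, rfl⟩ := hf; exact toL_hasDegree α

theorem IsAlt.mul (hf : IsAlt k f) (hg : IsAlt l g) : IsAlt (k + l) (f * g) := by
  obtain ⟨α, rfl⟩ := hf; obtain ⟨β, rfl⟩ := hg; exact ⟨wedge α β, toL_wedge α β⟩

theorem IsAlt.add (hf : IsAlt k f) (hg : IsAlt k g) : IsAlt k (f + g) := by
  obtain ⟨α, rfl⟩ := hf; obtain ⟨β, rfl⟩ := hg; exact ⟨α + β, toL_add α β⟩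

theorem IsAlt.smul (c : ℂ) (hf : IsAlt k f) : IsAlt k (c • f) := by
  obtain ⟨α, rfl⟩ := hf; exact ⟨c • α, toL_smul c α⟩

theorem IsAlt.neg (hf : IsAlt k f) : IsAlt k (-f) := by
  obtain ⟨α, rfl⟩ := hf; exact ⟨-α, toL_neg α⟩

theorem IsAlt.sub (hf : IsAlt k f) (hg : IsAlt k g) : IsAlt k (f - g) := by
  rw [sub_eq_add_neg]; exact hf.add hg.neg

theorem isAlt_zero : IsAlt k (0 : LForm V) := ⟨0, toL_zero⟩

theorem isAlt_one : IsAlt 0 (1 : LForm V) :=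
  ⟨ContinuousAlternatingMap.constOfIsEmpty ℝ V (Fin 0) (1 : ℂ),
    LForm.HasDegree.ext (toL_hasDegree _) (k := 0) (fun l hl => by
      cases l with
      | nil => simp at hl
      | cons v l => rfl) fun v => by rw [toL_ofFn, List.ofFn_zero]; rfl⟩

theorem IsAlt.pow (hf : IsAlt k f) (j : ℕ) : IsAlt (k * j) (f ^ j) := by
  induction j with
  | zero => simpa using isAlt_one
  | succ j ih => rw [pow_succ, Nat.mul_succ]; exact ih.mul hf

theorem IsAlt.ι (hf : IsAlt (k + 1) f) (v : V) : IsAlt k (LForm.ι v f) := by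
  obtain ⟨α, rfl⟩ := hf; exact ⟨curryVec α v, (ι_toL α v).symm⟩

theorem IsAlt.mapHom {f : LForm W} (hf : IsAlt k f) (A : V →L[ℝ] W) :
    IsAlt k (LForm.mapHom A f) := by
  obtain ⟨α, rfl⟩ := hf; exact ⟨_, toL_comp α A⟩

theorem IsAlt.conj (hf : IsAlt k f) : IsAlt k (LForm.conjHom f) := by
  obtain ⟨α, rfl⟩ := hf; exact ⟨_, toL_conj α⟩

/-- Alternating forms of degree above the dimension vanish. -/
theorem IsAlt.eq_zero_of_finrank_lt [FiniteDimensional ℝ V] (hf : IsAlt k f)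
    (h : Module.finrank ℝ V < k) : f = 0 := by
  obtain ⟨α, rfl⟩ := hf
  refine (toL_hasDegree α).ext (fun _ _ => rfl) fun v => ?_
  rw [toL_ofFn, LForm.zero_apply]
  refine α.toAlternatingMap.map_linearDependent v fun hv => ?_
  have := hv.fintype_card_le_finrank
  simp at this
  omega

/-- An alternating form of top degree is determined by its value on a basis. -/
theorem IsAlt.eq_zero_of_basis (hf : IsAlt k f) (b : Module.Basis (Fin k) ℝ V)
    (h : f (List.ofFn b) = 0) : f = 0 := by
  obtain ⟨α, rfl⟩ := hf
  rw [toL_ofFn] at h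
  have : α.toAlternatingMap = 0 := by
    refine Module.Basis.ext_alternating b fun v hv => ?_
    have hb : Function.Bijective v := Finite.injective_iff_bijective.1 hv
    have := α.toAlternatingMap.map_perm b (Equiv.ofBijective v hb)
    have h' : α.toAlternatingMap (⇑b) = 0 := h
    rw [h', smul_zero] at this
    exact this
  have h2 : α = 0 := ContinuousAlternatingMap.toAlternatingMap_injective this
  rw [h2, toL_zero]

theorem IsAlt.map_basis (hf : IsAlt k f) (b : Module.Basis (Fin k) ℝ V) (A : V →ₗ[ℝ] V) :
    f ((List.ofFn b).map A) = LinearMap.det A * f (List.ofFn b) := by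
  obtain ⟨α, rfl⟩ := hf
  rw [List.map_ofFn, toL_ofFn, toL_ofFn]
  have key (L : ℂ →ₗ[ℝ] ℝ) : L (α (A ∘ b)) = LinearMap.det A * L (α b) := by
    have h := AlternatingMap.eq_smul_basis_det b (L.compAlternatingMap α.toAlternatingMap)
    have h1 := DFunLike.congr_fun h (A ∘ b)
    rw [AlternatingMap.smul_apply, Module.Basis.det_comp, Module.Basis.det_self] at h1
    simp only [LinearMap.compAlternatingMap_apply, smul_eq_mul, mul_one] at h1
    rw [mul_comm]; exact h1
  apply Complex.ext
  · simpa using key Complex.reLm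
  · simpa using key Complex.imLm

theorem IsAlt.apply_two_self (hf : IsAlt 2 f) (u : V) : f [u, u] = 0 := by
  obtain ⟨α, rfl⟩ := hf
  have h := toL_ofFn α ![u, u]
  simp only [List.ofFn_succ, List.ofFn_zero] at h
  exact h.trans (α.map_eq_zero_of_eq ![u, u] (i := 0) (j := 1) (by simp) (by simp))

theorem IsAlt.ι_add (hf : IsAlt k f) (u v : V) :
    LForm.ι (u + v) f = LForm.ι u f + LForm.ι v f := by
  obtain ⟨α, rfl⟩ := hf
  cases k with
  | zero => simp [ι_toL_zero]
  | succ k =>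
    rw [ι_toL, ι_toL, ι_toL, ← toL_add]
    congr 1
    ext w
    exact α.toMultilinearMap.cons_add w u v

theorem IsAlt.ι_smul (hf : IsAlt k f) (c : ℝ) (v : V) :
    LForm.ι (c • v) f = (c : ℂ) • LForm.ι v f := by
  obtain ⟨α, rfl⟩ := hf
  cases k with
  | zero => simp [ι_toL_zero]
  | succ k =>
    rw [ι_toL, ι_toL, ← toL_smul]
    congr 1
    ext w
    have := α.toMultilinearMap.cons_smul w c v
    rw [Complex.real_smul] at this
    exact this

theorem IsAlt.ι_neg (hf : IsAlt k f) (v : V) : LForm.ι (-v) f = -LForm.ι v f := by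
  have := hf.ι_smul (-1) v
  simpa using this

theorem IsAlt.ι_sum (hf : IsAlt k f) {κ : Type*} (s : Finset κ) (v : κ → V) :
    LForm.ι (∑ i ∈ s, v i) f = ∑ i ∈ s, LForm.ι (v i) f := by
  classical
  induction s using Finset.induction_on with
  | empty => simpa using hf.ι_smul 0 0
  | insert a s ha ih => rw [Finset.sum_insert ha, Finset.sum_insert ha, hf.ι_add, ih]

theorem IsAlt.apply_two_swap (hf : IsAlt 2 f) (u v : V) : f [u, v] = -f [v, u] := by
  have h := hf.apply_two_self (u + v)
  have h1 := DFunLike.congr_fun (hf.ι_add u v) [u + v]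
  have h2 := DFunLike.congr_fun ((hf.ι u).ι_add u v) []
  have h3 := DFunLike.congr_fun ((hf.ι v).ι_add u v) []
  simp only [LForm.ι_apply, LForm.add_apply] at h1 h2 h3
  rw [h1, h2, h3, hf.apply_two_self, hf.apply_two_self] at h
  linear_combination h

/-- The linear form with values in `ℂ` as an alternating form of degree one. -/
theorem isAlt_one_of_linear (a : V →L[ℝ] ℂ) : IsAlt 1 (⟨fun l => if h : l.length = 1 then
    a (l.get ⟨0, by omega⟩) else 0⟩ : LForm V) := by
  refine ⟨ContinuousAlternatingMap.ofSubsingleton ℝ V ℂ (0 : Fin 1) a, ?_⟩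
  refine (toL_hasDegree _).ext (fun l hl => by simp [hl]) fun v => ?_
  rw [toL_ofFn]
  simp

end

/-! ### The exterior derivative in the shuffle algebra -/

section

variable {E : Type*} [NormedAddCommGroup E] [NormedSpace ℝ E]

/-- The exterior derivative, by recursion on the list of arguments, through Cartan's formula
`ι_v d + d ι_v = ∂_v` for constant vector fields `v`. -/
def extDAux : List E → (E → LForm E) → E → ℂ
  | [], _, _ => 0
  | v :: l, F, x => fderiv ℝ (fun y => F y l) x v - extDAux l (fun y => LForm.ι v (F y)) x

/-- The exterior derivative of a field of elements of the shuffle algebra. -/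
def extD (F : E → LForm E) (x : E) : LForm E := ⟨fun l => extDAux l F x⟩

theorem extD_nil (F : E → LForm E) (x : E) : extD F x [] = 0 := rfl

theorem extD_cons (F : E → LForm E) (x v : E) (l : List E) :
    extD F x (v :: l) = fderiv ℝ (fun y => F y l) x v - extD (fun y => LForm.ι v (F y)) x l := rfl

variable {F G : E → LForm E} {x : E}

theorem extD_congr (h : F =ᶠ[𝓝 x] G) : extD F x = extD G x := by
  ext l
  induction l generalizing F G with
  | nil => rfl
  | cons v l ih =>
    have h1 : (fun y => LForm.ι v (F y)) =ᶠ[𝓝 x] fun y => LForm.ι v (G y) :=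
      h.mono fun y hy => by simp only [hy]
    have h2 : (fun y => F y l) =ᶠ[𝓝 x] fun y => G y l := h.mono fun y hy => by simp only [hy]
    rw [extD_cons, extD_cons, ih h1, h2.fderiv_eq]

theorem extD_add (hF : ∀ l, DifferentiableAt ℝ (fun y => F y l) x)
    (hG : ∀ l, DifferentiableAt ℝ (fun y => G y l) x) :
    extD (fun y => F y + G y) x = extD F x + extD G x := by
  ext l
  induction l generalizing F G with
  | nil => simp [extD_nil]
  | cons v l ih =>
    simp only [extD_cons, LForm.add_apply, LForm.ι_add]
    rw [fderiv_fun_add (hF l) (hG l),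
      ih (fun l => hF (v :: l)) (fun l => hG (v :: l))]
    simp only [LForm.add_apply, add_apply]
    ring

theorem fderiv_const_mul_apply (c : ℂ) (u : E → ℂ) (x v : E) :
    fderiv ℝ (fun y => c * u y) x v = c * fderiv ℝ u x v := by
  have h := DFunLike.congr_fun (congrFun (fderiv_const_smul_field (𝕜 := ℝ) c (f := u)) x) v
  simpa [Pi.smul_def] using h

theorem extD_smul (c : ℂ) (F : E → LForm E) (x : E) :
    extD (fun y => c • F y) x = c • extD F x := by
  ext l
  induction l generalizing F with
  | nil => simp [extD_nil]
  | cons v l ih =>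
    simp only [extD_cons, LForm.smul_apply, LForm.ι_smul]
    rw [ih, LForm.smul_apply]
    rw [fderiv_const_mul_apply]; ring

theorem extD_hat (F : E → LForm E) (x : E) :
    extD (fun y => LForm.hat (F y)) x = -LForm.hat (extD F x) := by
  ext l
  induction l generalizing F with
  | nil => simp [extD_nil, LForm.hat_apply]
  | cons v l ih =>
    have h1 : (fun y => LForm.ι v (LForm.hat (F y))) =
        fun y => (-1 : ℂ) • LForm.hat (LForm.ι v (F y)) := by
      funext y; rw [LForm.ι_hat, neg_one_smul]
    have h2 : fderiv ℝ (fun y => LForm.hat (F y) l) x v =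
        (-1) ^ l.length * fderiv ℝ (fun y => F y l) x v := fderiv_const_mul_apply _ _ _ _
    rw [extD_cons, h1, extD_smul, LForm.smul_apply, ih, h2, LForm.neg_apply, LForm.neg_apply,
      LForm.hat_apply, LForm.hat_apply, extD_cons, List.length_cons, pow_succ]
    ring

theorem differentiableAt_mul_apply (hF : ∀ l, DifferentiableAt ℝ (fun y => F y l) x)
    (hG : ∀ l, DifferentiableAt ℝ (fun y => G y l) x) (l : List E) :
    DifferentiableAt ℝ (fun y => (F y * G y) l) x := by
  let A : Subring (E → ℂ) :=
    { carrier := {u | DifferentiableAt ℝ u x}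
      mul_mem' := fun ha hb => DifferentiableAt.mul ha hb
      one_mem' := differentiableAt_const (1 : ℂ)
      add_mem' := fun ha hb => DifferentiableAt.add ha hb
      zero_mem' := differentiableAt_const (0 : ℂ)
      neg_mem' := fun ha => DifferentiableAt.neg ha }
  exact LForm.mul_apply_mem A l F G hF hG

theorem differentiableAt_hat_apply (hF : ∀ l, DifferentiableAt ℝ (fun y => F y l) x) (l : List E) :
    DifferentiableAt ℝ (fun y => LForm.hat (F y) l) x :=
  (hF l).const_mul ((-1 : ℂ) ^ l.length)

/-- The Leibniz rule. -/
theorem extD_mul (hF : ∀ l, DifferentiableAt ℝ (fun y => F y l) x)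
    (hG : ∀ l, DifferentiableAt ℝ (fun y => G y l) x) :
    extD (fun y => F y * G y) x = extD F x * G x + LForm.hat (F x) * extD G x := by
  ext l
  induction l generalizing F G with
  | nil => simp [extD_nil]
  | cons v l ih =>
    have hFv : ∀ l, DifferentiableAt ℝ (fun y => LForm.ι v (F y) l) x := fun l => hF (v :: l)
    have hGv : ∀ l, DifferentiableAt ℝ (fun y => LForm.ι v (G y) l) x := fun l => hG (v :: l)
    have hh := fun l => differentiableAt_hat_apply hF l
    have hD : ∀ (l : List E) {F G : E → LForm E}, (∀ l, DifferentiableAt ℝ (fun y => F y l) x) →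
        (∀ l, DifferentiableAt ℝ (fun y => G y l) x) →
        fderiv ℝ (fun y => (F y * G y) l) x v =
          ((⟨fun l => fderiv ℝ (fun y => F y l) x v⟩ : LForm E) * G x +
            F x * ⟨fun l => fderiv ℝ (fun y => G y l) x v⟩) l := by
      intro l
      induction l with
      | nil =>
        intro F G hF hG
        simp only [LForm.mul_nil, LForm.add_apply, LForm.mk_apply]
        rw [fderiv_fun_mul (hF []) (hG [])]
        simp; ring
      | cons w l ihl =>
        intro F G hF hG
        have hFw : ∀ l, DifferentiableAt ℝ (fun y => LForm.ι w (F y) l) x := fun l => hF (w :: l)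
        have hGw : ∀ l, DifferentiableAt ℝ (fun y => LForm.ι w (G y) l) x := fun l => hG (w :: l)
        have hh := fun l => differentiableAt_hat_apply hF l
        simp only [LForm.mul_cons, LForm.add_apply]
        rw [fderiv_fun_add (differentiableAt_mul_apply hFw hG l)
          (differentiableAt_mul_apply hh hGw l), add_apply, ihl hFw hG,
          ihl hh hGw]
        have e1 : LForm.hat (⟨fun l => fderiv ℝ (fun y => F y l) x v⟩ : LForm E) =
            ⟨fun l => fderiv ℝ (fun y => LForm.hat (F y) l) x v⟩ := by
          ext l'
          simp only [LForm.hat_apply, LForm.mk_apply]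
          rw [fderiv_const_mul_apply]
        rw [e1]
        simp only [LForm.add_apply]
        have e2 (H : E → LForm E) : LForm.ι w (⟨fun l => fderiv ℝ (fun y => H y l) x v⟩ : LForm E) =
            ⟨fun l => fderiv ℝ (fun y => LForm.ι w (H y) l) x v⟩ := rfl
        rw [e2, e2]
        ring
    rw [extD_cons, hD l hF hG]
    simp only [LForm.ι_mul]
    rw [extD_add (fun l => differentiableAt_mul_apply hFv hG l)
      (fun l => differentiableAt_mul_apply hh hGv l), LForm.add_apply,
      LForm.add_apply, ih (F := fun y => LForm.ι v (F y)) hFv hG,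
      ih (G := fun y => LForm.ι v (G y)) hh hGv, extD_hat, LForm.hat_hat]
    have e3 (H : E → LForm E) : LForm.ι v (extD H x) =
        ⟨fun l => fderiv ℝ (fun y => H y l) x v⟩ - extD (fun y => LForm.ι v (H y)) x := rfl
    rw [LForm.add_apply (extD F x * G x), LForm.mul_cons, LForm.mul_cons, e3 F, e3 G, LForm.ι_hat,
      LForm.hat_hat, sub_mul, mul_sub]
    simp only [LForm.add_apply, LForm.sub_apply, neg_mul, LForm.neg_apply]
    ring

/-- The exterior derivative of Mathlib corresponds to the one of the shuffle algebra. -/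
theorem toL_extDeriv {k : ℕ} {α : E → E [⋀^Fin k]→L[ℝ] ℂ} (h : DifferentiableAt ℝ α x) :
    toL (extDeriv α x) = extD (fun y => toL (α y)) x := by
  have key : ∀ (k : ℕ) {α : E → E [⋀^Fin k]→L[ℝ] ℂ} (v : Fin (k + 1) → E),
      ∑ i, (-1 : ℤ) ^ i.val • fderiv ℝ (fun y => α y (i.removeNth v)) x (v i) =
        extD (fun y => toL (α y)) x (List.ofFn v) := by
    intro k
    induction k with
    | zero =>
      intro α v
      simp only [List.ofFn_succ, List.ofFn_zero, extD_cons, extD_nil, sub_zero]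
      have h0 (y : E) : toL (α y) [] = α y (Fin.removeNth 0 v) := by
        rw [← toL_ofFn (α y), List.ofFn_zero]
      simp [h0]
    | succ k ih =>
      intro α v
      rw [Fin.sum_univ_succ, List.ofFn_succ, extD_cons]
      simp only [ι_toL]
      rw [← ih, sub_eq_add_neg]
      congr 1
      · simp only [toL_ofFn]
        simp
        rfl
      · rw [← Finset.sum_neg_distrib]
        refine Finset.sum_congr rfl fun i _ => ?_
        have h1 (y : E) : α y (i.succ.removeNth v) =
            curryVec (α y) (v 0) (i.removeNth fun j => v j.succ) := by
          rw [curryVec_apply]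
          congr 1
          funext j
          refine Fin.cases ?_ (fun j => ?_) j
          · simp [Fin.removeNth]
          · simp [Fin.removeNth]
        simp only [h1, Fin.val_succ, pow_succ]
        simp
  have hdeg : (extD (fun y => toL (α y)) x).HasDegree (k + 1) := by
    have : ∀ (l : List E) (F : E → LForm E) (k : ℕ), (∀ y, (F y).HasDegree k) →
        l.length ≠ k + 1 → extD F x l = 0 := by
      intro l
      induction l with
      | nil => intros; rfl
      | cons v l ih =>
        intro F k hF hl
        have h1 : (fun y => F y l) = fun _ => 0 := by
          funext y; exact hF y l (by simpa using hl)
        rw [extD_cons, h1]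
        cases k with
        | zero =>
          have h2 : (fun y => LForm.ι v (F y)) = fun _ => (0 : ℂ) • (0 : LForm E) := by
            funext y; ext l'; rw [zero_smul]; exact hF y (v :: l') (by simp)
          rw [h2, extD_smul]; simp
        | succ k =>
          rw [ih (fun y => LForm.ι v (F y)) k (fun y l' hl' => hF y (v :: l') (by simpa using hl'))
            (by simpa using hl)]
          simp
    intro l hl
    exact this l _ k (fun y => toL_hasDegree _) hl
  refine (toL_hasDegree _).ext hdeg fun v => ?_
  rw [toL_ofFn, extDeriv_apply h, ← key]

end

/-! ### Symplectic linear algebra -/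

theorem finrank_le_inf_ker {V : Type*} [AddCommGroup V] [Module ℝ V]
    [FiniteDimensional ℝ V] (W : Submodule ℝ V) (L : V →ₗ[ℝ] ℝ) :
    Module.finrank ℝ W ≤ Module.finrank ℝ (W ⊓ LinearMap.ker L : Submodule ℝ V) + 1 := by
  have h1 := Submodule.finrank_sup_add_finrank_inf_eq W (LinearMap.ker L)
  have h2 := L.finrank_range_add_finrank_ker
  have h3 := Submodule.finrank_le (W ⊔ LinearMap.ker L)
  have h4 : Module.finrank ℝ (LinearMap.range L) ≤ 1 := by
    simpa using Submodule.finrank_le (LinearMap.range L)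
  omega

section

variable {V : Type*} [AddCommGroup V] [Module ℝ V] [TopologicalSpace V]

theorem toL_pair (α : V [⋀^Fin 2]→L[ℝ] ℂ) (u v : V) : toL α [u, v] = α ![u, v] := by
  have h := toL_ofFn α ![u, v]
  simp only [List.ofFn_succ, List.ofFn_zero] at h
  exact h

theorem IsAlt.exists_linear {f : LForm V} (hf : IsAlt 1 f) :
    ∃ L : V →ₗ[ℝ] ℂ, ∀ v, L v = f [v] := by
  refine ⟨{ toFun := fun v => f [v], map_add' := fun u v => ?_, map_smul' := fun c v => ?_ },
    fun v => rfl⟩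
  · exact DFunLike.congr_fun (hf.ι_add u v) []
  · exact (DFunLike.congr_fun (hf.ι_smul c v) []).trans (by
      rw [LForm.smul_apply, LForm.ι_apply]; exact Complex.real_smul.symm)

theorem IsAlt.ext_one {f g : LForm V} (hf : IsAlt 1 f) (hg : IsAlt 1 g)
    (h : ∀ v, f [v] = g [v]) : f = g :=
  hf.hasDegree.ext hg.hasDegree fun v => by simpa [List.ofFn_succ] using h (v 0)

theorem IsAlt.ext_two {f g : LForm V} (hf : IsAlt 2 f) (hg : IsAlt 2 g)
    (h : ∀ u v, f [u, v] = g [u, v]) : f = g :=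
  hf.hasDegree.ext hg.hasDegree fun v => by simpa [List.ofFn_succ] using h (v 0) (v 1)

theorem IsAlt.hat_one {f : LForm V} (hf : IsAlt 1 f) : LForm.hat f = -f :=
  hf.hasDegree.hat_of_odd odd_one

theorem IsAlt.hat_two {f : LForm V} (hf : IsAlt 2 f) : LForm.hat f = f :=
  hf.hasDegree.hat_of_even even_two

theorem IsAlt.mul_pair {f g : LForm V} (hf : IsAlt 1 f) (hg : IsAlt 1 g) (u v : V) :
    (f * g) [u, v] = f [u] * g [v] - f [v] * g [u] := by
  rw [LForm.mul_cons, hf.hat_one]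
  simp only [LForm.mul_cons, LForm.mul_nil, LForm.ι_apply, LForm.ι_neg, LForm.hat_apply,
    LForm.neg_apply, hf.hasDegree [] (by simp), hg.hasDegree [] (by simp)]
  simp
  ring

theorem pow_apply_cons_cons {f : LForm V} (hf : IsAlt 2 f) (m : ℕ) (e e' : V) (l : List V)
    (h : ∀ v ∈ l, f [e, v] = 0) :
    (f ^ (m + 1)) (e :: e' :: l) = (m + 1) * f [e, e'] * (f ^ m) l := by
  have h1 : (f ^ (m + 1)) (e :: e' :: l) = LForm.ι e (f ^ (m + 1)) (e' :: l) := rfl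
  have h2 : LForm.ι e' (LForm.ι e f) = f [e, e'] • (1 : LForm V) :=
    LForm.ι_of_degree_one (hf.ι e).hasDegree e'
  rw [h1, LForm.ι_pow hf.hat_two, LForm.smul_apply, LForm.mul_cons, h2, smul_mul_assoc, one_mul,
    (hf.ι e).hat_one, neg_mul, LForm.neg_apply,
    LForm.mul_apply_eq_zero (hf.ι e).hasDegree l h, LForm.smul_apply]
  ring

/-- The top power of a nondegenerate real 2-form does not vanish: split off a hyperbolic plane and
use induction on the dimension. -/
theorem exists_pow_ne_zero [FiniteDimensional ℝ V] {f : LForm V} (hf : IsAlt 2 f)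
    (hre : LForm.conjHom f = f) : ∀ (m : ℕ) (W : Submodule ℝ V), 2 * m ≤ Module.finrank ℝ W →
      (∀ w ∈ W, w ≠ 0 → ∃ u ∈ W, f [w, u] ≠ 0) →
        ∃ l : List V, (∀ v ∈ l, v ∈ W) ∧ (f ^ m) l ≠ 0 := by
  intro m
  induction m with
  | zero => intro W _ _; exact ⟨[], by simp, by simp⟩
  | succ m ih =>
    intro W hW hnd
    have hpos : 0 < Module.finrank ℝ W := by omega
    obtain ⟨⟨e, heW⟩, he⟩ := (Module.finrank_pos_iff_exists_ne_zero (R := ℝ)).1 hpos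
    have he0 : e ≠ 0 := fun h => he (by simp [h])
    obtain ⟨e', he'W, hee'⟩ := hnd e heW he0
    obtain ⟨L, hL⟩ := (hf.ι e).exists_linear
    obtain ⟨L', hL'⟩ := (hf.ι e').exists_linear
    have him (u v : V) : (f [u, v]).im = 0 := by
      have := DFunLike.congr_fun hre [u, v]
      exact Complex.conj_eq_iff_im.1 this
    have hreal (u v : V) : ((f [u, v]).re : ℂ) = f [u, v] := by
      apply Complex.ext <;> simp [him]
    -- The complement of the plane of `e` and `e'` with respect to `f`.
    set W' : Submodule ℝ V := W ⊓ LinearMap.ker (Complex.reLm ∘ₗ L) ⊓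
      LinearMap.ker (Complex.reLm ∘ₗ L') with hW'
    have hmem (v : V) : v ∈ W' ↔ v ∈ W ∧ f [e, v] = 0 ∧ f [e', v] = 0 := by
      have e1 (u v : V) : (f [u, v]).re = 0 ↔ f [u, v] = 0 := by
        rw [← Complex.ofReal_eq_zero, hreal]
      simp only [hW', Submodule.mem_inf, LinearMap.mem_ker, LinearMap.comp_apply, hL, hL',
        LForm.ι_apply, Complex.reLm_coe, e1, and_assoc]
    have hdim : 2 * m ≤ Module.finrank ℝ W' := by
      have h1 := finrank_le_inf_ker W (Complex.reLm ∘ₗ L)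
      have h2 := finrank_le_inf_ker (W ⊓ LinearMap.ker (Complex.reLm ∘ₗ L)) (Complex.reLm ∘ₗ L')
      rw [← hW'] at h2
      omega
    obtain ⟨l, hlW, hl⟩ := ih W' hdim (by
      intro w hw hw0
      obtain ⟨hwW, hew, he'w⟩ := (hmem w).1 hw
      obtain ⟨u, huW, hu⟩ := hnd w hwW hw0
      obtain ⟨Lw, hLw⟩ := (hf.ι w).exists_linear
      have hc : (f [e, e']).re ≠ 0 := fun h => hee' (by rw [← hreal, h]; simp)
      -- The projection of `u` to `W'`, which pairs with `w ∈ W'` as `u` does.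
      set u' := u - ((f [e, u]).re / (f [e, e']).re) • e' + ((f [e', u]).re / (f [e, e']).re) • e
        with hu'
      refine ⟨u', (hmem _).2 ⟨?_, ?_, ?_⟩, ?_⟩
      · exact W.add_mem (W.sub_mem huW (W.smul_mem _ he'W)) (W.smul_mem _ heW)
      · have : f [e, u'] = L u' := (hL u').symm
        rw [this, hu', map_add, map_sub, map_smul, map_smul]
        simp only [hL, LForm.ι_apply, hf.apply_two_self,
          Complex.real_smul, Complex.ofReal_div, hreal]
        field_simp
        simp
      · have : f [e', u'] = L' u' := (hL' u').symm
        rw [this, hu', map_add, map_sub, map_smul, map_smul]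
        simp only [hL', LForm.ι_apply, hf.apply_two_self,
          Complex.real_smul, Complex.ofReal_div, hreal, hf.apply_two_swap e' e]
        field_simp
        simp
      · have : f [w, u'] = Lw u' := (hLw u').symm
        rw [this, hu', map_add, map_sub, map_smul, map_smul]
        simp only [hLw, LForm.ι_apply, hf.apply_two_swap w e, hew,
          hf.apply_two_swap w e', he'w]
        simpa using hu)
    refine ⟨e :: e' :: l, ?_, ?_⟩
    · intro v hv
      simp only [List.mem_cons] at hv
      rcases hv with rfl | rfl | hv
      · exact heW
      · exact he'W
      · exact ((hmem v).1 (hlW v hv)).1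
    · rw [pow_apply_cons_cons hf m e e' l fun v hv => ((hmem v).1 (hlW v hv)).2.1]
      have hm : (m + 1 : ℂ) ≠ 0 := by exact_mod_cast Nat.succ_ne_zero m
      exact mul_ne_zero (mul_ne_zero hm hee') hl

end

/-! ### Tame 2-forms on `ℂⁿ` -/

section

variable {n : ℕ}

theorem finrank_model : Module.finrank ℝ (Model n) = 2 * n := by
  rw [finrank_real_of_complex, finrank_euclideanSpace_fin]

theorem top_le_span_realFrame : ⊤ ≤ Submodule.span ℝ (Set.range (realFrame n)) := by
  intro v _
  have hv : v = ∑ i, EuclideanSpace.single i (v i) := by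
    ext j
    simp
  rw [hv]
  refine Submodule.sum_mem _ fun i _ => ?_
  have h1 : EuclideanSpace.single i (v i) =
      (v i).re • realFrame n ⟨2 * i, by omega⟩ + (v i).im • realFrame n ⟨2 * i + 1, by omega⟩ := by
    ext j
    have e1 : (⟨(2 * (i : ℕ)) / 2, by omega⟩ : Fin n) = i := by ext; simp
    have e2 : (⟨(2 * (i : ℕ) + 1) / 2, by omega⟩ : Fin n) = i := by ext; simp; omega
    simp only [realFrame, e1, e2]
    by_cases hj : j = i
    · subst hj
      have e3 : (2 * (j : ℕ) + 1) % 2 = 1 := by omega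
      simp [e3]
    · simp [hj]
  rw [h1]
  exact Submodule.add_mem _ (Submodule.smul_mem _ _ (Submodule.subset_span ⟨_, rfl⟩))
    (Submodule.smul_mem _ _ (Submodule.subset_span ⟨_, rfl⟩))

variable (n) in
/-- The frame `realFrame` as a basis. -/
def realBasis : Module.Basis (Fin (2 * n)) ℝ (Model n) :=
  basisOfTopLeSpanOfCardEqFinrank (realFrame n) top_le_span_realFrame (by simp [finrank_model])

@[simp] theorem coe_realBasis : ⇑(realBasis n) = realFrame n :=
  coe_basisOfTopLeSpanOfCardEqFinrank _ _ _

variable (n) in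
/-- The frame `realFrame` as a list. -/
def frameList : List (Model n) := List.ofFn (realFrame n)

theorem IsAlt.eq_zero_of_frame {f : LForm (Model n)} (hf : IsAlt (2 * n) f)
    (h : f (frameList n) = 0) : f = 0 :=
  hf.eq_zero_of_basis (realBasis n) (by simpa [frameList] using h)

theorem IsAlt.map_frame {f : LForm (Model n)} (hf : IsAlt (2 * n) f)
    (A : Model n →ₗ[ℝ] Model n) :
    f ((frameList n).map A) = LinearMap.det A * f (frameList n) := by
  simpa [frameList] using hf.map_basis (realBasis n) A

theorem IsAlt.eq_smul_of_frame {f g : LForm (Model n)} (hf : IsAlt (2 * n) f)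
    (hg : IsAlt (2 * n) g) (h : g (frameList n) ≠ 0) :
    f = (f (frameList n) / g (frameList n)) • g := by
  rw [← sub_eq_zero]
  refine (hf.sub (hg.smul _)).eq_zero_of_frame ?_
  simp [div_mul_cancel₀ _ h]

/-- The determinant of an invertible complex linear map, as a real linear map, is positive, because
it is the squared absolute value of the complex determinant. -/
theorem det_pos_of_complex (A : Model n →ₗ[ℝ] Model n) (hA : ∀ v, A (Complex.I • v) =
    Complex.I • A v) (hinj : LinearMap.det A ≠ 0) : 0 < LinearMap.det A := by
  let A' : Model n →ₗ[ℂ] Model n :=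
    { toFun := A
      map_add' := A.map_add
      map_smul' := fun c v => by
        have h : c • v = c.re • v + c.im • (Complex.I • v) := by
          ext i; simp
          rw [← mul_assoc, ← add_mul, Complex.re_add_im]
        have h' : c • A v = c.re • A v + c.im • (Complex.I • A v) := by
          ext i; simp
          rw [← mul_assoc, ← add_mul, Complex.re_add_im]
        simp only [RingHom.id_apply]
        rw [h, A.map_add, A.map_smul, A.map_smul, hA, h'] }
  have h : LinearMap.det A = Algebra.norm ℝ (LinearMap.det A') := by
    rw [← LinearMap.det_restrictScalars]; rfl
  rw [h, Algebra.norm_complex_apply] at hinj ⊢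
  exact lt_of_le_of_ne (Complex.normSq_nonneg _) hinj.symm

theorem det_mulI : LinearMap.det (mulI n : Model n →ₗ[ℝ] Model n) = 1 := by
  have h : LinearMap.det (mulI n : Model n →ₗ[ℝ] Model n) ^ 2 = 1 := by
    rw [← map_pow]
    have : (mulI n : Model n →ₗ[ℝ] Model n) ^ 2 = (-1 : ℝ) • LinearMap.id := by
      ext1 v
      simp [pow_two, mulI_apply, smul_smul]
    rw [this, LinearMap.det_smul, LinearMap.det_id, finrank_model]
    simp
  have hpos : 0 < LinearMap.det (mulI n : Model n →ₗ[ℝ] Model n) :=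
    det_pos_of_complex _ (fun v => by simp [mulI_apply]) (by
      intro h0; rw [h0] at h; norm_num at h)
  nlinarith

/-- The complex structure acts trivially on forms of top degree. -/
theorem IsAlt.mapHom_mulI_top {f : LForm (Model n)} (hf : IsAlt (2 * n) f) :
    LForm.mapHom (mulI n) f = f := by
  rw [← sub_eq_zero]
  refine ((hf.mapHom (mulI n)).sub hf).eq_zero_of_frame ?_
  rw [LForm.sub_apply, LForm.mapHom_apply]
  have := hf.map_frame (mulI n : Model n →ₗ[ℝ] Model n)
  rw [det_mulI] at this
  simpa using sub_eq_zero.2 this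

/-- A real 2-form `Φ` on `ℂⁿ` is tame if `Φ (v, √-1 v) > 0` for all nonzero vectors `v`. -/
structure Tame (f : LForm (Model n)) : Prop where
  isAlt : IsAlt 2 f
  conj : LForm.conjHom f = f
  pos : ∀ v, v ≠ 0 → 0 < (f [v, mulI n v]).re

theorem LForm.im_eq_zero {V : Type*} {f : LForm V} (h : LForm.conjHom f = f) (l : List V) :
    (f l).im = 0 := Complex.conj_eq_iff_im.1 (DFunLike.congr_fun h l)

theorem LForm.ofReal_re {V : Type*} {f : LForm V} (h : LForm.conjHom f = f) (l : List V) :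
    ((f l).re : ℂ) = f l := by
  apply Complex.ext <;> simp [LForm.im_eq_zero h]

theorem Tame.pow_frame_ne_zero {f : LForm (Model n)} (hf : Tame f) :
    (f ^ n) (frameList n) ≠ 0 := by
  intro h0
  have h1 : f ^ n = 0 := (hf.isAlt.pow n).eq_zero_of_frame h0
  obtain ⟨l, -, hl⟩ := exists_pow_ne_zero hf.isAlt hf.conj n ⊤ (by
    rw [finrank_top, finrank_model]) fun w _ hw => ⟨mulI n w, trivial, fun h => by
      have := hf.pos w hw
      rw [h] at this
      simp at this⟩
  exact hl (by rw [h1]; rfl)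

variable (n) in
/-- The standard Kähler form of `ℂⁿ`. -/
def stdForm : LForm (Model n) :=
  ∑ i : Fin n, (⟨fun l => if h : l.length = 1 then ((l.get ⟨0, by omega⟩ i).re : ℂ) else 0⟩ *
    ⟨fun l => if h : l.length = 1 then ((l.get ⟨0, by omega⟩ i).im : ℂ) else 0⟩)

theorem isAlt_coord (L : ℂ →L[ℝ] ℝ) (i : Fin n) : IsAlt 1 (⟨fun l => if h : l.length = 1 then
    (L (l.get ⟨0, by omega⟩ i) : ℂ) else 0⟩ : LForm (Model n)) :=
  isAlt_one_of_linear (Complex.ofRealCLM ∘L L ∘L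
    ((EuclideanSpace.proj i : Model n →L[ℂ] ℂ).restrictScalars ℝ))

theorem stdForm_apply (u v : Model n) :
    stdForm n [u, v] = ∑ i, (((u i).re : ℂ) * (v i).im - (v i).re * (u i).im) := by
  rw [stdForm, LForm.sum_apply]
  refine Finset.sum_congr rfl fun i _ => ?_
  refine (IsAlt.mul_pair (isAlt_coord Complex.reCLM i) (isAlt_coord Complex.imCLM i) u v).trans ?_
  simp

theorem isAlt_stdForm : IsAlt 2 (stdForm n) := by
  classical
  have (s : Finset (Fin n)) : IsAlt 2 (∑ i ∈ s, ((⟨fun l => if h : l.length = 1 then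
      ((l.get ⟨0, by omega⟩ i).re : ℂ) else 0⟩ : LForm (Model n)) *
      ⟨fun l => if h : l.length = 1 then ((l.get ⟨0, by omega⟩ i).im : ℂ) else 0⟩)) := by
    induction s using Finset.induction_on with
    | empty => simpa using isAlt_zero
    | insert a s ha ih =>
      rw [Finset.sum_insert ha]
      exact ((isAlt_coord Complex.reCLM a).mul (isAlt_coord Complex.imCLM a)).add ih
  exact this Finset.univ

theorem tame_stdForm : Tame (stdForm n) where
  isAlt := isAlt_stdForm
  conj := by
    refine isAlt_stdForm.conj.ext_two isAlt_stdForm fun u v => ?_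
    rw [LForm.conjHom_apply, stdForm_apply]
    simp
  pos v hv := by
    rw [stdForm_apply]
    have h1 : (∑ i, (((v i).re : ℂ) * (mulI n v i).im - (mulI n v i).re * (v i).im)) =
        ((∑ i, ((v i).re ^ 2 + (v i).im ^ 2) : ℝ) : ℂ) := by
      push_cast
      refine Finset.sum_congr rfl fun i _ => ?_
      simp [mulI_apply]
      ring
    rw [h1, Complex.ofReal_re]
    obtain ⟨i, hi⟩ : ∃ i, v i ≠ 0 := by
      by_contra! h
      exact hv (by ext i; simp [h])
    refine Finset.sum_pos' (fun i _ => by positivity) ⟨i, Finset.mem_univ _, ?_⟩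
    have := Complex.normSq_pos.2 hi
    rw [Complex.normSq_apply] at this
    nlinarith

theorem stdForm_pow_frame : 0 < ((stdForm n ^ n) (frameList n)).re := by
  have key : ∀ L : List (Fin n), L.Nodup → (stdForm n ^ L.length)
      (L.flatMap fun i => [EuclideanSpace.single i 1, EuclideanSpace.single i Complex.I]) =
      (L.length ! : ℂ) := by
    intro L
    induction L with
    | nil => intro _; simp
    | cons i L ih =>
      intro hL
      rw [List.nodup_cons] at hL
      rw [List.flatMap_cons, List.length_cons]
      simp only [List.cons_append, List.nil_append]
      rw [pow_apply_cons_cons isAlt_stdForm, ih hL.2, stdForm_apply, Nat.factorial_succ]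
      · have : (∑ j, (((EuclideanSpace.single i (1 : ℂ) : Model n) j).re *
            (((EuclideanSpace.single i Complex.I : Model n) j).im : ℂ) -
            ((EuclideanSpace.single i Complex.I : Model n) j).re *
            ((EuclideanSpace.single i (1 : ℂ) : Model n) j).im)) = 1 := by
          rw [Finset.sum_eq_single i]
          · simp
          · intro j _ hj; simp [hj]
          · simp
        rw [this]
        push_cast
        ring
      · intro v hv
        rw [List.mem_flatMap] at hv
        obtain ⟨j, hj, hv⟩ := hv
        have hij : i ≠ j := fun h => hL.1 (h ▸ hj)
        rw [stdForm_apply]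
        refine Finset.sum_eq_zero fun k _ => ?_
        simp only [List.mem_cons, List.not_mem_nil, or_false] at hv
        rcases hv with rfl | rfl
        · by_cases hk : k = i
          · subst hk; simp [hij]
          · simp [hk]
        · by_cases hk : k = i
          · subst hk; simp [hij]
          · simp [hk]
  have h := key (List.finRange n) (List.nodup_finRange n)
  have h2 : (List.finRange n).flatMap (fun i => [(EuclideanSpace.single i 1 : Model n),
      EuclideanSpace.single i Complex.I]) = frameList n := by
    rw [frameList, List.ofFn_mul', List.flatMap, ← List.ofFn_eq_map]
    congr 1
    congr 1
    funext i
    have e2 : (⟨(2 * (i : ℕ) + 1) / 2, by omega⟩ : Fin n) = i := by ext; simp; omega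
    simp [List.ofFn_succ, realFrame, e2]
  rw [h2, List.length_finRange] at h
  rw [h]
  simpa using Nat.factorial_pos n

/-- The top power of a tame form is positive. It does not vanish as tame forms are nondegenerate,
and the tame forms are convex, so its sign is that of the standard Kähler form. -/
theorem Tame.pow_frame_pos {f : LForm (Model n)} (hf : Tame f) :
    0 < ((f ^ n) (frameList n)).re := by
  let F : ℝ → LForm (Model n) := fun s => ((1 - s : ℝ) : ℂ) • stdForm n + (s : ℂ) • f
  have hF : ∀ s ∈ Set.Icc (0 : ℝ) 1, Tame (F s) := by
    intro s hs
    refine ⟨(isAlt_stdForm.smul _).add (hf.isAlt.smul _), ?_, fun v hv => ?_⟩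
    · ext l
      have h1 := DFunLike.congr_fun hf.conj l
      have h2 := DFunLike.congr_fun (tame_stdForm (n := n)).conj l
      simp only [LForm.conjHom_apply] at h1 h2
      simp only [F, LForm.conjHom_apply, LForm.add_apply, LForm.smul_apply, map_add, map_mul, h1,
        h2, Complex.conj_ofReal]
    · have h1 := hf.pos v hv
      have h2 := tame_stdForm.pos v hv
      have h3 : ((F s) [v, mulI n v]).re = (1 - s) * (stdForm n [v, mulI n v]).re +
          s * (f [v, mulI n v]).re := by
        simp only [F, LForm.add_apply, LForm.smul_apply, Complex.add_re, Complex.re_ofReal_mul]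
      rw [h3]
      rcases eq_or_lt_of_le hs.1 with h | h
      · rw [← h]; simpa using h2
      · have := mul_pos h h1
        nlinarith [mul_nonneg (sub_nonneg.2 hs.2) h2.le]
  have hcont : Continuous fun s => ((F s ^ n) (frameList n)).re := by
    let A : Subring (ℝ → ℂ) :=
      { carrier := {u | Continuous u}
        mul_mem' := fun ha hb => Continuous.mul ha hb
        one_mem' := continuous_const
        add_mem' := fun ha hb => Continuous.add ha hb
        zero_mem' := continuous_const
        neg_mem' := fun ha => Continuous.neg ha }
    refine Complex.continuous_re.comp (LForm.pow_apply_mem A F (fun l => ?_) n (frameList n))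
    change Continuous fun s : ℝ => ((1 - s : ℝ) : ℂ) * stdForm n l + (s : ℂ) * f l
    fun_prop
  have h0 : F 0 = stdForm n := by simp [F]
  have h1 : F 1 = f := by simp [F]
  by_contra hneg
  have hmem : (0 : ℝ) ∈ Set.Icc ((F 1 ^ n) (frameList n)).re ((F 0 ^ n) (frameList n)).re := by
    rw [h0, h1]
    exact ⟨not_lt.1 hneg, stdForm_pow_frame.le⟩
  obtain ⟨s, hs, hs0⟩ := intermediate_value_Icc' zero_le_one hcont.continuousOn hmem
  apply (hF s hs).pow_frame_ne_zero
  apply Complex.ext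
  · exact hs0
  · have : LForm.conjHom (F s ^ n) = F s ^ n := by rw [map_pow, (hF s hs).conj]
    exact LForm.im_eq_zero this _

end

/-! ### Hermitian linear algebra -/

section

variable {n : ℕ}

/-- The Kähler form of a Hermitian inner product on `ℂⁿ`: a tame 2-form that is invariant under the
complex structure. The inner product is `(u, v) ↦ w [u, √-1 v]`. -/
structure IsKahler (w : LForm (Model n)) : Prop extends Tame w where
  inv : LForm.mapHom (mulI n) w = w

theorem mulI_mulI (v : Model n) : mulI n (mulI n v) = -v := by
  rw [mulI_apply, mulI_apply, smul_smul, Complex.I_mul_I, neg_one_smul]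

theorem inv_apply {f : LForm (Model n)} (hf : LForm.mapHom (mulI n) f = f) (u v : Model n) :
    f [mulI n u, mulI n v] = f [u, v] :=
  DFunLike.congr_fun hf [u, v]

theorem inv_apply_left {f : LForm (Model n)} (h2 : IsAlt 2 f) (hf : LForm.mapHom (mulI n) f = f)
    (u v : Model n) : f [mulI n u, v] = -f [u, mulI n v] := by
  rw [← inv_apply hf u (mulI n v), mulI_mulI, h2.apply_two_swap _ (-v),
    h2.apply_two_swap (mulI n u) v]
  have := DFunLike.congr_fun (h2.ι_neg v) [mulI n u]
  simp only [LForm.ι_apply, LForm.neg_apply] at this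
  rw [this]; simp

theorem mapHom_mulI_mulI {k : ℕ} {f : LForm (Model n)} (hf : IsAlt k f) :
    LForm.mapHom (mulI n) (LForm.mapHom (mulI n) f) = (-1 : ℂ) ^ k • f := by
  obtain ⟨α, rfl⟩ := hf
  refine (((isAlt_toL α).mapHom _).mapHom _).hasDegree.ext ((isAlt_toL α).smul _).hasDegree
    fun v => ?_
  rw [LForm.mapHom_apply, LForm.mapHom_apply, List.map_map, List.map_ofFn, toL_ofFn,
    LForm.smul_apply, toL_ofFn]
  have h : (⇑(mulI n) ∘ ⇑(mulI n)) ∘ v = fun i => (-1 : ℝ) • v i := by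
    funext i; simp [mulI_mulI]
  rw [h]
  have := α.toMultilinearMap.map_smul_univ (fun _ => (-1 : ℝ)) v
  simpa using this

theorem mapHom_mulI_mulI_one {f : LForm (Model n)} (hf : IsAlt 1 f) :
    LForm.mapHom (mulI n) (LForm.mapHom (mulI n) f) = -f := by
  rw [mapHom_mulI_mulI hf]; simp

variable {w : LForm (Model n)}

theorem IsKahler.even (hw : IsKahler w) : LForm.hat w = w := hw.isAlt.hat_two

theorem IsKahler.conj_pow (hw : IsKahler w) (k : ℕ) : LForm.conjHom (w ^ k) = w ^ k := by
  rw [map_pow, hw.conj]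

theorem IsKahler.isAlt_top (hw : IsKahler w) : IsAlt (2 * n) (w ^ n) := hw.isAlt.pow n

theorem IsKahler.comm (hw : IsKahler w) (f : LForm (Model n)) (k : ℕ) : f * w ^ k = w ^ k * f :=
  (LForm.mul_comm_of_even (LForm.hat_pow_of_even hw.even k) f).symm

/-- The contraction with `X` of `a ∧ w ^ n = 0`, which holds as its degree exceeds the real
dimension. -/
theorem IsKahler.mul_ι_mul_pow (hw : IsKahler w) (hn : 1 ≤ n) {a : LForm (Model n)}
    (ha : IsAlt 1 a) (X : Model n) :
    (n : ℂ) • (a * LForm.ι X w * w ^ (n - 1)) = a [X] • w ^ n := by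
  have h0 : a * w ^ n = 0 :=
    (ha.mul hw.isAlt_top).eq_zero_of_finrank_lt (by rw [finrank_model]; omega)
  have h1 := congrArg (LForm.ι X) h0
  obtain ⟨m, rfl⟩ : ∃ m, n = m + 1 := ⟨n - 1, by omega⟩
  rw [LForm.ι_mul, LForm.ι_of_degree_one ha.hasDegree, LForm.ι_pow hw.even, ha.hat_one,
    LForm.ι_zero, neg_mul, mul_smul_comm, smul_mul_assoc, one_mul, ← mul_assoc] at h1
  simp only [Nat.add_sub_cancel]
  push_cast
  rw [← sub_eq_add_neg, sub_eq_zero] at h1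
  exact h1.symm

/-- The inner product `w [u, √-1 v]`. -/
def IsKahler.bilin (hw : IsKahler w) : LinearMap.BilinForm ℝ (Model n) :=
  LinearMap.mk₂ ℝ (fun X v => (w [X, mulI n v]).re)
    (fun X Y v => congrArg Complex.re (DFunLike.congr_fun (hw.isAlt.ι_add X Y) [mulI n v]))
    (fun c X v => by
      have := congrArg Complex.re (DFunLike.congr_fun (hw.isAlt.ι_smul c X) [mulI n v])
      rw [LForm.smul_apply, Complex.re_ofReal_mul] at this
      exact this)
    (fun X u v => congrArg Complex.re (DFunLike.congr_fun
      (((hw.isAlt.ι X).mapHom (mulI n)).ι_add u v) []))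
    (fun c X v => by
      have := congrArg Complex.re (DFunLike.congr_fun
        (((hw.isAlt.ι X).mapHom (mulI n)).ι_smul c v) [])
      rw [LForm.smul_apply, Complex.re_ofReal_mul] at this
      exact this)

theorem IsKahler.exists_sharp (hw : IsKahler w) {a : LForm (Model n)} (ha : IsAlt 1 a)
    (hre : LForm.conjHom a = a) :
    ∃ X, ∀ v, a [v] = w [X, mulI n v] := by
  let B := hw.bilin
  have hB (X v : Model n) : B X v = (w [X, mulI n v]).re := rfl
  have hinj : Function.Injective B := by
    rw [← LinearMap.ker_eq_bot, LinearMap.ker_eq_bot']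
    intro X hX
    by_contra h0
    have h1 := hw.pos X h0
    rw [← hB, hX] at h1
    simp at h1
  have hsurj : Function.Surjective B := by
    refine (LinearMap.injective_iff_surjective_of_finrank_eq_finrank ?_).1 hinj
    exact (Subspace.dual_finrank_eq (K := ℝ) (V := Model n)).symm
  obtain ⟨L, hL⟩ := ha.exists_linear
  obtain ⟨X, hX⟩ := hsurj (Complex.reLm ∘ₗ L)
  refine ⟨X, fun v => ?_⟩
  have h1 : B X v = (a [v]).re := by rw [hX]; simp [hL]
  rw [← LForm.ofReal_re hre, ← h1, hB, LForm.ofReal_re hw.conj]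

theorem IsKahler.mapHom_eq_neg_ι (hw : IsKahler w) {a : LForm (Model n)} (ha : IsAlt 1 a)
    {X : Model n}
    (hX : ∀ v, a [v] = w [X, mulI n v]) : LForm.mapHom (mulI n) a = -LForm.ι X w := by
  refine (ha.mapHom _).ext_one (hw.isAlt.ι X).neg fun v => ?_
  change a [mulI n v] = -w [X, v]
  rw [hX, mulI_mulI]
  have := DFunLike.congr_fun ((hw.isAlt.ι X).ι_neg v) []
  exact this

theorem IsKahler.nonneg (hw : IsKahler w) (X : Model n) : 0 ≤ (w [X, mulI n X]).re := by
  by_cases h : X = 0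
  · subst h
    have := congrArg Complex.re (DFunLike.congr_fun (hw.isAlt.ι_smul 0 (0 : Model n))
      [mulI n (0 : Model n)])
    rw [LForm.smul_apply, zero_smul] at this
    simp only [LForm.ι_apply] at this
    rw [this]; simp
  · exact (hw.pos X h).le

/-- For a real 1-form `a` with dual vector `X`, `-a ∧ J a ∧ w ^ (n - 1) = |X|² w ^ n / n`. -/
theorem IsKahler.mul_J_mul_pow (hw : IsKahler w) (hn : 1 ≤ n) {a : LForm (Model n)}
    (ha : IsAlt 1 a) {X : Model n}
    (hX : ∀ v, a [v] = w [X, mulI n v]) :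
    (n : ℂ) • (a * LForm.mapHom (mulI n) a * w ^ (n - 1)) = -(w [X, mulI n X]) • w ^ n := by
  rw [hw.mapHom_eq_neg_ι ha hX, mul_neg, neg_mul, smul_neg, hw.mul_ι_mul_pow hn ha X, hX, neg_smul]

theorem IsKahler.exists_norm (hw : IsKahler w) (hn : 1 ≤ n) {a : LForm (Model n)} (ha : IsAlt 1 a)
    (hre : LForm.conjHom a = a) : ∃ r : ℝ, 0 ≤ r ∧ (r = 0 → a = 0) ∧
      a * LForm.mapHom (mulI n) a * w ^ (n - 1) = -(r : ℂ) • w ^ n := by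
  obtain ⟨X, hX⟩ := hw.exists_sharp ha hre
  have hn0 : (n : ℂ) ≠ 0 := by exact_mod_cast (by omega : n ≠ 0)
  refine ⟨(w [X, mulI n X]).re / n, div_nonneg (hw.nonneg X) (by positivity), fun h => ?_, ?_⟩
  · have h1 : (w [X, mulI n X]).re = 0 := by
      rcases div_eq_zero_iff.1 h with h | h
      · exact h
      · exact absurd (by exact_mod_cast h) hn0
    have hX0 : X = 0 := by
      by_contra h0
      exact (hw.pos X h0).ne' h1
    refine ha.ext_one isAlt_zero fun v => ?_
    rw [hX, hX0]
    have := DFunLike.congr_fun (hw.isAlt.ι_smul 0 (0 : Model n)) [mulI n v]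
    rw [LForm.smul_apply, zero_smul] at this
    exact this.trans (by simp)
  · apply smul_right_injective _ hn0
    simp only
    rw [hw.mul_J_mul_pow hn ha hX, smul_smul]
    congr 1
    push_cast
    rw [LForm.ofReal_re hw.conj]
    field_simp

theorem IsKahler.frame_ne_zero (hw : IsKahler w) : (w ^ n) (frameList n) ≠ 0 := hw.pow_frame_ne_zero

theorem IsKahler.eq_zero_of_smul (hw : IsKahler w) {c : ℂ} (h : c • w ^ n = 0) : c = 0 := by
  have := DFunLike.congr_fun h (frameList n)
  simpa [hw.frame_ne_zero] using this

/-- The multiplication by `w ^ (n - 1)` is injective on 1-forms. -/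
theorem IsKahler.eq_zero_of_mul_pow_eq_zero (hw : IsKahler w) (hn : 1 ≤ n)
    {a : LForm (Model n)} (ha : IsAlt 1 a)
    (h : a * w ^ (n - 1) = 0) : a = 0 := by
  refine ha.ext_one isAlt_zero fun X => hw.eq_zero_of_smul ?_
  rw [← hw.mul_ι_mul_pow hn ha X, mul_assoc, hw.comm, ← mul_assoc, h, zero_mul, smul_zero]

/-- A form of degree `2 n - 1` vanishes if all its products with 1-forms do. -/
theorem IsKahler.eq_zero_of_forall_ι_mul (hw : IsKahler w) {k : ℕ} (hk : k + 1 = 2 * n)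
    {z : LForm (Model n)}
    (hz : IsAlt k z) (h : ∀ X, LForm.ι X w * z = 0) : z = 0 := by
  refine hz.hasDegree.ext (fun _ _ => rfl) fun v => ?_
  have hL (u : Model n) : ∃ L : Model n →ₗ[ℝ] ℂ, ∀ X, L X = w [u, X] := (hw.isAlt.ι u).exists_linear
  choose L hL using hL
  -- Take a nonzero vector `X` that is orthogonal to the `2 n - 1` arguments with respect to `w`.
  -- The contraction of `(ι X w) ∧ z = 0` with `√-1 X`, evaluated at these arguments, is
  -- `w (X, √-1 X)` times the value of `z`.
  obtain ⟨X, hXker, hX0⟩ := (Submodule.ne_bot_iff _).1 (LinearMap.ker_ne_bot_of_finrank_lt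
    (f := LinearMap.pi fun i : Fin k => Complex.reLm ∘ₗ L (v i)) (by
      rw [finrank_model]; simp; omega))
  have hX (u : Model n) (hu : u ∈ List.ofFn v) : LForm.ι X w [u] = 0 := by
    obtain ⟨i, rfl⟩ := List.mem_ofFn.1 hu
    have h1 : (w [v i, X]).re = 0 := by
      have := congrFun hXker i
      simpa [hL] using this
    change w [X, v i] = 0
    rw [hw.isAlt.apply_two_swap, ← LForm.ofReal_re hw.conj, h1]
    simp
  have h1 := congrArg (LForm.ι (mulI n X)) (h X)
  rw [LForm.ι_mul, LForm.ι_of_degree_one (hw.isAlt.ι X).hasDegree, smul_mul_assoc, one_mul,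
    (hw.isAlt.ι X).hat_one, neg_mul, LForm.ι_zero] at h1
  have h2 := DFunLike.congr_fun h1 (List.ofFn v)
  rw [LForm.add_apply, LForm.neg_apply, LForm.mul_apply_eq_zero (hw.isAlt.ι X).hasDegree _ hX,
    LForm.smul_apply, neg_zero, add_zero] at h2
  refine (mul_eq_zero.1 h2).resolve_left fun h3 => ?_
  have := hw.pos X hX0
  rw [show w [X, mulI n X] = 0 from h3] at this
  simp at this

/-- A primitive real `(1, 1)`-form `f` satisfies `-f ∧ f ∧ w ^ (n - 2) = q w ^ n` with `q ≥ 0`, a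
case of the Hodge-Riemann relations. For an orthogonal basis `e i` with dual 1-forms `E i`, the
form `2 f` is the sum of the `E i ∧ ι (e i) f / |e i|²`, and as `f` is primitive,
`E i ∧ f ∧ w ^ (n - 2)` is a multiple of `J (ι (e i) f) ∧ w ^ (n - 1)`. This reduces the claim to
the 1-forms `ι (e i) f`. -/
theorem IsKahler.exists_sq_primitive (hw : IsKahler w) (hn : 2 ≤ n) {f : LForm (Model n)}
    (hf : IsAlt 2 f)
    (hre : LForm.conjHom f = f) (hinv : LForm.mapHom (mulI n) f = f) (hprim : f * w ^ (n - 1) = 0) :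
    ∃ q : ℝ, 0 ≤ q ∧ (q = 0 → f = 0) ∧ f * f * w ^ (n - 2) = -(q : ℂ) • w ^ n := by
  let B := hw.bilin
  have hB (X v : Model n) : B X v = (w [X, mulI n v]).re := rfl
  have hBC (X v : Model n) : (B X v : ℂ) = w [X, mulI n v] := by rw [hB, LForm.ofReal_re hw.conj]
  have hsymm : LinearMap.IsSymm B := ⟨fun u v => by
    have h := hw.isAlt.apply_two_swap u (mulI n v)
    rw [inv_apply_left hw.isAlt hw.inv v u, neg_neg] at h
    exact congrArg Complex.re h⟩
  let _ : Invertible (2 : ℝ) := invertibleOfNonzero two_ne_zero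
  obtain ⟨e, he⟩ := LinearMap.BilinForm.exists_orthogonal_basis (K := ℝ) (B := B) hsymm
  have hpos (i) : 0 < B (e i) (e i) := hw.pos _ (e.ne_zero i)
  -- `E i` is the 1-form dual to `e i`.
  let E := fun i => LForm.ι (-mulI n (e i)) w
  have hE (i) (u : Model n) : E i [u] = (B (e i) u : ℂ) := by
    have h1 := DFunLike.congr_fun (hw.isAlt.ι_neg (mulI n (e i))) [u]
    have h2 : w [mulI n (e i), u] = -w [e i, mulI n u] := inv_apply_left hw.isAlt hw.inv _ _
    rw [hBC]
    refine h1.trans ?_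
    rw [LForm.neg_apply, LForm.ι_apply, h2, neg_neg]
  have hExp (u : Model n) : u = ∑ i, (B (e i) u / B (e i) (e i)) • e i := by
    have hu := (e.sum_repr u).symm
    have h1 (i) : B (e i) u = e.repr u i * B (e i) (e i) := by
      conv_lhs => rw [hu]
      rw [map_sum, Finset.sum_eq_single i]
      · simp
      · intro j _ hj
        rw [map_smul, he hj.symm]; simp
      · simp
    conv_lhs => rw [hu]
    refine Finset.sum_congr rfl fun i _ => ?_
    rw [h1, mul_div_cancel_right₀ _ (hpos i).ne']
  have halt : IsAlt 2 (∑ i, ((1 / B (e i) (e i) : ℝ) : ℂ) • (E i * LForm.ι (e i) f)) := by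
    classical
    have (s : Finset (Fin (Module.finrank ℝ (Model n)))) :
        IsAlt 2 (∑ i ∈ s, ((1 / B (e i) (e i) : ℝ) : ℂ) • (E i * LForm.ι (e i) f)) := by
      induction s using Finset.induction_on with
      | empty => simpa using isAlt_zero
      | insert a s ha ih =>
        rw [Finset.sum_insert ha]
        exact (((hw.isAlt.ι _).mul (hf.ι _)).smul _).add ih
    exact this Finset.univ
  have hsum (u v : Model n) :
      f [u, v] = ∑ i, ((1 / B (e i) (e i) : ℝ) : ℂ) * (E i [u] * f [e i, v]) := by
    have h1 := hf.ι_sum Finset.univ fun i => (B (e i) u / B (e i) (e i)) • e i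
    rw [← hExp] at h1
    have h2 := DFunLike.congr_fun h1 [v]
    rw [LForm.sum_apply] at h2
    refine h2.trans (Finset.sum_congr rfl fun i _ => ?_)
    rw [hf.ι_smul, LForm.smul_apply, hE]
    push_cast
    rw [LForm.ι_apply]
    ring
  have hexpand : (2 : ℂ) • f = ∑ i, ((1 / B (e i) (e i) : ℝ) : ℂ) • (E i * LForm.ι (e i) f) := by
    refine (hf.smul 2).ext_two halt fun u v => ?_
    rw [LForm.sum_apply, LForm.smul_apply, two_mul]
    have h1 (i) : (((1 / B (e i) (e i) : ℝ) : ℂ) • (E i * LForm.ι (e i) f)) [u, v] =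
        ((1 / B (e i) (e i) : ℝ) : ℂ) * (E i [u] * f [e i, v]) -
          ((1 / B (e i) (e i) : ℝ) : ℂ) * (E i [v] * f [e i, u]) := by
      rw [LForm.smul_apply, IsAlt.mul_pair (hw.isAlt.ι _) (hf.ι _)]
      change _ * (E i [u] * f [e i, v] - E i [v] * f [e i, u]) = _
      ring
    simp only [h1]
    rw [Finset.sum_sub_distrib, ← hsum, ← hsum, hf.apply_two_swap v u]
    ring
  -- The contraction of the primitivity of `f` with `-J (e i)`.
  have hprim' (i) : ((n : ℂ) - 1) • (E i * f * w ^ (n - 2)) =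
      -(LForm.mapHom (mulI n) (LForm.ι (e i) f) * w ^ (n - 1)) := by
    obtain ⟨m, rfl⟩ : ∃ m, n = m + 2 := ⟨n - 2, by omega⟩
    have h1 := congrArg (LForm.ι (-mulI (m + 2) (e i))) hprim
    simp only [Nat.add_sub_cancel, show m + 2 - 1 = m + 1 by omega] at h1 ⊢
    rw [LForm.ι_mul, LForm.ι_pow hw.even, hf.hat_two, LForm.ι_zero] at h1
    have h2 : LForm.ι (-mulI (m + 2) (e i)) f = LForm.mapHom (mulI (m + 2)) (LForm.ι (e i) f) := by
      refine (hf.ι _).ext_one ((hf.ι _).mapHom _) fun u => ?_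
      have h3 := DFunLike.congr_fun (hf.ι_neg (mulI (m + 2) (e i))) [u]
      refine h3.trans ?_
      change -f [mulI (m + 2) (e i), u] = f [e i, mulI (m + 2) u]
      rw [inv_apply_left hf hinv, neg_neg]
    rw [h2, mul_smul_comm, ← mul_assoc, LForm.mul_comm_of_even hf.hat_two] at h1
    have h3 : ((m + 2 : ℕ) : ℂ) - 1 = m + 1 := by push_cast; ring
    rw [h3, eq_neg_iff_add_eq_zero]
    exact (add_comm _ _).trans h1
  have hnorm (i) := hw.exists_norm (by omega) (hf.ι (e i)) (a := LForm.ι (e i) f) (by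
    ext l; exact DFunLike.congr_fun hre (e i :: l))
  choose r hr0 hr hreq using hnorm
  have hn1 : (0 : ℝ) < 2 * ((n : ℝ) - 1) := by
    have : (2 : ℝ) ≤ n := by exact_mod_cast hn
    linarith
  refine ⟨(∑ i, (1 / B (e i) (e i)) * r i) / (2 * ((n : ℝ) - 1)), ?_, fun h0 => ?_, ?_⟩
  · exact div_nonneg (Finset.sum_nonneg fun i _ =>
      mul_nonneg (one_div_nonneg.2 (hpos i).le) (hr0 i)) hn1.le
  · have h1 : ∑ i, (1 / B (e i) (e i)) * r i = 0 := by
      rcases div_eq_zero_iff.1 h0 with h | h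
      · exact h
      · exact absurd h hn1.ne'
    rw [Finset.sum_eq_zero_iff_of_nonneg fun i _ =>
      mul_nonneg (one_div_nonneg.2 (hpos i).le) (hr0 i)] at h1
    have h2 (i) : LForm.ι (e i) f = 0 := by
      refine hr i ((mul_eq_zero.1 (h1 i (Finset.mem_univ i))).resolve_left ?_)
      exact one_div_ne_zero (hpos i).ne'
    have h3 : (2 : ℂ) • f = 0 := by
      rw [hexpand]
      exact Finset.sum_eq_zero fun i _ => by rw [h2, mul_zero, smul_zero]
    exact (smul_eq_zero.1 h3).resolve_left two_ne_zero
  · have h1 : (2 * ((n : ℂ) - 1)) • (f * f * w ^ (n - 2)) =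
        -((∑ i, (1 / B (e i) (e i)) * r i : ℝ) : ℂ) • w ^ n := by
      have e1 : (2 * ((n : ℂ) - 1)) • (f * f * w ^ (n - 2)) =
          ((n : ℂ) - 1) • (((2 : ℂ) • f) * f * w ^ (n - 2)) := by
        rw [smul_mul_assoc, smul_mul_assoc, smul_smul, mul_comm]
      rw [e1, hexpand, Finset.sum_mul, Finset.sum_mul, Finset.smul_sum]
      have e2 (i) : ((n : ℂ) - 1) • (((1 / B (e i) (e i) : ℝ) : ℂ) • (E i * LForm.ι (e i) f) * f *
          w ^ (n - 2)) = -(((1 / B (e i) (e i)) * r i : ℝ) : ℂ) • w ^ n := by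
        have e3 : E i * LForm.ι (e i) f = -(LForm.ι (e i) f * E i) := by
          have := LForm.mul_comm_of_odd (hw.isAlt.ι (-mulI n (e i))).hat_one (LForm.ι (e i) f)
          rw [(hf.ι (e i)).hat_one, neg_mul] at this
          exact this
        rw [e3, smul_mul_assoc, smul_mul_assoc, smul_comm, neg_mul, neg_mul, mul_assoc, mul_assoc,
          ← mul_assoc (E i), smul_neg, ← mul_smul_comm, hprim' i, mul_neg, neg_neg, ← mul_assoc,
          hreq, smul_smul]
        push_cast
        congr 1
        ring
      rw [Finset.sum_congr rfl fun i _ => e2 i, ← Finset.sum_smul]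
      congr 1
      push_cast
      rw [Finset.sum_neg_distrib]
    have hnc : (2 * ((n : ℂ) - 1)) ≠ 0 := by
      have := hn1.ne'
      exact_mod_cast this
    apply smul_right_injective _ hnc
    have h2 : ((2 * ((n : ℝ) - 1) : ℝ) : ℂ) = 2 * ((n : ℂ) - 1) := by push_cast; ring
    simp only
    rw [h1, smul_smul, Complex.ofReal_div, h2, mul_neg, mul_div_cancel₀ _ hnc]

end

/-! ### Charts of a complex manifold -/

section

variable {n : ℕ} {M : Type*} [TopologicalSpace M] [ChartedSpace (Model n) M]

variable (n) in
/-- The derivative of the inverse of the chart at `c`. -/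
def chartInvDeriv (c : M) (y : Model n) : Model n →L[ℝ] Model n :=
  mfderiv 𝓘(ℝ, Model n) 𝓘(ℝ, Model n) (chartAt (Model n) c).symm y

variable (n) in
/-- The derivative of the chart at `c`. -/
def chartDeriv (c x : M) : Model n →L[ℝ] Model n :=
  mfderiv 𝓘(ℝ, Model n) 𝓘(ℝ, Model n) (chartAt (Model n) c) x

variable (n) in
/-- The change of coordinates from the chart at `c` to the chart at `c'`. -/
def chartTrans (c c' : M) (y : Model n) : Model n :=
  chartAt (Model n) c' ((chartAt (Model n) c).symm y)

theorem mem_target_chartTrans {c c' : M} {y : Model n}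
    (hx : (chartAt (Model n) c).symm y ∈ (chartAt (Model n) c').source) :
    chartTrans n c c' y ∈ (chartAt (Model n) c').target :=
  (chartAt (Model n) c').map_source hx

theorem symm_chartTrans {c c' : M} {y : Model n}
    (hx : (chartAt (Model n) c).symm y ∈ (chartAt (Model n) c').source) :
    (chartAt (Model n) c').symm (chartTrans n c c' y) = (chartAt (Model n) c).symm y :=
  (chartAt (Model n) c').left_inv hx

theorem eventually_mem_overlap {c c' : M} {y : Model n} (hy : y ∈ (chartAt (Model n) c).target)
    (hx : (chartAt (Model n) c).symm y ∈ (chartAt (Model n) c').source) :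
    ∀ᶠ z in 𝓝 y, z ∈ (chartAt (Model n) c).target ∧
      (chartAt (Model n) c).symm z ∈ (chartAt (Model n) c').source :=
  ((chartAt (Model n) c).open_target.mem_nhds hy |> Filter.Eventually.and <|
    ((chartAt (Model n) c).continuousAt_symm hy).eventually
      ((chartAt (Model n) c').open_source.mem_nhds hx))

variable [IsManifold 𝓘(ℂ, Model n) ω M]

theorem mdifferentiable_chartAt (c : M) :
    (chartAt (Model n) c).MDifferentiable 𝓘(ℝ, Model n) 𝓘(ℝ, Model n) :=
  haveI : IsManifold 𝓘(ℝ, Model n) 1 M := IsManifold.of_le (n := ∞) (by exact_mod_cast le_top)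
  mdifferentiable_chart c

theorem chartDeriv_chartInvDeriv (c : M) {y : Model n} (hy : y ∈ (chartAt (Model n) c).target)
    (v : Model n) :
    chartDeriv n c ((chartAt (Model n) c).symm y) (chartInvDeriv n c y v) = v :=
  DFunLike.congr_fun ((mdifferentiable_chartAt c).comp_symm_deriv hy) v

theorem chartInvDeriv_chartDeriv (c : M) {x : M} (hx : x ∈ (chartAt (Model n) c).source)
    (v : Model n) :
    chartInvDeriv n c (chartAt (Model n) c x) (chartDeriv n c x v) = v :=
  DFunLike.congr_fun ((mdifferentiable_chartAt c).symm_comp_deriv hx) v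

theorem chartInvDeriv_mulI (c : M) {y : Model n} (hy : y ∈ (chartAt (Model n) c).target)
    (v : Model n) : chartInvDeriv n c y (mulI n v) = mulI n (chartInvDeriv n c y v) := by
  have : IsManifold 𝓘(ℂ, Model n) 1 M := IsManifold.of_le (n := ω) le_top
  have h := ((mdifferentiable_chart (I := 𝓘(ℂ, Model n)) c).mdifferentiableAt_symm hy).hasMFDerivAt
  have h2 : HasMFDerivAt 𝓘(ℝ, Model n) 𝓘(ℝ, Model n) (chartAt (Model n) c).symm y
      ((mfderiv 𝓘(ℂ, Model n) 𝓘(ℂ, Model n) (chartAt (Model n) c).symm y :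
        Model n →L[ℂ] Model n).restrictScalars ℝ) :=
    ⟨h.1, h.2.restrictScalars ℝ⟩
  have h3 := h2.mfderiv
  rw [chartInvDeriv, h3]
  exact (mfderiv 𝓘(ℂ, Model n) 𝓘(ℂ, Model n) (chartAt (Model n) c).symm y :
        Model n →L[ℂ] Model n).map_smul Complex.I v

theorem contDiffAt_chartTrans {c c' : M} {y : Model n} (hy : y ∈ (chartAt (Model n) c).target)
    (hx : (chartAt (Model n) c).symm y ∈ (chartAt (Model n) c').source) :
    ContDiffAt ℝ ∞ (chartTrans n c c') y := by
  have h := (mem_groupoid_of_pregroupoid.1 (HasGroupoid.compatible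
    (G := contDiffGroupoid ∞ 𝓘(ℝ, Model n)) (chart_mem_atlas (Model n) c)
      (chart_mem_atlas (Model n) c'))).1
  have h2 : ContDiffOn ℝ ∞ (chartTrans n c c')
      ((chartAt (Model n) c).target ∩
        (chartAt (Model n) c).symm ⁻¹' (chartAt (Model n) c').source) := by
    simp [contDiffPregroupoid, Function.comp_def] at h
    exact h
  exact h2.contDiffAt (eventually_mem_overlap hy hx)

theorem chartInvDeriv_comp_fderiv {c c' : M} {y : Model n} (hy : y ∈ (chartAt (Model n) c).target)
    (hx : (chartAt (Model n) c).symm y ∈ (chartAt (Model n) c').source) (v : Model n) :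
    chartInvDeriv n c' (chartTrans n c c' y) (fderiv ℝ (chartTrans n c c') y v) =
      chartInvDeriv n c y v := by
  have h1 : MDifferentiableAt 𝓘(ℝ, Model n) 𝓘(ℝ, Model n) (chartTrans n c c') y :=
    ((contDiffAt_chartTrans hy hx).differentiableAt (by simp)).mdifferentiableAt
  have h2 : MDifferentiableAt 𝓘(ℝ, Model n) 𝓘(ℝ, Model n) (chartAt (Model n) c').symm
      (chartTrans n c c' y) :=
    (mdifferentiable_chartAt c').mdifferentiableAt_symm (mem_target_chartTrans hx)
  have h3 := mfderiv_comp y h2 h1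
  have h4 : (chartAt (Model n) c').symm ∘ chartTrans n c c' =ᶠ[𝓝 y] (chartAt (Model n) c).symm :=
    (eventually_mem_overlap hy hx).mono fun z hz => symm_chartTrans hz.2
  rw [h4.mfderiv_eq, mfderiv_eq_fderiv] at h3
  exact (DFunLike.congr_fun h3 v).symm

theorem fderiv_chartTrans {c c' : M} {y : Model n} (hy : y ∈ (chartAt (Model n) c).target)
    (hx : (chartAt (Model n) c).symm y ∈ (chartAt (Model n) c').source) (v : Model n) :
    fderiv ℝ (chartTrans n c c') y v =
      chartDeriv n c' ((chartAt (Model n) c).symm y) (chartInvDeriv n c y v) := by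
  rw [← chartInvDeriv_comp_fderiv hy hx, ← symm_chartTrans hx,
    chartDeriv_chartInvDeriv c' (mem_target_chartTrans hx)]

theorem det_chartInvDeriv_pos (c : M) {y : Model n} (hy : y ∈ (chartAt (Model n) c).target) :
    0 < LinearMap.det (chartInvDeriv n c y : Model n →ₗ[ℝ] Model n) := by
  refine det_pos_of_complex _ (fun v => chartInvDeriv_mulI c hy v) fun h0 => ?_
  have h1 : (chartDeriv n c ((chartAt (Model n) c).symm y) : Model n →ₗ[ℝ] Model n) ∘ₗ
      (chartInvDeriv n c y : Model n →ₗ[ℝ] Model n) = LinearMap.id := by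
    ext1 v; exact chartDeriv_chartInvDeriv c hy v
  have h2 := congrArg LinearMap.det h1
  rw [LinearMap.det_comp, h0, mul_zero, LinearMap.det_id] at h2
  exact zero_ne_one h2

theorem det_fderiv_chartTrans_pos {c c' : M} {y : Model n}
    (hy : y ∈ (chartAt (Model n) c).target)
    (hx : (chartAt (Model n) c).symm y ∈ (chartAt (Model n) c').source) :
    0 < LinearMap.det (fderiv ℝ (chartTrans n c c') y : Model n →ₗ[ℝ] Model n) := by
  have h1 : (chartInvDeriv n c' (chartTrans n c c' y) : Model n →ₗ[ℝ] Model n) ∘ₗ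
      (fderiv ℝ (chartTrans n c c') y : Model n →ₗ[ℝ] Model n) = chartInvDeriv n c y := by
    ext1 v; exact chartInvDeriv_comp_fderiv hy hx v
  have h2 := congrArg LinearMap.det h1
  rw [LinearMap.det_comp] at h2
  have h3 := det_chartInvDeriv_pos c hy
  rw [← h2] at h3
  exact pos_of_mul_pos_right h3 (det_chartInvDeriv_pos c' (mem_target_chartTrans hx)).le

end

/-! ### Differential forms as fields in the shuffle algebra -/

section

variable {n : ℕ} {M : Type*} {k l : ℕ} {σ τ : M → LForm (Model n)}

variable (n M) in
/-- The action of the complex structure on fields, as a homomorphism of algebras. -/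
def fieldJ : (M → LForm (Model n)) →ₐ[ℂ] (M → LForm (Model n)) where
  toFun σ x := LForm.mapHom (mulI n) (σ x)
  map_one' := by funext x; exact map_one _
  map_mul' σ τ := by funext x; exact map_mul _ _ _
  map_zero' := by funext x; exact map_zero _
  map_add' σ τ := by funext x; exact map_add _ _ _
  commutes' c := by funext x; exact AlgHom.commutes _ c

variable (n M) in
/-- The complex conjugation of fields. -/
def fieldConj : (M → LForm (Model n)) →+* (M → LForm (Model n)) where
  toFun σ x := LForm.conjHom (σ x)
  map_one' := by funext x; exact map_one _
  map_mul' σ τ := by funext x; exact map_mul _ _ _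
  map_zero' := by funext x; exact map_zero _
  map_add' σ τ := by funext x; exact map_add _ _ _

/-- The grading involution of fields. -/
def fieldHat (σ : M → LForm (Model n)) (x : M) : LForm (Model n) := LForm.hat (σ x)

theorem fieldJ_apply (σ : M → LForm (Model n)) (x : M) :
    fieldJ n M σ x = LForm.mapHom (mulI n) (σ x) := rfl

theorem fieldConj_apply (σ : M → LForm (Model n)) (x : M) :
    fieldConj n M σ x = LForm.conjHom (σ x) := rfl

/-- A field that comes from a differential form of degree `k` (of any regularity). -/
def IsFormField (k : ℕ) (σ : M → LForm (Model n)) : Prop := ∀ x, IsAlt k (σ x)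

theorem IsFormField.mul (hσ : IsFormField k σ) (hτ : IsFormField l τ) :
    IsFormField (k + l) (σ * τ) := fun x => (hσ x).mul (hτ x)

theorem IsFormField.sub (hσ : IsFormField k σ) (hτ : IsFormField k τ) :
    IsFormField k (σ - τ) := fun x => (hσ x).sub (hτ x)

theorem IsFormField.neg (hσ : IsFormField k σ) : IsFormField k (-σ) := fun x => (hσ x).neg

theorem IsFormField.smul (c : ℂ) (hσ : IsFormField k σ) : IsFormField k (c • σ) :=
  fun x => (hσ x).smul c

theorem IsFormField.pow (hσ : IsFormField k σ) (j : ℕ) : IsFormField (k * j) (σ ^ j) :=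
  fun x => (hσ x).pow j

theorem IsFormField.fieldJ (hσ : IsFormField k σ) : IsFormField k (fieldJ n M σ) :=
  fun x => (hσ x).mapHom _

theorem IsFormField.fieldConj (hσ : IsFormField k σ) : IsFormField k (fieldConj n M σ) :=
  fun x => (hσ x).conj

theorem isFormField_zero : IsFormField k (0 : M → LForm (Model n)) := fun _ => isAlt_zero

theorem isFormField_one : IsFormField 0 (1 : M → LForm (Model n)) := fun _ => isAlt_one

theorem IsFormField.fieldHat (hσ : IsFormField k σ) : fieldHat σ = (-1 : ℂ) ^ k • σ :=
  funext fun x => (hσ x).hasDegree.hat_eq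

variable [TopologicalSpace M] [ChartedSpace (Model n) M]

/-- A differential form as a field with values in the shuffle algebra. These fields form a ring,
the product of functions. -/
def Form.toField (α : Form n M k) (x : M) : LForm (Model n) := toL (V := Model n) (α x)

/-- The expression of a field in the chart at `c`. -/
def chartRep (c : M) (σ : M → LForm (Model n)) (y : Model n) : LForm (Model n) :=
  LForm.mapHom (chartInvDeriv n c y) (σ ((chartAt (Model n) c).symm y))

/-- The exterior derivative of a field, computed in the chart at each point. -/
def fieldD (σ : M → LForm (Model n)) (x : M) : LForm (Model n) :=
  LForm.mapHom (chartDeriv n x x) (extD (chartRep x σ) (chartAt (Model n) x x))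

/-- A field is smooth if its expressions in charts are. -/
def SmoothField (σ : M → LForm (Model n)) : Prop :=
  ∀ (c : M) (l : List (Model n)),
    ContDiffOn ℝ ∞ (fun y => chartRep c σ y l) (chartAt (Model n) c).target

theorem IsFormField.exists_form (h : IsFormField k σ) :
    ∃ α : Form n M k, α.toField = σ := by
  choose α hα using h
  exact ⟨α, funext hα⟩

theorem Form.isFormField (α : Form n M k) : IsFormField k α.toField := fun _ => isAlt_toL _

theorem Form.toField_injective : Function.Injective (Form.toField : Form n M k → _) := by
  intro α β h
  funext x
  exact toL_injective (congrFun h x)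

theorem Form.toField_wedge (α : Form n M k) (β : Form n M l) :
    (α.wedge β).toField = α.toField * β.toField := funext fun _ => toL_wedge _ _

theorem Form.toField_pow (β : Form n M 2) (j : ℕ) : (β.pow j).toField = β.toField ^ j :=
  funext fun _ => toL_wedgePow _ _

theorem Form.toField_add (α β : Form n M k) : (α + β).toField = α.toField + β.toField :=
  funext fun _ => toL_add _ _

theorem Form.toField_neg (α : Form n M k) : (-α).toField = -α.toField :=
  funext fun _ => toL_neg _

theorem Form.toField_sub (α β : Form n M k) : (α - β).toField = α.toField - β.toField := by
  rw [sub_eq_add_neg, toField_add, toField_neg, sub_eq_add_neg]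

theorem Form.toField_smul (c : ℂ) (α : Form n M k) : (c • α).toField = c • α.toField :=
  funext fun _ => toL_smul _ _

theorem Form.toField_conj (α : Form n M k) : α.conj.toField = fieldConj n M α.toField :=
  funext fun _ => toL_conj _

theorem Form.toField_J (α : Form n M k) : α.J.toField = fieldJ n M α.toField :=
  funext fun x => toL_comp (V := Model n) (W := Model n) (α x) (mulI n)

theorem Form.toField_cast (h : k = l) (α : Form n M k) : (α.cast h).toField = α.toField := by
  subst h; rfl

/-! #### Expressions in charts -/

theorem chartRep_add (c : M) (σ τ : M → LForm (Model n)) :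
    chartRep c (σ + τ) = fun y => chartRep c σ y + chartRep c τ y := funext fun _ => map_add _ _ _

theorem chartRep_smul (c : M) (a : ℂ) (σ : M → LForm (Model n)) :
    chartRep c (a • σ) = fun y => a • chartRep c σ y :=
  funext fun y => map_smul (LForm.mapHom (chartInvDeriv n c y)) _ _

theorem chartRep_mul (c : M) (σ τ : M → LForm (Model n)) :
    chartRep c (σ * τ) = fun y => chartRep c σ y * chartRep c τ y := funext fun _ => map_mul _ _ _

theorem chartRep_hat (c : M) (σ : M → LForm (Model n)) (y : Model n) :
    chartRep c (fieldHat σ) y = LForm.hat (chartRep c σ y) := (LForm.hat_mapHom _ _).symm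

theorem chartRep_toField (c : M) (α : Form n M k) (y : Model n) :
    chartRep c α.toField y = toL (α.inChart (chartAt (Model n) c) y) :=
  (toL_comp (V := Model n) (W := Model n) (α ((chartAt (Model n) c).symm y))
    (chartInvDeriv n c y)).symm

theorem IsFormField.chartRep (hσ : IsFormField k σ) (c : M) (y : Model n) :
    IsAlt k (chartRep c σ y) := (hσ _).mapHom _

theorem SmoothField.add (hσ : SmoothField σ) (hτ : SmoothField τ) : SmoothField (σ + τ) :=
  fun c l => by
    rw [chartRep_add]
    exact (hσ c l).add (hτ c l)

theorem SmoothField.smul (a : ℂ) (hσ : SmoothField σ) : SmoothField (a • σ) :=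
  fun c l => by
    rw [chartRep_smul]
    exact contDiffOn_const.mul (hσ c l)

theorem SmoothField.neg (hσ : SmoothField σ) : SmoothField (-σ) := by
  rw [← neg_one_smul ℂ]; exact hσ.smul _

theorem SmoothField.sub (hσ : SmoothField σ) (hτ : SmoothField τ) : SmoothField (σ - τ) := by
  rw [sub_eq_add_neg]; exact hσ.add hτ.neg

theorem SmoothField.mul (hσ : SmoothField σ) (hτ : SmoothField τ) : SmoothField (σ * τ) :=
  fun c l => by
    let A : Subring (Model n → ℂ) :=
      { carrier := {u | ContDiffOn ℝ ∞ u (chartAt (Model n) c).target}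
        mul_mem' := fun ha hb => ContDiffOn.mul ha hb
        one_mem' := contDiffOn_const
        add_mem' := fun ha hb => ContDiffOn.add ha hb
        zero_mem' := contDiffOn_const
        neg_mem' := fun ha => ContDiffOn.neg ha }
    rw [chartRep_mul]
    exact LForm.mul_apply_mem A l _ _ (hσ c) (hτ c)

theorem chartRep_smul_one (c : M) (u : M → ℂ) :
    chartRep c (fun x => u x • (1 : LForm (Model n))) =
      fun y => u ((chartAt (Model n) c).symm y) • (1 : LForm (Model n)) := by
  funext y
  change LForm.mapHom _ (u _ • (1 : LForm (Model n))) = _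
  rw [map_smul, map_one]

theorem smoothField_smul_one {u : M → ℂ} (hu : ∀ c : M, ContDiffOn ℝ ∞
    (fun y => u ((chartAt (Model n) c).symm y)) (chartAt (Model n) c).target) :
    SmoothField (fun x => u x • (1 : LForm (Model n))) := fun c l => by
  rw [chartRep_smul_one]
  exact (hu c).mul contDiffOn_const

theorem smoothField_one : SmoothField (1 : M → LForm (Model n)) := by
  have h := smoothField_smul_one (n := n) (M := M) (u := fun _ => 1) fun c => contDiffOn_const
  simpa [funext_iff, Pi.one_def] using h

theorem smoothField_zero : SmoothField (0 : M → LForm (Model n)) := by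
  have h := (smoothField_one (n := n) (M := M)).smul 0
  rwa [zero_smul] at h

theorem SmoothField.pow (hσ : SmoothField σ) (j : ℕ) : SmoothField (σ ^ j) := by
  induction j with
  | zero => rw [pow_zero]; exact smoothField_one
  | succ j ih => rw [pow_succ]; exact ih.mul hσ

theorem SmoothField.differentiableAt (hσ : SmoothField σ) (c : M) {y : Model n}
    (hy : y ∈ (chartAt (Model n) c).target) (l : List (Model n)) :
    DifferentiableAt ℝ (fun y => chartRep c σ y l) y :=
  ((hσ c l).contDiffAt ((chartAt (Model n) c).open_target.mem_nhds hy)).differentiableAt (by simp)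

/-- A map into the alternating forms on `ℂⁿ` is smooth if its values on all vectors are. -/
theorem contDiffOn_of_apply {α : Model n → (Model n) [⋀^Fin k]→L[ℝ] ℂ} {s : Set (Model n)}
    (h : ∀ v, ContDiffOn ℝ ∞ (fun y => α y v) s) : ContDiffOn ℝ ∞ α s := by
  let L : ((Model n) [⋀^Fin k]→L[ℝ] ℂ) →ₗ[ℝ] ((Fin k → Fin (2 * n)) → ℂ) :=
    { toFun := fun a v => a fun i => realBasis n (v i)
      map_add' := fun a b => rfl
      map_smul' := fun r a => rfl }
  have hL : Function.Injective L := by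
    intro a b hab
    apply ContinuousAlternatingMap.toAlternatingMap_injective
    refine Module.Basis.ext_alternating (realBasis n) fun v _ => ?_
    exact congrFun hab v
  obtain ⟨R, hR⟩ := L.exists_leftInverse_of_injective (LinearMap.ker_eq_bot.2 hL)
  have h1 : α = fun y => (LinearMap.toContinuousLinearMap R) (L (α y)) := by
    funext y
    exact (DFunLike.congr_fun hR (α y)).symm
  rw [h1]
  refine (LinearMap.toContinuousLinearMap R).contDiff.comp_contDiffOn ?_
  exact contDiffOn_pi.2 fun v => h _

theorem contDiffOn_inChart {α : Form n M k} (h : SmoothField α.toField) (c : M) :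
    ContDiffOn ℝ ∞ (α.inChart (chartAt (Model n) c)) (chartAt (Model n) c).target := by
  refine contDiffOn_of_apply fun v => ?_
  have := h c (List.ofFn v)
  simpa only [chartRep_toField, toL_ofFn] using this

theorem Form.toField_d {α : Form n M k} (h : SmoothField α.toField) :
    α.d.toField = fieldD α.toField := by
  funext x
  have h1 : DifferentiableAt ℝ (α.inChart (chartAt (Model n) x)) (chartAt (Model n) x x) :=
    ((contDiffOn_inChart h x).contDiffAt ((chartAt (Model n) x).open_target.mem_nhds
      (mem_chart_target _ x))).differentiableAt (by simp)
  have h2 := toL_extDeriv h1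
  have h3 : chartRep x α.toField = fun y => toL (α.inChart (chartAt (Model n) x) y) :=
    funext fun y => chartRep_toField x α y
  rw [fieldD, h3, ← h2]
  exact toL_comp (V := Model n) (W := Model n) _ (chartDeriv n x x)

theorem fieldD_add (hσ : SmoothField σ) (hτ : SmoothField τ) :
    fieldD (σ + τ) = fieldD σ + fieldD τ := by
  funext x
  have hy := mem_chart_target (Model n) x
  simp only [fieldD, chartRep_add, Pi.add_apply]
  rw [extD_add (hσ.differentiableAt x hy) (hτ.differentiableAt x hy), map_add]

theorem fieldD_smul (a : ℂ) (σ : M → LForm (Model n)) : fieldD (a • σ) = a • fieldD σ := by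
  funext x
  simp only [fieldD, chartRep_smul, Pi.smul_apply]
  rw [extD_smul, map_smul]

theorem fieldD_neg (σ : M → LForm (Model n)) : fieldD (-σ) = -fieldD σ := by
  rw [← neg_one_smul ℂ, fieldD_smul, neg_one_smul]

theorem fieldD_sub (hσ : SmoothField σ) (hτ : SmoothField τ) :
    fieldD (σ - τ) = fieldD σ - fieldD τ := by
  rw [sub_eq_add_neg, fieldD_add hσ hτ.neg, fieldD_neg, sub_eq_add_neg]

theorem fieldD_conj (σ : M → LForm (Model n)) :
    fieldD (fieldConj n M σ) = fieldConj n M (fieldD σ) := by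
  funext x
  have hy := mem_chart_target (Model n) x
  have key : ∀ (l : List (Model n)) (F : Model n → LForm (Model n)) (y : Model n),
      extD (fun y => LForm.conjHom (F y)) y l = starRingEnd ℂ (extD F y l) := by
    intro l
    induction l with
    | nil => intro F y; simp [extD_nil]
    | cons v l ih =>
      intro F y
      have h1 : fderiv ℝ (fun z => (LForm.conjHom (F z)) l) y v =
          starRingEnd ℂ (fderiv ℝ (fun z => F z l) y v) := by
        have := (Complex.conjCLE).comp_fderiv (f := fun z => F z l) (x := y)
        exact DFunLike.congr_fun this v
      rw [extD_cons, extD_cons, map_sub, ← h1, ← ih]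
      rfl
  ext l
  rw [fieldConj_apply, LForm.conjHom_apply, fieldD, fieldD, LForm.mapHom_apply, LForm.mapHom_apply,
    ← key]
  rfl

theorem chartRep_frame (hσ : IsFormField (2 * n) σ) (c : M) (y : Model n) :
    chartRep c σ y (frameList n) =
      LinearMap.det (chartInvDeriv n c y : Model n →ₗ[ℝ] Model n) *
        σ ((chartAt (Model n) c).symm y) (frameList n) :=
  (hσ ((chartAt (Model n) c).symm y)).map_frame (chartInvDeriv n c y : Model n →ₗ[ℝ] Model n)

theorem IsFormField.fieldD (hσ : IsFormField k σ) (h : SmoothField σ) :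
    IsFormField (k + 1) (fieldD σ) := by
  obtain ⟨α, rfl⟩ := hσ.exists_form
  rw [← Form.toField_d h]
  exact Form.isFormField _

variable [IsManifold 𝓘(ℂ, Model n) ω M]

theorem chartRep_fieldJ (c : M) (σ : M → LForm (Model n)) {y : Model n}
    (hy : y ∈ (chartAt (Model n) c).target) :
    chartRep c (fieldJ n M σ) y = LForm.mapHom (mulI n) (chartRep c σ y) := by
  ext l
  simp only [chartRep, fieldJ_apply, LForm.mapHom_apply, List.map_map]
  congr 1
  refine List.map_congr_left fun v _ => ?_
  simp [chartInvDeriv_mulI c hy]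

theorem SmoothField.fieldJ (hσ : SmoothField σ) : SmoothField (fieldJ n M σ) := fun c l =>
  (hσ c (l.map (mulI n))).congr fun y hy => by rw [chartRep_fieldJ c σ hy]; rfl

theorem chartRep_chartTrans (σ : M → LForm (Model n)) {c c' : M} {y : Model n}
    (hy : y ∈ (chartAt (Model n) c).target)
    (hx : (chartAt (Model n) c).symm y ∈ (chartAt (Model n) c').source) :
    chartRep c σ y = LForm.mapHom (fderiv ℝ (chartTrans n c c') y)
      (chartRep c' σ (chartTrans n c c' y)) := by
  ext l
  simp only [chartRep, LForm.mapHom_apply, List.map_map, symm_chartTrans hx]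
  congr 1
  refine List.map_congr_left fun v _ => ?_
  exact (chartInvDeriv_comp_fderiv hy hx v).symm

theorem mapHom_chartDeriv_chartRep (c : M) {x : M} (hx : x ∈ (chartAt (Model n) c).source)
    (σ : M → LForm (Model n)) :
    LForm.mapHom (chartDeriv n c x) (chartRep c σ (chartAt (Model n) c x)) = σ x := by
  ext l
  simp only [chartRep, LForm.mapHom_apply, List.map_map, (chartAt (Model n) c).left_inv hx]
  congr 1
  conv_rhs => rw [← List.map_id l]
  exact List.map_congr_left fun v _ => chartInvDeriv_chartDeriv c hx v

theorem Form.extDeriv_inChart {α : Form n M k} (h : SmoothField α.toField) (c : M) {y : Model n}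
    (hy : y ∈ (chartAt (Model n) c).target) :
    chartRep c (fieldD α.toField) y = toL (extDeriv (α.inChart (chartAt (Model n) c)) y) := by
  set x := (chartAt (Model n) c).symm y with hx
  have hxx : (chartAt (Model n) c).symm y ∈ (chartAt (Model n) x).source := mem_chart_source _ x
  have hdiff : DifferentiableAt ℝ (α.inChart (chartAt (Model n) x)) (chartTrans n c x y) :=
    ((contDiffOn_inChart h x).contDiffAt ((chartAt (Model n) x).open_target.mem_nhds
      (mem_target_chartTrans hxx))).differentiableAt (by simp)
  have h1 := extDeriv_pullback hdiff
    (contDiffAt_chartTrans hy hxx) (by simpa using ENat.LEInfty.out)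
  have h2 : (fun z => (α.inChart (chartAt (Model n) x) (chartTrans n c x z)).compContinuousLinearMap
      (fderiv ℝ (chartTrans n c x) z)) =ᶠ[𝓝 y] α.inChart (chartAt (Model n) c) := by
    refine (eventually_mem_overlap hy hxx).mono fun z hz => toL_injective ?_
    rw [toL_comp, ← chartRep_toField, ← chartRep_toField, ← chartRep_chartTrans _ hz.1 hz.2]
  rw [h2.extDeriv_eq] at h1
  rw [h1, toL_comp, toL_extDeriv hdiff]
  have h3 : (fun y => toL (α.inChart (chartAt (Model n) x) y)) = chartRep x α.toField :=
    funext fun y => (chartRep_toField x α y).symm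
  rw [h3]
  ext l
  simp only [chartRep, fieldD, LForm.mapHom_apply, List.map_map, ← hx]
  have h4 : chartTrans n c x y = chartAt (Model n) x x := by rw [chartTrans, ← hx]
  rw [h4]
  congr 1
  exact List.map_congr_left fun v _ => (fderiv_chartTrans hy hxx v).symm

/-- The exterior derivative can be computed in any chart. -/
theorem chartRep_fieldD (hσ : IsFormField k σ) (h : SmoothField σ) (c : M) {y : Model n}
    (hy : y ∈ (chartAt (Model n) c).target) :
    chartRep c (fieldD σ) y = extD (chartRep c σ) y := by
  obtain ⟨α, rfl⟩ := hσ.exists_form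
  have h1 : DifferentiableAt ℝ (α.inChart (chartAt (Model n) c)) y :=
    ((contDiffOn_inChart h c).contDiffAt ((chartAt (Model n) c).open_target.mem_nhds
      hy)).differentiableAt (by simp)
  have h3 : (fun y => toL (α.inChart (chartAt (Model n) c) y)) = chartRep c α.toField :=
    funext fun y => (chartRep_toField c α y).symm
  rw [Form.extDeriv_inChart h c hy, toL_extDeriv h1, h3]

theorem SmoothField.fieldD (hσ : IsFormField k σ) (h : SmoothField σ) : SmoothField (fieldD σ) := by
  intro c l
  have key : ∀ (l : List (Model n)) (F : Model n → LForm (Model n)),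
      (∀ l, ContDiffOn ℝ ∞ (fun y => F y l) (chartAt (Model n) c).target) →
      ContDiffOn ℝ ∞ (fun y => extD F y l) (chartAt (Model n) c).target := by
    intro l
    induction l with
    | nil => intro F _; exact contDiffOn_const
    | cons v l ih =>
      intro F hF
      have h1 : ContDiffOn ℝ ∞ (fun y => fderiv ℝ (fun z => F z l) y v)
          (chartAt (Model n) c).target :=
        ((hF l).fderiv_of_isOpen (chartAt (Model n) c).open_target (by simp)).clm_apply
          contDiffOn_const
      exact h1.sub (ih (fun y => LForm.ι v (F y)) fun l => hF (v :: l))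
  exact (key l _ (h c)).congr fun y hy => by rw [chartRep_fieldD hσ h c hy]

/-- The Leibniz rule for fields. -/
theorem fieldD_mul (hσ : SmoothField σ) (hτ : SmoothField τ) :
    fieldD (σ * τ) = fieldD σ * τ + fieldHat σ * fieldD τ := by
  funext x
  have hy := mem_chart_target (Model n) x
  simp only [fieldD, chartRep_mul, Pi.add_apply, Pi.mul_apply]
  rw [extD_mul (hσ.differentiableAt x hy) (hτ.differentiableAt x hy), map_add, map_mul, map_mul,
    mapHom_chartDeriv_chartRep x (mem_chart_source _ x), ← chartRep_hat,
    mapHom_chartDeriv_chartRep x (mem_chart_source _ x)]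

theorem fieldD_fieldD (hσ : IsFormField k σ) (h : SmoothField σ) : fieldD (fieldD σ) = 0 := by
  funext x
  have hy := mem_chart_target (Model n) x
  obtain ⟨α, rfl⟩ := hσ.exists_form
  have h1 : chartRep x (fieldD α.toField) =ᶠ[𝓝 (chartAt (Model n) x x)]
      fun y => toL (extDeriv (α.inChart (chartAt (Model n) x)) y) :=
    Filter.mem_of_superset ((chartAt (Model n) x).open_target.mem_nhds hy)
      fun y hy => Form.extDeriv_inChart h x hy
  have h2 : ContDiffAt ℝ ∞ (α.inChart (chartAt (Model n) x)) (chartAt (Model n) x x) :=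
    (contDiffOn_inChart h x).contDiffAt ((chartAt (Model n) x).open_target.mem_nhds hy)
  have h4 : ContDiffOn ℝ ∞ (extDeriv (α.inChart (chartAt (Model n) x)))
      (chartAt (Model n) x).target := by
    refine contDiffOn_of_apply fun v => ?_
    refine ((SmoothField.fieldD hσ h) x (List.ofFn v)).congr fun y hy => ?_
    rw [Form.extDeriv_inChart h x hy, toL_ofFn]
  have h5 := toL_extDeriv ((h4.contDiffAt ((chartAt (Model n) x).open_target.mem_nhds
    hy)).differentiableAt (by simp))
  rw [fieldD, extD_congr h1, ← h5, extDeriv_extDeriv_apply h2 (by simpa using ENat.LEInfty.out),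
    toL_zero]
  rfl

end

/-! ### Integration and the theorem of Stokes -/

section

open MeasureTheory

variable {n : ℕ} {M : Type*} [TopologicalSpace M] [ChartedSpace (Model n) M] {k : ℕ}
  {σ τ : M → LForm (Model n)}

/-- The coefficient of a field of top degree in the chart at `c`. -/
def chartCoeff (c : M) (σ : M → LForm (Model n)) (y : Model n) : ℂ :=
  chartRep c σ y (frameList n)

theorem SmoothField.continuousOn_chartCoeff (hσ : SmoothField σ) (c : M) :
    ContinuousOn (chartCoeff c σ) (chartAt (Model n) c).target := (hσ c (frameList n)).continuousOn

theorem isCompact_chart_image {c : M} {K : Set M} (hK : IsCompact K)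
    (hKc : K ⊆ (chartAt (Model n) c).source) : IsCompact (chartAt (Model n) c '' K) :=
  hK.image_of_continuousOn ((chartAt (Model n) c).continuousOn.mono hKc)

theorem integrableOn_target {c : M} {K : Set M} (hK : IsCompact K)
    (hKc : K ⊆ (chartAt (Model n) c).source) {f : Model n → ℂ}
    (hf : ContinuousOn f (chartAt (Model n) c).target)
    (h0 : ∀ y ∈ (chartAt (Model n) c).target, (chartAt (Model n) c).symm y ∉ K → f y = 0) :
    IntegrableOn f (chartAt (Model n) c).target := by
  have h1 : chartAt (Model n) c '' K ⊆ (chartAt (Model n) c).target := by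
    rintro _ ⟨x, hx, rfl⟩
    exact (chartAt (Model n) c).map_source (hKc hx)
  refine ((hf.mono h1).integrableOn_compact (isCompact_chart_image hK hKc)).of_forall_sdiff_eq_zero
    (chartAt (Model n) c).open_target.measurableSet fun y hy => h0 y hy.1 fun hyK => hy.2 ?_
  exact ⟨_, hyK, (chartAt (Model n) c).right_inv hy.1⟩

theorem extD_zero (l : List (Model n)) (y : Model n) :
    extD (fun _ => (0 : LForm (Model n))) y l = 0 := by
  induction l generalizing y with
  | nil => rw [extD_nil]
  | cons v l ih =>
    have h : LForm.ι v (0 : LForm (Model n)) = 0 := LForm.ι_zero v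
    simp [extD_cons, h, ih]

theorem SmoothField.sum {ι : Type*} (s : Finset ι) {f : ι → M → LForm (Model n)}
    (hf : ∀ i ∈ s, SmoothField (f i)) : SmoothField (∑ i ∈ s, f i) := by
  classical
  induction s using Finset.induction_on with
  | empty => rw [Finset.sum_empty]; exact smoothField_zero
  | insert a s ha ih =>
    rw [Finset.sum_insert ha]
    exact (hf a (Finset.mem_insert_self a s)).add
      (ih fun i hi => hf i (Finset.mem_insert_of_mem hi))

theorem fieldD_sum {ι : Type*} (s : Finset ι) {f : ι → M → LForm (Model n)}
    (hf : ∀ i ∈ s, SmoothField (f i)) : fieldD (∑ i ∈ s, f i) = ∑ i ∈ s, fieldD (f i) := by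
  classical
  induction s using Finset.induction_on with
  | empty =>
    have h := fieldD_smul 0 (0 : M → LForm (Model n))
    rwa [zero_smul, zero_smul] at h
  | insert a s ha ih =>
    have h := fun i hi => hf i (Finset.mem_insert_of_mem hi)
    rw [Finset.sum_insert ha, Finset.sum_insert ha,
      fieldD_add (hf a (Finset.mem_insert_self a s)) (SmoothField.sum s h), ih h]

theorem re_chartCoeff (hσ : IsFormField (2 * n) σ) (c : M) (y : Model n) :
    (chartCoeff c σ y).re = LinearMap.det (chartInvDeriv n c y : Model n →ₗ[ℝ] Model n) *
      (σ ((chartAt (Model n) c).symm y) (frameList n)).re := by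
  rw [chartCoeff, chartRep_frame hσ, Complex.re_ofReal_mul]

section

variable [IsManifold 𝓘(ℂ, Model n) ω M]

/-- The change of variables between two charts. -/
theorem setIntegral_overlap (hσ : IsFormField (2 * n) σ) (c c' : M) (u : M → ℂ) :
    ∫ y in (chartAt (Model n) c').target ∩
        (chartAt (Model n) c').symm ⁻¹' (chartAt (Model n) c).source,
      u ((chartAt (Model n) c').symm y) * chartCoeff c' σ y =
    ∫ y in (chartAt (Model n) c).target ∩
        (chartAt (Model n) c).symm ⁻¹' (chartAt (Model n) c').source,
      u ((chartAt (Model n) c).symm y) * chartCoeff c σ y := by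
  have himage : (chartAt (Model n) c').target ∩
      (chartAt (Model n) c').symm ⁻¹' (chartAt (Model n) c).source =
      chartTrans n c c' '' ((chartAt (Model n) c).target ∩
        (chartAt (Model n) c).symm ⁻¹' (chartAt (Model n) c').source) := by
    ext y
    constructor
    · rintro ⟨h1, h2⟩
      have h3 := symm_chartTrans (c := c') (c' := c) h2
      refine ⟨chartTrans n c' c y, ⟨mem_target_chartTrans h2, ?_⟩, ?_⟩
      · rw [Set.mem_preimage, h3]; exact (chartAt (Model n) c').map_target h1
      · rw [chartTrans, h3, (chartAt (Model n) c').right_inv h1]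
    · rintro ⟨z, ⟨h1, h2⟩, rfl⟩
      refine ⟨mem_target_chartTrans h2, ?_⟩
      rw [Set.mem_preimage, symm_chartTrans h2]
      exact (chartAt (Model n) c).map_target h1
  have hmeas : MeasurableSet ((chartAt (Model n) c).target ∩
      (chartAt (Model n) c).symm ⁻¹' (chartAt (Model n) c').source) :=
    ((chartAt (Model n) c).symm.isOpen_inter_preimage
      (chartAt (Model n) c').open_source).measurableSet
  rw [himage, integral_image_eq_integral_abs_det_fderiv_smul volume hmeas
    (f' := fun y => fderiv ℝ (chartTrans n c c') y)]
  · refine setIntegral_congr_fun hmeas fun y hy => ?_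
    change |LinearMap.det (fderiv ℝ (chartTrans n c c') y : Model n →ₗ[ℝ] Model n)| • _ = _
    rw [abs_of_pos (det_fderiv_chartTrans_pos hy.1 hy.2), symm_chartTrans hy.2]
    have h1 := (hσ.chartRep c' (chartTrans n c c' y)).map_frame
      (fderiv ℝ (chartTrans n c c') y : Model n →ₗ[ℝ] Model n)
    have h2 : chartCoeff c σ y = LinearMap.det (fderiv ℝ (chartTrans n c c') y :
        Model n →ₗ[ℝ] Model n) * chartCoeff c' σ (chartTrans n c c' y) := by
      rw [chartCoeff, chartRep_chartTrans σ hy.1 hy.2]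
      exact h1
    rw [h2, Complex.real_smul]
    ring
  · intro y hy
    exact ((contDiffAt_chartTrans hy.1 hy.2).differentiableAt
      (by simp)).hasFDerivAt.hasFDerivWithinAt
  · intro y hy z hz hyz
    have h := congrArg (chartAt (Model n) c').symm hyz
    rw [symm_chartTrans hy.2, symm_chartTrans hz.2] at h
    exact (chartAt (Model n) c).symm.injOn hy.1 hz.1 h

end

variable [CompactSpace M] [T2Space M]

/-- The integral of a field of top degree; see `Form.integral`. -/
def fieldInt (σ : M → LForm (Model n)) : ℂ :=
  ∑ᶠ c : M, ∫ y in (chartAt (Model n) c).target,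
    (chartPartition n M c ((chartAt (Model n) c).symm y) : ℂ) * chartCoeff c σ y

theorem Form.integral_eq_fieldInt (τ : Form n M (2 * n)) : τ.integral = fieldInt τ.toField := by
  have h (c : M) (y : Model n) : chartCoeff c τ.toField y =
      τ.inChart (chartAt (Model n) c) y (realFrame n) := by
    rw [chartCoeff, chartRep_toField, frameList, toL_ofFn]
  simp only [Form.integral, fieldInt, h]

variable (n M) in
theorem tsupport_chartPartition (c : M) :
    tsupport (chartPartition n M c) ⊆ (chartAt (Model n) c).source :=
  (exists_partitionOfUnity n M).choose_spec c

theorem chartPartition_eq_zero {c x : M} (hx : x ∉ tsupport (chartPartition n M c)) :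
    chartPartition n M c x = 0 := image_eq_zero_of_notMem_tsupport hx

variable (n M) in
theorem finite_chartPartition :
    {c : M | (Function.support (chartPartition n M c)).Nonempty}.Finite :=
  (chartPartition n M).locallyFinite.finite_nonempty_of_compact

variable (n M) in
/-- The finitely many indices at which the partition of unity does not vanish identically. -/
def partitionIndices : Finset M := (finite_chartPartition n M).toFinset

theorem chartPartition_apply_of_notMem {c : M} (hc : c ∉ partitionIndices n M) (x : M) :
    chartPartition n M c x = 0 := by
  by_contra hx
  exact hc ((finite_chartPartition n M).mem_toFinset.2 ⟨x, hx⟩)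

theorem sum_chartPartition (x : M) : ∑ c ∈ partitionIndices n M, chartPartition n M c x = 1 := by
  rw [← (chartPartition n M).sum_eq_one (Set.mem_univ x)]
  refine (finsum_eq_sum_of_support_subset _ fun c hc => ?_).symm
  by_contra h
  exact hc (chartPartition_apply_of_notMem h x)

theorem fieldInt_eq_sum (σ : M → LForm (Model n)) :
    fieldInt σ = ∑ c ∈ partitionIndices n M, ∫ y in (chartAt (Model n) c).target,
      (chartPartition n M c ((chartAt (Model n) c).symm y) : ℂ) * chartCoeff c σ y := by
  refine finsum_eq_sum_of_support_subset _ fun c hc => ?_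
  by_contra h
  refine hc ?_
  simp [chartPartition_apply_of_notMem h]

theorem integrableOn_partition_mul (c : M) {f : Model n → ℂ}
    (hf : ContinuousOn f (chartAt (Model n) c).target) :
    IntegrableOn (fun y => (chartPartition n M c ((chartAt (Model n) c).symm y) : ℂ) * f y)
      (chartAt (Model n) c).target := by
  refine integrableOn_target (isClosed_tsupport (chartPartition n M c)).isCompact
    (tsupport_chartPartition n M c) (ContinuousOn.mul ?_ hf) fun y _ h => ?_
  · exact Complex.continuous_ofReal.comp_continuousOn
      ((chartPartition n M c).continuous.comp_continuousOn (chartAt (Model n) c).continuousOn_symm)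
  · simp [chartPartition_eq_zero h]

theorem fieldInt_add (hσ : SmoothField σ) (hτ : SmoothField τ) :
    fieldInt (σ + τ) = fieldInt σ + fieldInt τ := by
  simp only [fieldInt_eq_sum, ← Finset.sum_add_distrib]
  refine Finset.sum_congr rfl fun c _ => ?_
  rw [← integral_add (integrableOn_partition_mul c (hσ.continuousOn_chartCoeff c))
    (integrableOn_partition_mul c (hτ.continuousOn_chartCoeff c))]
  simp only [chartCoeff, chartRep_add, LForm.add_apply, mul_add]

theorem fieldInt_smul (a : ℂ) (σ : M → LForm (Model n)) : fieldInt (a • σ) = a * fieldInt σ := by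
  simp only [fieldInt_eq_sum, Finset.mul_sum, ← integral_const_mul]
  refine Finset.sum_congr rfl fun c _ => ?_
  simp only [chartCoeff, chartRep_smul, LForm.smul_apply]
  congr 1
  funext y
  ring

theorem fieldInt_zero : fieldInt (0 : M → LForm (Model n)) = 0 := by
  have h := fieldInt_smul 0 (0 : M → LForm (Model n))
  rwa [zero_smul, zero_mul] at h

theorem fieldInt_neg (σ : M → LForm (Model n)) : fieldInt (-σ) = -fieldInt σ := by
  rw [← neg_one_smul ℂ, fieldInt_smul, neg_one_mul]

theorem fieldInt_sub (hσ : SmoothField σ) (hτ : SmoothField τ) :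
    fieldInt (σ - τ) = fieldInt σ - fieldInt τ := by
  rw [sub_eq_add_neg, fieldInt_add hσ hτ.neg, fieldInt_neg, sub_eq_add_neg]

theorem fieldInt_sum {ι : Type*} (s : Finset ι) {f : ι → M → LForm (Model n)}
    (hf : ∀ i ∈ s, SmoothField (f i)) : fieldInt (∑ i ∈ s, f i) = ∑ i ∈ s, fieldInt (f i) := by
  classical
  induction s using Finset.induction_on with
  | empty => rw [Finset.sum_empty, Finset.sum_empty, fieldInt_zero]
  | insert a s ha ih =>
    have h := fun i hi => hf i (Finset.mem_insert_of_mem hi)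
    rw [Finset.sum_insert ha, Finset.sum_insert ha,
      fieldInt_add (hf a (Finset.mem_insert_self a s)) (SmoothField.sum s h), ih h]

theorem fieldInt_re (hs : SmoothField σ) :
    (fieldInt σ).re = ∑ c ∈ partitionIndices n M, ∫ y in (chartAt (Model n) c).target,
      chartPartition n M c ((chartAt (Model n) c).symm y) * (chartCoeff c σ y).re := by
  rw [fieldInt_eq_sum, Complex.re_sum]
  refine Finset.sum_congr rfl fun c _ => ?_
  have h := integral_re (𝕜 := ℂ) (integrableOn_partition_mul c (hs.continuousOn_chartCoeff c))
  simp only [RCLike.re_to_complex, Complex.re_ofReal_mul] at h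
  exact h.symm

variable [IsManifold 𝓘(ℂ, Model n) ω M]

theorem partition_mul_re_nonneg (hσ : IsFormField (2 * n) σ)
    (h0 : ∀ x, 0 ≤ (σ x (frameList n)).re) (c : M) {y : Model n}
    (hy : y ∈ (chartAt (Model n) c).target) :
    0 ≤ chartPartition n M c ((chartAt (Model n) c).symm y) * (chartCoeff c σ y).re := by
  rw [re_chartCoeff hσ]
  exact mul_nonneg ((chartPartition n M).nonneg _ _)
    (mul_nonneg (det_chartInvDeriv_pos c hy).le (h0 _))

theorem fieldInt_re_nonneg (hσ : IsFormField (2 * n) σ) (hs : SmoothField σ)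
    (h0 : ∀ x, 0 ≤ (σ x (frameList n)).re) : 0 ≤ (fieldInt σ).re := by
  rw [fieldInt_re hs]
  exact Finset.sum_nonneg fun c _ => setIntegral_nonneg
    (chartAt (Model n) c).open_target.measurableSet fun y hy => partition_mul_re_nonneg hσ h0 c hy

/-- A field of top degree with nonnegative coefficients and vanishing integral vanishes. -/
theorem re_eq_zero_of_fieldInt (hσ : IsFormField (2 * n) σ) (hs : SmoothField σ)
    (h0 : ∀ x, 0 ≤ (σ x (frameList n)).re) (hI : (fieldInt σ).re = 0) (x : M) :
    (σ x (frameList n)).re = 0 := by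
  obtain ⟨c, hc⟩ := (chartPartition n M).exists_pos (Set.mem_univ x)
  have hcs : c ∈ partitionIndices n M := by
    by_contra h
    rw [chartPartition_apply_of_notMem h] at hc
    exact lt_irrefl _ hc
  have hxc : x ∈ (chartAt (Model n) c).source :=
    tsupport_chartPartition n M c (subset_tsupport _ hc.ne')
  rw [fieldInt_re hs, Finset.sum_eq_zero_iff_of_nonneg fun c _ => setIntegral_nonneg
    (chartAt (Model n) c).open_target.measurableSet fun y hy =>
      partition_mul_re_nonneg hσ h0 c hy] at hI
  have hcont : ContinuousOn (fun y => (chartPartition n M c ((chartAt (Model n) c).symm y) : ℝ) *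
      (chartCoeff c σ y).re) (chartAt (Model n) c).target :=
    ((chartPartition n M c).continuous.comp_continuousOn
      (chartAt (Model n) c).continuousOn_symm).mul
      (Complex.continuous_re.comp_continuousOn (hs.continuousOn_chartCoeff c))
  have hint : IntegrableOn (fun y => chartPartition n M c ((chartAt (Model n) c).symm y) *
      (chartCoeff c σ y).re) (chartAt (Model n) c).target := by
    have h := (integrableOn_partition_mul c (hs.continuousOn_chartCoeff c)).re
    simp only [RCLike.re_to_complex, Complex.re_ofReal_mul] at h
    exact h
  have h1 := (setIntegral_eq_zero_iff_of_nonneg_ae (by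
    refine (ae_restrict_iff' (chartAt (Model n) c).open_target.measurableSet).2 ?_
    exact Filter.Eventually.of_forall fun y hy => partition_mul_re_nonneg hσ h0 c hy)
    hint).1 (hI c hcs)
  have h2 := Measure.eqOn_open_of_ae_eq h1 (chartAt (Model n) c).open_target hcont
    continuousOn_const ((chartAt (Model n) c).map_source hxc)
  simp only [Pi.zero_apply, (chartAt (Model n) c).left_inv hxc, re_chartCoeff hσ] at h2
  rcases mul_eq_zero.1 h2 with h2 | h2
  · exact absurd h2 hc.ne'
  · exact (mul_eq_zero.1 h2).resolve_left
      (det_chartInvDeriv_pos c ((chartAt (Model n) c).map_source hxc)).ne'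

/-- The integral of a field supported in a chart can be computed in that chart. In particular, it
does not involve the partition of unity. -/
theorem fieldInt_eq_of_support (hσ : IsFormField (2 * n) σ) (hs : SmoothField σ) {c : M}
    {K : Set M} (hK : IsClosed K) (hKc : K ⊆ (chartAt (Model n) c).source)
    (h0 : ∀ x ∉ K, σ x = 0) :
    fieldInt σ = ∫ y in (chartAt (Model n) c).target, chartCoeff c σ y := by
  have hzero (c' : M) (y : Model n) (h : (chartAt (Model n) c').symm y ∉ K) :
      chartCoeff c' σ y = 0 := by
    rw [chartCoeff, chartRep, h0 _ h, map_zero, LForm.zero_apply]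
  have h1 (c' : M) : ∫ y in (chartAt (Model n) c').target,
      (chartPartition n M c' ((chartAt (Model n) c').symm y) : ℂ) * chartCoeff c' σ y =
      ∫ y in (chartAt (Model n) c).target,
        (chartPartition n M c' ((chartAt (Model n) c).symm y) : ℂ) * chartCoeff c σ y := by
    have h2 := setIntegral_overlap hσ c c' fun x => (chartPartition n M c' x : ℂ)
    rw [setIntegral_eq_of_subset_of_forall_sdiff_eq_zero
        (s := (chartAt (Model n) c').target ∩
          (chartAt (Model n) c').symm ⁻¹' (chartAt (Model n) c).source)
        (chartAt (Model n) c').open_target.measurableSet Set.inter_subset_left,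
      setIntegral_eq_of_subset_of_forall_sdiff_eq_zero
        (s := (chartAt (Model n) c).target ∩
          (chartAt (Model n) c).symm ⁻¹' (chartAt (Model n) c').source)
        (chartAt (Model n) c).open_target.measurableSet Set.inter_subset_left]
    · exact h2
    · intro y hy
      have h3 : (chartAt (Model n) c).symm y ∉ tsupport (chartPartition n M c') :=
        fun h => hy.2 ⟨hy.1, tsupport_chartPartition n M c' h⟩
      simp [chartPartition_eq_zero h3]
    · intro y hy
      rw [hzero c' y fun h => hy.2 ⟨hy.1, hKc h⟩, mul_zero]
  rw [fieldInt_eq_sum]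
  simp only [h1]
  rw [← integral_finsetSum]
  · congr 1
    funext y
    rw [← Finset.sum_mul, ← Complex.ofReal_sum, sum_chartPartition, Complex.ofReal_one, one_mul]
  · intro c' _
    refine integrableOn_target hK.isCompact hKc (ContinuousOn.mul ?_
      (hs.continuousOn_chartCoeff c)) fun y _ h => ?_
    · exact Complex.continuous_ofReal.comp_continuousOn
        ((chartPartition n M c').continuous.comp_continuousOn
          (chartAt (Model n) c).continuousOn_symm)
    · rw [hzero c y h, mul_zero]

theorem integral_fderiv_eq_zero {f : Model n → ℂ} (hf : ContDiff ℝ ∞ f)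
    (hc : HasCompactSupport f) (v : Model n) : ∫ y, fderiv ℝ f y v = 0 := by
  have hd : Integrable fun y => fderiv ℝ f y v := by
    refine Continuous.integrable_of_hasCompactSupport ?_ ?_
    · exact (hf.continuous_fderiv (by simp)).clm_apply continuous_const
    · exact (hc.fderiv ℝ).comp_left (g := fun L : Model n →L[ℝ] ℂ => L v) rfl
  have hi : Integrable f := hf.continuous.integrable_of_hasCompactSupport hc
  have h := integral_mul_fderiv_eq_neg_fderiv_mul_of_integrable (𝕜 := ℂ) (μ := volume)
    (f := fun _ : Model n => (1 : ℂ)) (g := f) (v := v) (by simp) (by simpa using hd)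
    (by simpa using hi) (fun x _ => differentiableAt_const _)
    (fun x _ => (hf.differentiable (by simp)) x)
  simpa using h

/-- The exterior derivative of a compactly supported field on `ℂⁿ` has integral zero on every list
of vectors, because its values are sums of partial derivatives. -/
theorem integral_extD_eq_zero (l : List (Model n)) {F : Model n → LForm (Model n)}
    (hF : ∀ l, ContDiff ℝ ∞ fun y => F y l) (hc : ∀ l, HasCompactSupport fun y => F y l) :
    Integrable (fun y => extD F y l) ∧ ∫ y, extD F y l = 0 := by
  induction l generalizing F with
  | nil => simp [extD_nil]
  | cons v l ih =>
    have hd : Integrable fun y => fderiv ℝ (fun z => F z l) y v := by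
      refine Continuous.integrable_of_hasCompactSupport ?_ ?_
      · exact ((hF l).continuous_fderiv (by simp)).clm_apply continuous_const
      · exact ((hc l).fderiv ℝ).comp_left (g := fun L : Model n →L[ℝ] ℂ => L v) rfl
    obtain ⟨h1, h2⟩ := ih (F := fun y => LForm.ι v (F y)) (fun l => hF (v :: l))
      fun l => hc (v :: l)
    simp only [extD_cons]
    refine ⟨hd.sub h1, ?_⟩
    rw [integral_sub hd h1, h2, integral_fderiv_eq_zero (hF l) (hc l), sub_zero]

theorem fieldInt_fieldD_of_support (hσ : IsFormField k σ) (hs : SmoothField σ) (hk : k + 1 = 2 * n)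
    {c : M} {K : Set M} (hK : IsClosed K) (hKc : K ⊆ (chartAt (Model n) c).source)
    (h0 : ∀ x ∉ K, σ x = 0) : fieldInt (fieldD σ) = 0 := by
  have hd0 : ∀ x ∉ K, fieldD σ x = 0 := by
    intro x hx
    have h1 : chartRep x σ =ᶠ[𝓝 (chartAt (Model n) x x)] fun _ => 0 := by
      have h2 := ((chartAt (Model n) x).continuousAt_symm (mem_chart_target _ x)).eventually
        (hK.isOpen_compl.mem_nhds (by rwa [(chartAt (Model n) x).left_inv (mem_chart_source _ x)]))
      refine h2.mono fun y hy => ?_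
      rw [chartRep, h0 _ hy, map_zero]
    ext l
    rw [fieldD, extD_congr h1, LForm.mapHom_apply, extD_zero]
    rfl
  have hf : IsFormField (2 * n) (fieldD σ) := hk ▸ hσ.fieldD hs
  rw [fieldInt_eq_of_support hf (hs.fieldD hσ) hK hKc hd0]
  set K' := chartAt (Model n) c '' K
  have hK' : IsCompact K' := isCompact_chart_image hK.isCompact hKc
  have hKt : K' ⊆ (chartAt (Model n) c).target := by
    rintro _ ⟨x, hx, rfl⟩
    exact (chartAt (Model n) c).map_source (hKc hx)
  -- The expression in the chart, extended by zero, is smooth as it is supported in `K'`.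
  let F : Model n → LForm (Model n) := (chartAt (Model n) c).target.indicator (chartRep c σ)
  have hF0 : ∀ y ∉ K', F y = 0 := by
    intro y hy
    by_cases hyt : y ∈ (chartAt (Model n) c).target
    · rw [show F y = chartRep c σ y from Set.indicator_of_mem hyt _, chartRep, h0, map_zero]
      exact fun h => hy ⟨_, h, (chartAt (Model n) c).right_inv hyt⟩
    · exact Set.indicator_of_notMem hyt _
  have hFd : ∀ l, ContDiff ℝ ∞ fun y => F y l := by
    intro l
    refine contDiff_iff_contDiffAt.2 fun y => ?_
    by_cases hyt : y ∈ (chartAt (Model n) c).target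
    · have hn := (chartAt (Model n) c).open_target.mem_nhds hyt
      refine ((hs c l).contDiffAt hn).congr_of_eventuallyEq
        (Filter.mem_of_superset hn fun z hz => ?_)
      exact congrArg (fun f : LForm (Model n) => f l) (Set.indicator_of_mem hz _)
    · refine (contDiffAt_const (c := (0 : ℂ))).congr_of_eventuallyEq
        (Filter.mem_of_superset (hK'.isClosed.isOpen_compl.mem_nhds fun h => hyt (hKt h))
          fun z hz => ?_)
      exact congrArg (fun f : LForm (Model n) => f l) (hF0 z hz)
  have hFc : ∀ l, HasCompactSupport fun y => F y l := fun l =>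
    HasCompactSupport.intro hK' fun y hy => congrArg (fun f : LForm (Model n) => f l) (hF0 y hy)
  have h1 : ∀ y ∈ (chartAt (Model n) c).target,
      chartCoeff c (fieldD σ) y = extD F y (frameList n) := by
    intro y hy
    rw [chartCoeff, chartRep_fieldD hσ hs c hy]
    refine (congrArg (fun f : LForm (Model n) => f (frameList n)) (extD_congr ?_)).symm
    exact Filter.mem_of_superset ((chartAt (Model n) c).open_target.mem_nhds hy)
      fun z hz => Set.indicator_of_mem hz _
  rw [setIntegral_congr_fun (chartAt (Model n) c).open_target.measurableSet h1,
    setIntegral_eq_integral_of_forall_compl_eq_zero,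
    (integral_extD_eq_zero (frameList n) hFd hFc).2]
  intro y hy
  have h2 : F =ᶠ[𝓝 y] fun _ => 0 :=
    Filter.mem_of_superset (hK'.isClosed.isOpen_compl.mem_nhds fun h => hy (hKt h)) hF0
  rw [extD_congr h2]
  exact extD_zero _ _

/-- The theorem of Stokes. The form is decomposed by a smooth partition of unity, as the one in the
definition of the integral is only continuous. -/
theorem fieldInt_fieldD (hσ : IsFormField k σ) (hs : SmoothField σ) (hk : k + 1 = 2 * n) :
    fieldInt (fieldD σ) = 0 := by
  obtain ⟨f, hf⟩ := SmoothPartitionOfUnity.exists_isSubordinate_chartAt_source 𝓘(ℝ, Model n) M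
  have hfin := f.locallyFinite.finite_nonempty_of_compact
  set s : Finset M := hfin.toFinset
  have hs0 : ∀ c ∉ s, ∀ x, f c x = 0 := by
    intro c hc x
    by_contra hx
    exact hc (hfin.mem_toFinset.2 ⟨x, hx⟩)
  have hsum (x : M) : ∑ c ∈ s, f c x = 1 := by
    rw [← f.sum_eq_one (Set.mem_univ x)]
    refine (finsum_eq_sum_of_support_subset _ fun c hc => ?_).symm
    by_contra h
    exact hc (hs0 c h x)
  have hsm (c : M) : SmoothField (fun x => (f c x : ℂ) • (1 : LForm (Model n))) := by
    refine smoothField_smul_one (n := n) (M := M) (u := fun x => (f c x : ℂ)) fun c' => ?_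
    have h1 := (f c).contMDiff.comp_contMDiffOn
      (contMDiffOn_chart_symm (I := 𝓘(ℝ, Model n)) (n := ∞) (x := c'))
    exact Complex.ofRealCLM.contDiff.comp_contDiffOn h1.contDiffOn
  have hff (c : M) : IsFormField 0 (fun x => (f c x : ℂ) • (1 : LForm (Model n))) :=
    fun x => isAlt_one.smul _
  have hdec : σ = ∑ c ∈ s, (fun x => (f c x : ℂ) • (1 : LForm (Model n))) * σ := by
    funext x
    rw [Finset.sum_apply]
    simp only [Pi.mul_apply, ← Finset.sum_mul, ← Finset.sum_smul, ← Complex.ofReal_sum, hsum]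
    rw [Complex.ofReal_one, one_smul, one_mul]
  have hpf (c : M) : IsFormField k ((fun x => (f c x : ℂ) • (1 : LForm (Model n))) * σ) := by
    have := (hff c).mul hσ
    rwa [zero_add] at this
  rw [hdec, fieldD_sum s fun c _ => (hsm c).mul hs,
    fieldInt_sum s fun c _ => ((hsm c).mul hs).fieldD (hpf c)]
  refine Finset.sum_eq_zero fun c _ => ?_
  refine fieldInt_fieldD_of_support (hpf c) ((hsm c).mul hs) hk (isClosed_tsupport (f c)) (hf c)
    fun x hx => ?_
  have h1 : f c x = 0 := image_eq_zero_of_notMem_tsupport hx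
  simp [h1]

end

/-! ### The Lee form -/

section

variable {n : ℕ} {w β : LForm (Model n)} {k : ℕ}

/-- The 1-form `a` that satisfies `a ∧ w ^ (n - 1) = -β`, for a form `β` of degree `2 n - 1` and
the Kähler form `w` of a Hermitian inner product. -/
def leeAt (w β : LForm (Model n)) : LForm (Model n) :=
  ⟨fun l => if h : l.length = 1 then
    n * (LForm.ι (l.get ⟨0, by omega⟩) w * β) (frameList n) / (w ^ n) (frameList n) else 0⟩

theorem leeAt_apply (w β : LForm (Model n)) (X : Model n) :
    leeAt w β [X] = n * (LForm.ι X w * β) (frameList n) / (w ^ n) (frameList n) := rfl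

theorem isAlt_leeAt (hw : IsAlt 2 w) : IsAlt 1 (leeAt w β) := by
  let L : Model n →ₗ[ℝ] ℂ :=
    { toFun := fun X => n * (LForm.ι X w * β) (frameList n) / (w ^ n) (frameList n)
      map_add' := fun X Y => by
        rw [hw.ι_add, add_mul, LForm.add_apply]; ring
      map_smul' := fun c X => by
        rw [hw.ι_smul, smul_mul_assoc, LForm.smul_apply, RingHom.id_apply, Complex.real_smul]
        ring }
  exact isAlt_one_of_linear (LinearMap.toContinuousLinearMap L)

theorem IsKahler.leeAt_mul (hw : IsKahler w) (hn : 1 ≤ n) (hβ : IsAlt k β) (hk : k + 1 = 2 * n) :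
    leeAt w β * w ^ (n - 1) = -β := by
  have ha : IsAlt 1 (leeAt w β) := isAlt_leeAt hw.isAlt
  have hk' : k = 1 + 2 * (n - 1) := by omega
  rw [eq_neg_iff_add_eq_zero]
  refine hw.eq_zero_of_forall_ι_mul hk
    (IsAlt.add (by rw [hk']; exact ha.mul (hw.isAlt.pow _)) hβ) fun X => ?_
  have hX : IsAlt 1 (LForm.ι X w) := hw.isAlt.ι X
  have hn0 : (n : ℂ) ≠ 0 := by exact_mod_cast (by omega : n ≠ 0)
  have h1 : LForm.ι X w * leeAt w β = -(leeAt w β * LForm.ι X w) := by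
    rw [LForm.mul_comm_of_odd hX.hat_one, ha.hat_one, neg_mul]
  have hβX : IsAlt (2 * n) (LForm.ι X w * β) := by rw [← hk, add_comm]; exact hX.mul hβ
  have h2 : (n : ℂ) • (LForm.ι X w * β) = leeAt w β [X] • w ^ n := by
    conv_lhs => rw [hβX.eq_smul_of_frame hw.isAlt_top hw.frame_ne_zero]
    rw [leeAt_apply, smul_smul, mul_div_assoc]
  have h3 : (n : ℂ) • (LForm.ι X w * (leeAt w β * w ^ (n - 1) + β)) = 0 := by
    rw [mul_add, ← mul_assoc, h1, neg_mul, smul_add, smul_neg, hw.mul_ι_mul_pow hn ha X, h2,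
      neg_add_cancel]
  exact (smul_eq_zero.1 h3).resolve_left hn0

theorem mapHom_leeAt (hw : IsAlt 2 w) (hβ : IsAlt k β) (hk : k + 1 = 2 * n)
    {A : Model n →L[ℝ] Model n} (hA : LinearMap.det (A : Model n →ₗ[ℝ] Model n) ≠ 0) :
    LForm.mapHom A (leeAt w β) = leeAt (LForm.mapHom A w) (LForm.mapHom A β) := by
  refine ((isAlt_leeAt hw).mapHom A).ext_one (isAlt_leeAt (hw.mapHom A)) fun X => ?_
  have hβX : IsAlt (2 * n) (LForm.ι (A X) w * β) := by
    rw [← hk, add_comm]; exact (IsAlt.ι hw (A X)).mul hβ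
  have h1 : (LForm.ι X (LForm.mapHom A w) * LForm.mapHom A β) (frameList n) =
      LinearMap.det (A : Model n →ₗ[ℝ] Model n) * (LForm.ι (A X) w * β) (frameList n) := by
    rw [← hβX.map_frame (A : Model n →ₗ[ℝ] Model n)]
    change (LForm.mapHom A (LForm.ι (A X) w) * LForm.mapHom A β) (frameList n) = _
    rw [← map_mul]
    rfl
  have h2 : (LForm.mapHom A w ^ n) (frameList n) =
      LinearMap.det (A : Model n →ₗ[ℝ] Model n) * (w ^ n) (frameList n) := by
    rw [← (hw.pow n).map_frame (A : Model n →ₗ[ℝ] Model n), ← map_pow]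
    rfl
  have hA' : ((LinearMap.det (A : Model n →ₗ[ℝ] Model n) : ℝ) : ℂ) ≠ 0 := by exact_mod_cast hA
  rw [leeAt_apply, h1, h2, LForm.mapHom_apply]
  change leeAt w β [A X] = _
  rw [leeAt_apply, mul_left_comm, mul_div_mul_left _ _ hA']

end

section

variable {n : ℕ} {M : Type*} {k : ℕ} {w σ τ : M → LForm (Model n)}

theorem IsFormField.fieldJ_eq_of_top (hσ : IsFormField (2 * n) σ) :
    HermitianGeometry.fieldJ n M σ = σ :=
  funext fun x => (hσ x).mapHom_mulI_top

theorem IsFormField.fieldJ_fieldJ (hσ : IsFormField 1 σ) : 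
    HermitianGeometry.fieldJ n M (HermitianGeometry.fieldJ n M σ) = -σ :=
  funext fun x => mapHom_mulI_mulI_one (hσ x)

theorem IsFormField.eq_zero_of_dim_zero (hσ : IsFormField 1 σ) (hn : n = 0) : σ = 0 :=
  funext fun x => (hσ x).eq_zero_of_finrank_lt (by rw [finrank_model]; omega)

theorem IsFormField.mul_anticomm (hσ : IsFormField 1 σ) (hτ : IsFormField 1 τ) :
    σ * τ = -(τ * σ) := funext fun x => by
  rw [Pi.mul_apply, Pi.neg_apply, Pi.mul_apply, LForm.mul_comm_of_odd (hσ x).hat_one,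
    (hτ x).hat_one, neg_mul]

theorem fieldJ_fieldConj_comm (σ : M → LForm (Model n)) :
    fieldJ n M (fieldConj n M σ) = fieldConj n M (fieldJ n M σ) := rfl

theorem fieldConj_smul_real (a : ℂ) (ha : starRingEnd ℂ a = a) (σ : M → LForm (Model n)) :
    fieldConj n M (a • σ) = a • fieldConj n M σ := by
  funext x
  ext l
  simp only [fieldConj_apply, LForm.conjHom_apply, Pi.smul_apply, LForm.smul_apply, map_mul, ha]

theorem re_smul_pow_frame (w : M → LForm (Model n)) (r : ℝ) (x : M) :
    (((r : ℂ) • (w x) ^ n) (frameList n)).re = r * ((w x ^ n) (frameList n)).re := by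
  rw [LForm.smul_apply, Complex.re_ofReal_mul]

variable [TopologicalSpace M] [ChartedSpace (Model n) M]

/-- The Kähler form of a smooth Hermitian metric, as a field. -/
structure IsKahlerField (w : M → LForm (Model n)) : Prop where
  kahler : ∀ x, IsKahler (w x)
  smooth : SmoothField w

/-- The Lee form of a Hermitian metric with Kähler form `w`: the real 1-form `θ` with
`d (w ^ (n - 1)) = -θ ∧ w ^ (n - 1)`. -/
def leeField (w : M → LForm (Model n)) (x : M) : LForm (Model n) :=
  leeAt (w x) (fieldD (w ^ (n - 1)) x)

namespace IsKahlerField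

theorem isFormField (hw : IsKahlerField w) : IsFormField 2 w := fun x => (hw.kahler x).isAlt

theorem isFormField_pow (hw : IsKahlerField w) (j : ℕ) : IsFormField (2 * j) (w ^ j) :=
  hw.isFormField.pow j

theorem fieldJ_eq (hw : IsKahlerField w) : fieldJ n M w = w := funext fun x => (hw.kahler x).inv

theorem fieldJ_pow (hw : IsKahlerField w) (j : ℕ) : fieldJ n M (w ^ j) = w ^ j := by
  rw [map_pow, hw.fieldJ_eq]

theorem fieldConj_eq (hw : IsKahlerField w) : fieldConj n M w = w :=
  funext fun x => (hw.kahler x).conj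

theorem fieldConj_pow (hw : IsKahlerField w) (j : ℕ) : fieldConj n M (w ^ j) = w ^ j := by
  rw [map_pow, hw.fieldConj_eq]

theorem mul_comm (hw : IsKahlerField w) (σ : M → LForm (Model n)) (j : ℕ) :
    σ * w ^ j = w ^ j * σ := funext fun x => (hw.kahler x).comm (σ x) j

theorem isFormField_fieldD_pow (hw : IsKahlerField w) (hn : 1 ≤ n) :
    IsFormField (2 * n - 1) (fieldD (w ^ (n - 1))) := by
  have h := (hw.isFormField_pow (n - 1)).fieldD (hw.smooth.pow _)
  rwa [show 2 * (n - 1) + 1 = 2 * n - 1 by omega] at h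

theorem isFormField_lee (hw : IsKahlerField w) : IsFormField 1 (leeField w) :=
  fun x => isAlt_leeAt (hw.kahler x).isAlt

theorem lee_mul (hw : IsKahlerField w) (hn : 1 ≤ n) :
    leeField w * w ^ (n - 1) = -fieldD (w ^ (n - 1)) :=
  funext fun x => (hw.kahler x).leeAt_mul hn (hw.isFormField_fieldD_pow hn x) (by omega)

theorem eq_of_mul_pow_eq (hw : IsKahlerField w) (hσ : IsFormField 1 σ) (hτ : IsFormField 1 τ)
    (h : σ * w ^ (n - 1) = τ * w ^ (n - 1)) : σ = τ := by
  rw [← sub_eq_zero]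
  rcases Nat.eq_zero_or_pos n with hn | hn
  · exact (hσ.sub hτ).eq_zero_of_dim_zero hn
  · rw [← sub_eq_zero, ← sub_mul] at h
    exact funext fun x => (hw.kahler x).eq_zero_of_mul_pow_eq_zero hn (hσ.sub hτ x) (congrFun h x)

theorem fieldConj_lee (hw : IsKahlerField w) : fieldConj n M (leeField w) = leeField w := by
  rcases Nat.eq_zero_or_pos n with hn | hn
  · rw [hw.isFormField_lee.eq_zero_of_dim_zero hn, map_zero]
  · refine hw.eq_of_mul_pow_eq hw.isFormField_lee.fieldConj hw.isFormField_lee ?_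
    rw [hw.lee_mul hn, ← hw.fieldConj_pow, ← map_mul, hw.lee_mul hn, map_neg, ← fieldD_conj,
      hw.fieldConj_pow]

/-- The number `r` is the squared norm of the Lee form divided by `n`. -/
theorem exists_norm_lee (hw : IsKahlerField w) (hn : 1 ≤ n) (x : M) :
    ∃ r : ℝ, 0 ≤ r ∧ (r = 0 → leeField w x = 0) ∧
      (leeField w * fieldJ n M (leeField w) * w ^ (n - 1)) x = -(r : ℂ) • (w x) ^ n :=
  (hw.kahler x).exists_norm hn (hw.isFormField_lee x) (congrFun hw.fieldConj_lee x)

theorem isFormField_J_lee (hw : IsKahlerField w) : IsFormField 1 (fieldJ n M (leeField w)) :=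
  hw.isFormField_lee.fieldJ

theorem fieldConj_J_lee (hw : IsKahlerField w) :
    fieldConj n M (fieldJ n M (leeField w)) = fieldJ n M (leeField w) := by
  rw [← fieldJ_fieldConj_comm, hw.fieldConj_lee]

theorem isFormField_norm_lee (hw : IsKahlerField w) (hn : 1 ≤ n) :
    IsFormField (2 * n) (-(leeField w * fieldJ n M (leeField w) * w ^ (n - 1))) := by
  have h := ((hw.isFormField_lee.mul hw.isFormField_J_lee).mul (hw.isFormField_pow (n - 1))).neg
  rwa [show 1 + 1 + 2 * (n - 1) = 2 * n by omega] at h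

theorem norm_lee_nonneg (hw : IsKahlerField w) (hn : 1 ≤ n) (x : M) :
    0 ≤ ((-(leeField w * fieldJ n M (leeField w) * w ^ (n - 1))) x (frameList n)).re := by
  obtain ⟨r, hr, -, h⟩ := hw.exists_norm_lee hn x
  rw [Pi.neg_apply, h, neg_smul, neg_neg, re_smul_pow_frame]
  exact mul_nonneg hr ((hw.kahler x).pow_frame_pos).le

theorem fieldConj_d_J_lee (hw : IsKahlerField w) :
    fieldConj n M (fieldD (fieldJ n M (leeField w))) = fieldD (fieldJ n M (leeField w)) := by
  rw [← fieldD_conj, hw.fieldConj_J_lee]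

variable [IsManifold 𝓘(ℂ, Model n) ω M]

theorem smooth_lee (hw : IsKahlerField w) : SmoothField (leeField w) := by
  rcases Nat.eq_zero_or_pos n with hn | hn
  · rw [hw.isFormField_lee.eq_zero_of_dim_zero hn]
    exact smoothField_zero
  intro c l
  have hd : SmoothField (fieldD (w ^ (n - 1))) :=
    SmoothField.fieldD (hw.isFormField_pow (n - 1)) (hw.smooth.pow _)
  have hrep : ∀ y ∈ (chartAt (Model n) c).target, chartRep c (leeField w) y =
      leeAt (chartRep c w y) (chartRep c (fieldD (w ^ (n - 1))) y) := fun y hy =>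
    mapHom_leeAt (hw.kahler _).isAlt (hw.isFormField_fieldD_pow hn _) (by omega)
      (det_chartInvDeriv_pos c hy).ne'
  refine ContDiffOn.congr ?_ fun y hy => by rw [hrep y hy]
  by_cases hl : l.length = 1
  · obtain ⟨X, rfl⟩ := List.length_eq_one_iff.1 hl
    simp only [leeAt_apply]
    let A : Subring (Model n → ℂ) :=
      { carrier := {u | ContDiffOn ℝ ∞ u (chartAt (Model n) c).target}
        mul_mem' := fun ha hb => ContDiffOn.mul ha hb
        one_mem' := contDiffOn_const
        add_mem' := fun ha hb => ContDiffOn.add ha hb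
        zero_mem' := contDiffOn_const
        neg_mem' := fun ha => ContDiffOn.neg ha }
    have h1 : ContDiffOn ℝ ∞ (fun y => (LForm.ι X (chartRep c w y) *
        chartRep c (fieldD (w ^ (n - 1))) y) (frameList n)) (chartAt (Model n) c).target :=
      LForm.mul_apply_mem A (frameList n) (fun y => LForm.ι X (chartRep c w y)) _
        (fun l => hw.smooth c (X :: l)) (hd c)
    have h2 : ContDiffOn ℝ ∞ (fun y => (chartRep c w y ^ n) (frameList n))
        (chartAt (Model n) c).target := by
      refine ((hw.smooth.pow n) c (frameList n)).congr fun y _ => ?_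
      change _ = (LForm.mapHom _ ((w ^ n) _)) _
      rw [Pi.pow_apply, map_pow]
      rfl
    simp only [div_eq_mul_inv]
    refine (contDiffOn_const.mul h1).mul (h2.inv fun y hy => ?_)
    have h3 := chartRep_frame (hw.isFormField_pow n) c y
    have h4 : (chartRep c w y ^ n) (frameList n) = chartRep c (w ^ n) y (frameList n) := by
      change _ = (LForm.mapHom _ ((w ^ n) _)) _
      rw [Pi.pow_apply, map_pow]
      rfl
    rw [h4, h3]
    exact mul_ne_zero (by exact_mod_cast (det_chartInvDeriv_pos c hy).ne')
      (hw.kahler _).frame_ne_zero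
  · have h (y : Model n) : leeAt (chartRep c w y)
        (chartRep c (fieldD (w ^ (n - 1))) y) l = 0 := dif_neg hl
    simp only [h]
    exact contDiffOn_const

end IsKahlerField

/-! ### The vanishing theorem -/

/-- The torsion field, the form `√-1 (∂ (conj η) - ∂bar η - η ∧ conj η)` in terms of the Lee form
`θ`, where `η = (θ - √-1 J θ) / 2`. -/
def torsionField (w : M → LForm (Model n)) : M → LForm (Model n) :=
  (1 / 2 : ℂ) • (leeField w * fieldJ n M (leeField w) - fieldD (fieldJ n M (leeField w)) -
    fieldJ n M (fieldD (fieldJ n M (leeField w))))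

theorem IsKahlerField.fieldConj_torsion (hw : IsKahlerField w) :
    fieldConj n M (torsionField w) = torsionField w := by
  rw [torsionField, fieldConj_smul_real _ (by simp [Complex.conj_ofNat]), map_sub, map_sub,
    map_mul, hw.fieldConj_lee, ← fieldJ_fieldConj_comm (fieldD _), hw.fieldConj_d_J_lee,
    hw.fieldConj_J_lee]

variable [IsManifold 𝓘(ℂ, Model n) ω M]

namespace IsKahlerField

theorem smooth_J_lee (hw : IsKahlerField w) : SmoothField (fieldJ n M (leeField w)) :=
  hw.smooth_lee.fieldJ

theorem isFormField_d_J_lee (hw : IsKahlerField w) :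
    IsFormField 2 (fieldD (fieldJ n M (leeField w))) := hw.isFormField_J_lee.fieldD hw.smooth_J_lee

theorem smooth_d_J_lee (hw : IsKahlerField w) :
    SmoothField (fieldD (fieldJ n M (leeField w))) := hw.smooth_J_lee.fieldD hw.isFormField_J_lee

theorem isFormField_torsion (hw : IsKahlerField w) : IsFormField 2 (torsionField w) :=
  (((hw.isFormField_lee.mul hw.isFormField_J_lee).sub hw.isFormField_d_J_lee).sub
    hw.isFormField_d_J_lee.fieldJ).smul _

theorem fieldJ_torsion (hw : IsKahlerField w) : fieldJ n M (torsionField w) = torsionField w := by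
  have h : fieldJ n M (fieldJ n M (fieldD (fieldJ n M (leeField w)))) =
      fieldD (fieldJ n M (leeField w)) := funext fun x => by
    have h1 := mapHom_mulI_mulI (hw.isFormField_d_J_lee x)
    rwa [neg_one_sq, one_smul] at h1
  rw [torsionField, map_smul, map_sub, map_sub, h, map_mul,
    hw.isFormField_lee.fieldJ_fieldJ, mul_neg, ← hw.isFormField_lee.mul_anticomm
      hw.isFormField_J_lee, sub_right_comm]

theorem smooth_torsion (hw : IsKahlerField w) : SmoothField (torsionField w) :=
  (((hw.smooth_lee.mul hw.smooth_J_lee).sub hw.smooth_d_J_lee).sub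
    hw.smooth_d_J_lee.fieldJ).smul _

theorem smooth_norm_lee (hw : IsKahlerField w) :
    SmoothField (-(leeField w * fieldJ n M (leeField w) * w ^ (n - 1))) :=
  ((hw.smooth_lee.mul hw.smooth_J_lee).mul (hw.smooth.pow (n - 1))).neg

/-- If the torsion form is a positive multiple of the Kähler form, then `-d (J θ)` is tame. -/
theorem tame_neg_d_J_lee (hw : IsKahlerField w) {a : ℝ} (ha : 0 < a)
    (h : torsionField w = (a : ℂ) • w) (x : M) :
    Tame ((-fieldD (fieldJ n M (leeField w))) x) where
  isAlt := (hw.isFormField_d_J_lee x).neg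
  conj := by
    have := congrFun hw.fieldConj_d_J_lee x
    rw [fieldConj_apply] at this
    rw [Pi.neg_apply, map_neg, this]
  pos := by
    intro v hv
    set f := fieldD (fieldJ n M (leeField w)) x with hf
    have hf2 : IsAlt 2 f := hw.isFormField_d_J_lee x
    have h1 := congrArg Complex.re (DFunLike.congr_fun (congrFun h x) [v, mulI n v])
    have h2 : LForm.mapHom (mulI n) f [v, mulI n v] = f [v, mulI n v] := by
      change f [mulI n v, mulI n (mulI n v)] = _
      rw [mulI_mulI, hf2.apply_two_swap, hf2.apply_two_swap v]
      have := DFunLike.congr_fun (hf2.ι_neg v) [mulI n v]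
      simp only [LForm.ι_apply, LForm.neg_apply] at this
      rw [this, hf2.apply_two_swap (mulI n v) v]
    have h3 := (hw.isFormField_lee x).mul_pair (hw.isFormField_J_lee x) v (mulI n v)
    have h4 : fieldJ n M (leeField w) x [mulI n v] = -leeField w x [v] := by
      change leeField w x [mulI n (mulI n v)] = _
      rw [mulI_mulI]
      exact DFunLike.congr_fun ((hw.isFormField_lee x).ι_neg v) []
    have h5 : fieldJ n M (leeField w) x [v] = leeField w x [mulI n v] := rfl
    rw [h4, h5] at h3
    have hl (u : Model n) : (leeField w x [u]).im = 0 :=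
      LForm.im_eq_zero (congrFun hw.fieldConj_lee x) _
    have h6 := (hw.kahler x).pos v hv
    have h7 : torsionField w x [v, mulI n v] = (1 / 2 : ℂ) *
        ((leeField w x * fieldJ n M (leeField w) x) [v, mulI n v] - f [v, mulI n v] -
          LForm.mapHom (mulI n) f [v, mulI n v]) := rfl
    rw [h7, h2, h3, Pi.smul_apply, LForm.smul_apply, Complex.re_ofReal_mul] at h1
    simp only [Complex.mul_re, Complex.sub_re, Complex.neg_re, Complex.div_ofNat_re,
      Complex.div_ofNat_im, Complex.one_re, Complex.one_im, Complex.neg_im, hl, Complex.sub_im,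
      Complex.mul_im] at h1
    rw [Pi.neg_apply, LForm.neg_apply, Complex.neg_re]
    -- Evaluated at `(v, √-1 v)`, the equation says `2 Φ = 2 a w + θ (v) ² + θ (√-1 v) ²`.
    nlinarith [mul_pos ha h6, sq_nonneg (leeField w x [v]).re,
      sq_nonneg (leeField w x [mulI n v]).re]

variable [CompactSpace M] [T2Space M]

theorem fieldInt_pow_re_nonneg (hw : IsKahlerField w) : 0 ≤ (fieldInt (w ^ n)).re :=
  fieldInt_re_nonneg (hw.isFormField_pow n) (hw.smooth.pow n)
    fun x => ((hw.kahler x).pow_frame_pos).le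

theorem fieldInt_pow_re_pos [Nonempty M] (hw : IsKahlerField w) : 0 < (fieldInt (w ^ n)).re := by
  refine lt_of_le_of_ne hw.fieldInt_pow_re_nonneg fun h => ?_
  obtain ⟨x⟩ := ‹Nonempty M›
  have h1 := re_eq_zero_of_fieldInt (hw.isFormField_pow n) (hw.smooth.pow n)
    (fun x => ((hw.kahler x).pow_frame_pos).le) h.symm x
  exact ((hw.kahler x).pow_frame_pos).ne' h1

theorem lee_eq_zero_of_fieldInt (hw : IsKahlerField w) (hn : 1 ≤ n)
    (h : (fieldInt (-(leeField w * fieldJ n M (leeField w) * w ^ (n - 1)))).re = 0) :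
    leeField w = 0 := by
  funext x
  have h1 := re_eq_zero_of_fieldInt (hw.isFormField_norm_lee hn) hw.smooth_norm_lee
    (hw.norm_lee_nonneg hn) h x
  obtain ⟨r, hr, hr0, hrx⟩ := hw.exists_norm_lee hn x
  rw [Pi.neg_apply, hrx, neg_smul, neg_neg, re_smul_pow_frame] at h1
  exact hr0 ((mul_eq_zero.1 h1).resolve_right ((hw.kahler x).pow_frame_pos).ne')

/-- Integration by parts against the 1-form `J θ`. -/
theorem fieldInt_J_lee_mul_fieldD (hw : IsKahlerField w) (hτ : IsFormField k τ)
    (hs : SmoothField τ) (hk : k + 2 = 2 * n) :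
    fieldInt (fieldJ n M (leeField w) * fieldD τ) =
      fieldInt (fieldD (fieldJ n M (leeField w)) * τ) := by
  have h1 := fieldInt_fieldD (hw.isFormField_J_lee.mul hτ) (hw.smooth_J_lee.mul hs)
    (by omega)
  rw [fieldD_mul hw.smooth_J_lee hs, hw.isFormField_J_lee.fieldHat, pow_one, neg_one_smul,
    neg_mul, ← sub_eq_add_neg, fieldInt_sub (hw.smooth_d_J_lee.mul hs)
      (hw.smooth_J_lee.mul (hs.fieldD hτ))] at h1
  exact (sub_eq_zero.1 h1).symm

theorem fieldInt_torsion_mul (hw : IsKahlerField w) (hτ : IsFormField k τ)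
    (hs : SmoothField τ) (hJ : fieldJ n M τ = τ) (hk : k + 2 = 2 * n) :
    2 * fieldInt (torsionField w * τ) =
      fieldInt (leeField w * fieldJ n M (leeField w) * τ) -
        2 * fieldInt (fieldD (fieldJ n M (leeField w)) * τ) := by
  -- Both sides are of top degree, where `J` is the identity, and `J τ = τ`.
  have h1 : fieldJ n M (fieldD (fieldJ n M (leeField w))) * τ =
      fieldD (fieldJ n M (leeField w)) * τ := by
    have h2 : IsFormField (2 * n) (fieldD (fieldJ n M (leeField w)) * τ) := by
      rw [← hk, add_comm]; exact hw.isFormField_d_J_lee.mul hτ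
    have h3 := h2.fieldJ_eq_of_top
    rwa [map_mul (fieldJ n M), hJ] at h3
  rw [torsionField, smul_mul_assoc, fieldInt_smul, sub_mul, sub_mul, h1,
    fieldInt_sub (((hw.smooth_lee.mul hw.smooth_J_lee).mul hs).sub (hw.smooth_d_J_lee.mul hs))
      (hw.smooth_d_J_lee.mul hs),
    fieldInt_sub ((hw.smooth_lee.mul hw.smooth_J_lee).mul hs) (hw.smooth_d_J_lee.mul hs)]
  ring

theorem fieldInt_torsion_mul_pow (hw : IsKahlerField w) (hn : 1 ≤ n) :
    2 * fieldInt (torsionField w * w ^ (n - 1)) =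
      fieldInt (-(leeField w * fieldJ n M (leeField w) * w ^ (n - 1))) := by
  rw [hw.fieldInt_torsion_mul (hw.isFormField_pow (n - 1)) (hw.smooth.pow _)
    (hw.fieldJ_pow _) (by omega), ← hw.fieldInt_J_lee_mul_fieldD (hw.isFormField_pow (n - 1))
      (hw.smooth.pow _) (by omega), ← neg_neg (fieldD (w ^ (n - 1))), ← hw.lee_mul hn, mul_neg,
    ← mul_assoc]
  rw [hw.isFormField_J_lee.mul_anticomm hw.isFormField_lee, neg_mul, neg_neg, fieldInt_neg]
  ring

/-- The Lee form vanishes if the torsion field is a constant multiple of the Kähler form. -/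
theorem lee_eq_zero_of_torsion (hw : IsKahlerField w) {a : ℝ}
    (h : torsionField w = (a : ℂ) • w) : leeField w = 0 := by
  rcases Nat.eq_zero_or_pos n with hn | hn
  · exact hw.isFormField_lee.eq_zero_of_dim_zero hn
  rcases isEmpty_or_nonempty M with hM | hM
  · exact Subsingleton.elim _ _
  have h1 := congrArg Complex.re (hw.fieldInt_torsion_mul_pow hn)
  rw [h, smul_mul_assoc, ← pow_succ', Nat.sub_add_cancel hn, fieldInt_smul, ← mul_assoc,
    ← Complex.ofReal_ofNat, ← Complex.ofReal_mul, Complex.re_ofReal_mul] at h1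
  have h2 := fieldInt_re_nonneg (hw.isFormField_norm_lee hn) hw.smooth_norm_lee
    (hw.norm_lee_nonneg hn)
  rcases lt_trichotomy a 0 with ha | rfl | ha
  -- The integral of the squared norm of `θ` cannot be negative.
  · nlinarith [hw.fieldInt_pow_re_pos]
  · refine hw.lee_eq_zero_of_fieldInt hn ?_
    rw [← h1]; simp
  · exfalso
    -- The top power of the tame form `Φ = -d (J θ)` is positive but exact.
    set φ' := fieldJ n M (leeField w) with hφ
    set Φ := -fieldD φ' with hΦ
    have ht : ∀ x, Tame (Φ x) := hw.tame_neg_d_J_lee ha h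
    have hΦf : IsFormField 2 Φ := fun x => (ht x).isAlt
    have hΦs : SmoothField Φ := hw.smooth_d_J_lee.neg
    have hdΦ : fieldD Φ = 0 := by
      rw [hΦ, fieldD_neg, fieldD_fieldD hw.isFormField_J_lee hw.smooth_J_lee, neg_zero]
    have hdpow (j : ℕ) : fieldD (Φ ^ j) = 0 := by
      induction j with
      | zero =>
        have h3 := fieldD_mul (smoothField_one (n := n) (M := M)) smoothField_one
        rw [(isFormField_one (n := n) (M := M)).fieldHat] at h3
        simpa using h3
      | succ j ih =>
        rw [pow_succ, fieldD_mul (hΦs.pow j) hΦs, ih, hdΦ, zero_mul, mul_zero, add_zero]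
    have hex : fieldD (φ' * Φ ^ (n - 1)) = -Φ ^ n := by
      rw [fieldD_mul hw.smooth_J_lee (hΦs.pow _), hdpow, mul_zero, add_zero,
        ← neg_neg (fieldD φ'), ← hΦ, neg_mul, ← pow_succ', Nat.sub_add_cancel hn]
    have h3 := fieldInt_fieldD (hw.isFormField_J_lee.mul (hΦf.pow (n - 1)))
      (hw.smooth_J_lee.mul (hΦs.pow (n - 1))) (by omega)
    rw [hex, fieldInt_neg, neg_eq_zero] at h3
    obtain ⟨x⟩ := hM
    exact (ht x).pow_frame_pos.ne' (re_eq_zero_of_fieldInt (hΦf.pow n) (hΦs.pow n)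
      (fun x => (ht x).pow_frame_pos.le) (by rw [h3]; rfl) x)

end IsKahlerField

end

/-! ### The Euler-Lagrange equation -/

section

variable {n : ℕ} {M : Type*} [TopologicalSpace M] [ChartedSpace (Model n) M]
  {w w' χ σ : M → LForm (Model n)}

/-- The function by which a form of degree `2 n` is a multiple of `w ^ n`. -/
def topRatio (σ w : M → LForm (Model n)) (x : M) : ℂ :=
  σ x (frameList n) / (w x ^ n) (frameList n)

namespace IsKahlerField

theorem topRatio_smul (hw : IsKahlerField w) (hσ : IsFormField (2 * n) σ) (x : M) :
    σ x = topRatio σ w x • (w x) ^ n :=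
  (hσ x).eq_smul_of_frame (hw.kahler x).isAlt_top (hw.kahler x).frame_ne_zero

theorem topRatio_real (hw : IsKahlerField w) (hσ : fieldConj n M σ = σ) (x : M) :
    starRingEnd ℂ (topRatio σ w x) = topRatio σ w x := by
  have h1 : starRingEnd ℂ (σ x (frameList n)) = σ x (frameList n) :=
    DFunLike.congr_fun (congrFun hσ x) _
  have h2 : starRingEnd ℂ ((w x ^ n) (frameList n)) = (w x ^ n) (frameList n) :=
    DFunLike.congr_fun ((hw.kahler x).conj_pow n) _
  rw [topRatio, map_div₀, h1, h2]

variable [IsManifold 𝓘(ℂ, Model n) ω M]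

theorem smooth_topRatio (hw : IsKahlerField w) (hσ : IsFormField (2 * n) σ) (hs : SmoothField σ) :
    SmoothField fun x => topRatio σ w x • (1 : LForm (Model n)) := by
  refine smoothField_smul_one fun c => ?_
  have hne : ∀ y ∈ (chartAt (Model n) c).target, chartRep c (w ^ n) y (frameList n) ≠ 0 := by
    intro y hy
    rw [chartRep_frame (hw.isFormField_pow n)]
    exact mul_ne_zero (by exact_mod_cast (det_chartInvDeriv_pos c hy).ne')
      (hw.kahler _).frame_ne_zero
  refine ((hs c (frameList n)).mul (((hw.smooth.pow n) c (frameList n)).inv hne)).congr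
    fun y hy => ?_
  have hd : ((LinearMap.det (chartInvDeriv n c y : Model n →ₗ[ℝ] Model n) : ℝ) : ℂ) ≠ 0 := by
    exact_mod_cast (det_chartInvDeriv_pos c hy).ne'
  change _ = chartRep c σ y (frameList n) * (chartRep c (w ^ n) y (frameList n))⁻¹
  rw [chartRep_frame hσ, chartRep_frame (hw.isFormField_pow n), ← div_eq_mul_inv,
    mul_div_mul_left _ _ hd]
  rfl

end IsKahlerField

variable [CompactSpace M] [T2Space M]

/-- The derivative of an integral that is polynomial in the parameter. -/
theorem hasDerivAt_fieldInt_pow_mul (hw : SmoothField w) (hχ : SmoothField χ)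
    (hc : w * χ = χ * w) (k : ℕ) (hσ : SmoothField σ) :
    HasDerivAt (fun t : ℝ => fieldInt ((w + (t : ℂ) • χ) ^ k * σ))
      (k * fieldInt (w ^ (k - 1) * χ * σ)) 0 := by
  induction k generalizing σ with
  | zero => simpa using hasDerivAt_const (0 : ℝ) (fieldInt σ)
  | succ k ih =>
    have h1 : (fun t : ℝ => fieldInt ((w + (t : ℂ) • χ) ^ (k + 1) * σ)) = fun t : ℝ =>
        fieldInt ((w + (t : ℂ) • χ) ^ k * (w * σ)) +
          (t : ℂ) * fieldInt ((w + (t : ℂ) • χ) ^ k * (χ * σ)) := by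
      funext t
      have hs : SmoothField ((w + (t : ℂ) • χ) ^ k) := (hw.add (hχ.smul _)).pow k
      rw [← fieldInt_smul, ← fieldInt_add (hs.mul (hw.mul hσ)) ((hs.mul (hχ.mul hσ)).smul _)]
      congr 1
      rw [pow_succ, mul_assoc, add_mul, mul_add, smul_mul_assoc, mul_smul_comm]
    rw [h1]
    have h2 : HasDerivAt (fun t : ℝ => (t : ℂ)) 1 0 := (hasDerivAt_id (0 : ℝ)).ofReal_comp
    have h3 := (ih (hw.mul hσ)).add (h2.mul (ih (hχ.mul hσ)))
    refine h3.congr_deriv ?_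
    simp only [Complex.ofReal_zero, zero_smul, add_zero, zero_mul, one_mul, Nat.add_sub_cancel]
    have h4 : (k : ℂ) * fieldInt (w ^ (k - 1) * χ * (w * σ)) =
        k * fieldInt (w ^ k * χ * σ) := by
      cases k with
      | zero => simp
      | succ k =>
        rw [Nat.add_sub_cancel, pow_succ, mul_assoc _ w χ, hc]
        simp only [mul_assoc]
    rw [h4, ← mul_assoc]
    push_cast
    ring

variable [IsManifold 𝓘(ℂ, Model n) ω M]

namespace IsKahlerField

/-- The integrals of `θ ∧ J θ - 2 d (J θ)` against powers of another Kähler form `w'` bound the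
squared norm of its Lee form `θ'` from below, because the squared norm of `θ' - θ` with respect
to `w'` is nonnegative. -/
theorem le_fieldInt_norm_lee (hw : IsKahlerField w) (hw' : IsKahlerField w') (hn : 1 ≤ n) :
    (fieldInt (w' ^ (n - 1) * (leeField w * fieldJ n M (leeField w) -
      (2 : ℂ) • fieldD (fieldJ n M (leeField w))))).re ≤
    (fieldInt (-(leeField w' * fieldJ n M (leeField w') * w' ^ (n - 1)))).re := by
  set θ := leeField w
  set θ' := leeField w'
  set Ω' := w' ^ (n - 1) with hΩ
  have hα : IsFormField 1 (θ' - θ) := hw'.isFormField_lee.sub hw.isFormField_lee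
  have hαs : SmoothField (θ' - θ) := hw'.smooth_lee.sub hw.smooth_lee
  have hΩs : SmoothField Ω' := hw'.smooth.pow _
  have hαf : IsFormField (2 * n) (-((θ' - θ) * fieldJ n M (θ' - θ) * Ω')) := by
    have h := ((hα.mul hα.fieldJ).mul (hw'.isFormField_pow (n - 1))).neg
    rwa [show 1 + 1 + 2 * (n - 1) = 2 * n by omega] at h
  have h0 : 0 ≤ (fieldInt (-((θ' - θ) * fieldJ n M (θ' - θ) * Ω'))).re := by
    refine fieldInt_re_nonneg hαf ((hαs.mul hαs.fieldJ).mul hΩs).neg fun x => ?_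
    have hre : fieldConj n M (θ' - θ) = θ' - θ := by
      rw [map_sub, hw'.fieldConj_lee, hw.fieldConj_lee]
    obtain ⟨r, hr, -, h⟩ := (hw'.kahler x).exists_norm hn (hα x) (congrFun hre x)
    change 0 ≤ ((-((θ' - θ) x * LForm.mapHom (mulI n) ((θ' - θ) x) * w' x ^ (n - 1)))
      (frameList n)).re
    rw [h, neg_smul, neg_neg, re_smul_pow_frame]
    exact mul_nonneg hr ((hw'.kahler x).pow_frame_pos).le
  -- In the mixed terms, `θ' ∧ Ω' = -d Ω'` eliminates the Lee form of `w'`.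
  have h1 : θ' * fieldJ n M θ * Ω' = fieldJ n M θ * fieldD Ω' := by
    rw [hw'.isFormField_lee.mul_anticomm hw.isFormField_J_lee, neg_mul, mul_assoc, hw'.lee_mul hn,
      mul_neg, neg_neg]
  have h2 : θ * fieldJ n M θ' * Ω' = fieldJ n M θ * fieldD Ω' := by
    rw [← h1]
    have hf : IsFormField (2 * n) (θ' * fieldJ n M θ * Ω') := by
      have h := (hw'.isFormField_lee.mul hw.isFormField_J_lee).mul (hw'.isFormField_pow (n - 1))
      rwa [show 1 + 1 + 2 * (n - 1) = 2 * n by omega] at h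
    have h3 := hf.fieldJ_eq_of_top
    rw [map_mul (fieldJ n M), map_mul (fieldJ n M), hw.isFormField_lee.fieldJ_fieldJ,
      hw'.fieldJ_pow, mul_neg, ← hw.isFormField_lee.mul_anticomm hw'.isFormField_J_lee] at h3
    exact h3
  have h4 : -((θ' - θ) * fieldJ n M (θ' - θ) * Ω') =
      -(θ' * fieldJ n M θ' * Ω') + (2 : ℂ) • (fieldJ n M θ * fieldD Ω') -
        θ * fieldJ n M θ * Ω' := by
    have h5 : (θ' - θ) * fieldJ n M (θ' - θ) * Ω' = θ' * fieldJ n M θ' * Ω' -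
        θ' * fieldJ n M θ * Ω' - θ * fieldJ n M θ' * Ω' + θ * fieldJ n M θ * Ω' := by
      rw [map_sub]; noncomm_ring
    rw [h5, h1, h2, two_smul]
    abel
  have hd : SmoothField (fieldJ n M θ * fieldD Ω') :=
    hw.smooth_J_lee.mul (hΩs.fieldD (hw'.isFormField_pow _))
  rw [h4, fieldInt_sub (hw'.smooth_norm_lee.add (hd.smul _))
      ((hw.smooth_lee.mul hw.smooth_J_lee).mul hΩs),
    fieldInt_add hw'.smooth_norm_lee (hd.smul _), fieldInt_smul,
    hw.fieldInt_J_lee_mul_fieldD (hw'.isFormField_pow _) hΩs (by omega)] at h0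
  rw [← hw'.mul_comm, sub_mul, smul_mul_assoc,
    fieldInt_sub ((hw.smooth_lee.mul hw.smooth_J_lee).mul hΩs)
      ((hw.smooth_d_J_lee.mul hΩs).smul _), fieldInt_smul]
  simp only [Complex.sub_re, Complex.add_re] at h0 ⊢
  linarith

theorem fieldInt_mul_torsion (hw : IsKahlerField w) {τ : M → LForm (Model n)} {k : ℕ}
    (hτ : IsFormField k τ) (hs : SmoothField τ) (hJ : fieldJ n M τ = τ) (hk : k + 2 = 2 * n) :
    fieldInt (τ * (leeField w * fieldJ n M (leeField w) -
      (2 : ℂ) • fieldD (fieldJ n M (leeField w)))) = 2 * fieldInt (torsionField w * τ) := by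
  have hcomm : τ * (leeField w * fieldJ n M (leeField w) -
      (2 : ℂ) • fieldD (fieldJ n M (leeField w))) = (leeField w * fieldJ n M (leeField w) -
      (2 : ℂ) • fieldD (fieldJ n M (leeField w))) * τ := funext fun x => by
    have h2 : IsFormField 2 (leeField w * fieldJ n M (leeField w) -
        (2 : ℂ) • fieldD (fieldJ n M (leeField w))) :=
      (hw.isFormField_lee.mul hw.isFormField_J_lee).sub (hw.isFormField_d_J_lee.smul _)
    exact (LForm.mul_comm_of_even (h2 x).hat_two (τ x)).symm
  rw [hcomm, hw.fieldInt_torsion_mul hτ hs hJ hk, sub_mul, smul_mul_assoc,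
    fieldInt_sub ((hw.smooth_lee.mul hw.smooth_J_lee).mul hs) ((hw.smooth_d_J_lee.mul hs).smul _),
    fieldInt_smul]

end IsKahlerField

/-- The Gauduchon functional, up to a constant factor, in terms of the Kähler form. -/
def gauduchonField (w : M → LForm (Model n)) : ℝ :=
  (fieldInt (w ^ n)).re ^ ((1 - n : ℝ) / n) *
    (fieldInt (-(leeField w * fieldJ n M (leeField w) * w ^ (n - 1)))).re

namespace IsKahlerField

/-- The first variation of the Gauduchon functional, for a `J`-invariant variation `χ` of the Kähler
form. The functional itself is only compared with the lower bound from `le_fieldInt_norm_lee`. -/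
theorem fieldInt_torsion_of_critical [Nonempty M] (hw : IsKahlerField w) (hn : 2 ≤ n)
    (hχ : IsFormField 2 χ) (hs : SmoothField χ) (hJ : fieldJ n M χ = χ)
    {W : ℝ → M → LForm (Model n)} (hW : ∀ t, IsKahlerField (W t))
    (hWt : ∀ᶠ t : ℝ in 𝓝 0, W t = w + (t : ℂ) • χ)
    (hcrit : HasDerivAt (fun t => gauduchonField (W t)) 0 0) :
    (fieldInt ((torsionField w - ((((fieldInt (-(leeField w * fieldJ n M (leeField w) *
      w ^ (n - 1)))).re / (2 * (fieldInt (w ^ n)).re) : ℝ)) : ℂ) • w) *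
        (w ^ (n - 2) * χ))).re = 0 := by
  set κ := leeField w * fieldJ n M (leeField w) - (2 : ℂ) • fieldD (fieldJ n M (leeField w))
    with hκ
  have hκs : SmoothField κ :=
    (hw.smooth_lee.mul hw.smooth_J_lee).sub (hw.smooth_d_J_lee.smul _)
  set ℓ := (fieldInt (-(leeField w * fieldJ n M (leeField w) * w ^ (n - 1)))).re with hℓ
  set v := (fieldInt (w ^ n)).re with hv
  have hvpos : 0 < v := hw.fieldInt_pow_re_pos
  have hW0 : W 0 = w := by simpa using hWt.self_of_nhds
  have hc : w * χ = χ * w := funext fun x =>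
    LForm.mul_comm_of_even (hw.kahler x).even (χ x)
  have hreal {F : ℝ → ℂ} {F' : ℂ} (h : HasDerivAt F F' 0) :
      HasDerivAt (fun t => (F t).re) F'.re 0 :=
    Complex.reCLM.hasFDerivAt.comp_hasDerivAt (0 : ℝ) h
  have hV := hreal (hasDerivAt_fieldInt_pow_mul hw.smooth hs hc n smoothField_one)
  have hL := hreal (hasDerivAt_fieldInt_pow_mul hw.smooth hs hc (n - 1) hκs)
  simp only [mul_one] at hV
  have hV0 : (fieldInt ((w + ((0 : ℝ) : ℂ) • χ) ^ n)).re = v := by simp [hv]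
  have hL0 : (fieldInt ((w + ((0 : ℝ) : ℂ) • χ) ^ (n - 1) * κ)).re = ℓ := by
    simp only [Complex.ofReal_zero, zero_smul, add_zero]
    rw [hκ, hw.fieldInt_mul_torsion (hw.isFormField_pow _) (hw.smooth.pow _) (hw.fieldJ_pow _)
      (by omega), hw.fieldInt_torsion_mul_pow (by omega)]
  -- The derivative of the lower bound of the functional along the variation.
  have hlow := (hV.rpow_const (p := (1 - n : ℝ) / n) (Or.inl (by rw [hV0]; exact hvpos.ne'))).mul hL
  -- The functional minus its lower bound is nonnegative, and zero at `t = 0`.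
  have hmin : IsLocalMin (fun t : ℝ => gauduchonField (W t) -
      (fieldInt ((w + (t : ℂ) • χ) ^ n)).re ^ ((1 - n : ℝ) / n) *
        (fieldInt ((w + (t : ℂ) • χ) ^ (n - 1) * κ)).re) 0 := by
    have h0 : gauduchonField (W 0) - (fieldInt ((w + ((0 : ℝ) : ℂ) • χ) ^ n)).re ^
        ((1 - n : ℝ) / n) * (fieldInt ((w + ((0 : ℝ) : ℂ) • χ) ^ (n - 1) * κ)).re = 0 := by
      rw [hV0, hL0, hW0, gauduchonField, sub_self]
    refine hWt.mono fun t ht => ?_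
    beta_reduce
    rw [h0, gauduchonField, ← ht, sub_nonneg]
    exact mul_le_mul_of_nonneg_left (hw.le_fieldInt_norm_lee (hW t) (by omega))
      (Real.rpow_nonneg (hW t).fieldInt_pow_re_nonneg _)
  have hD := hmin.hasDerivAt_eq_zero (hcrit.sub hlow)
  rw [hV0, hL0, zero_sub, neg_eq_zero, Real.rpow_sub_one hvpos.ne'] at hD
  have hτ : IsFormField (2 * (n - 2) + 2) (w ^ (n - 2) * χ) := (hw.isFormField_pow _).mul hχ
  have hτs : SmoothField (w ^ (n - 2) * χ) := (hw.smooth.pow _).mul hs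
  have hτJ : fieldJ n M (w ^ (n - 2) * χ) = w ^ (n - 2) * χ := by
    rw [map_mul, hJ, hw.fieldJ_pow]
  rw [show n - 1 - 1 = n - 2 by omega, hw.fieldInt_mul_torsion hτ hτs hτJ (by omega)] at hD
  have hpow : w ^ (n - 1) * χ = w * (w ^ (n - 2) * χ) := by
    rw [← mul_assoc, ← pow_succ', show n - 2 + 1 = n - 1 by omega]
  rw [hpow] at hD
  rw [sub_mul, smul_mul_assoc, fieldInt_sub (hw.smooth_torsion.mul hτs)
    ((hw.smooth.mul hτs).smul _), fieldInt_smul, Complex.sub_re, Complex.re_ofReal_mul]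
  have hvp : 0 < v ^ ((1 - n : ℝ) / n) := Real.rpow_pos_of_pos hvpos _
  have hn1 : ((n - 1 : ℕ) : ℂ) = ((n - 1 : ℝ) : ℂ) := by
    rw [Nat.cast_sub (by omega)]; push_cast; rfl
  have hn2 : (n : ℝ) - 1 ≠ 0 := by
    have : (2 : ℝ) ≤ n := by exact_mod_cast hn
    linarith
  have hn0 : (n : ℝ) ≠ 0 := by exact_mod_cast (by omega : n ≠ 0)
  rw [hn1, ← Complex.ofReal_natCast, Complex.re_ofReal_mul, Complex.re_ofReal_mul,
    ← Complex.ofReal_ofNat, Complex.re_ofReal_mul] at hD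
  set A := (fieldInt (torsionField w * (w ^ (n - 2) * χ))).re
  set B := (fieldInt (w * (w ^ (n - 2) * χ))).re
  have hE : v ^ ((1 - n : ℝ) / n) * ((n - 1) * 2) * (A - ℓ / (2 * v) * B) = 0 := by
    rw [← hD]
    field_simp
    ring
  exact (mul_eq_zero.1 hE).resolve_left (mul_ne_zero hvp.ne' (mul_ne_zero hn2 two_ne_zero))

/-- A real form of type `(1, 1)` that is orthogonal to all others, for the symmetric pairing
defined by `w ^ (n - 2)`, vanishes. -/
theorem eq_zero_of_fieldInt_pairing (hw : IsKahlerField w) (hn : 2 ≤ n)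
    {Ψ : M → LForm (Model n)} (hΨ : IsFormField 2 Ψ) (hs : SmoothField Ψ)
    (hc : fieldConj n M Ψ = Ψ) (hJ : fieldJ n M Ψ = Ψ)
    (h : ∀ χ : M → LForm (Model n), IsFormField 2 χ → SmoothField χ → fieldConj n M χ = χ →
      fieldJ n M χ = χ → (fieldInt (Ψ * (w ^ (n - 2) * χ))).re = 0) : Ψ = 0 := by
  have htop : IsFormField (2 * n) (Ψ * w ^ (n - 1)) := by
    have := hΨ.mul (hw.isFormField_pow (n - 1))
    rwa [show 2 + 2 * (n - 1) = 2 * n by omega] at this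
  have htops : SmoothField (Ψ * w ^ (n - 1)) := hs.mul (hw.smooth.pow _)
  have htopc : fieldConj n M (Ψ * w ^ (n - 1)) = Ψ * w ^ (n - 1) := by
    rw [map_mul, hc, hw.fieldConj_pow]
  set u := topRatio (Ψ * w ^ (n - 1)) w with hu
  have huc (x : M) : ((u x).re : ℂ) = u x :=
    Complex.conj_eq_iff_re.1 (hw.topRatio_real htopc x)
  set U : M → LForm (Model n) := fun x => u x • (1 : LForm (Model n)) with hU
  have hUs : SmoothField U := hw.smooth_topRatio htop htops
  have hUf : IsFormField 0 U := fun x => isAlt_one.smul _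
  have hUw (x : M) : (U * w) x = u x • w x := by
    rw [Pi.mul_apply, hU, smul_mul_assoc, one_mul]
  -- With `Ψ = u w + Ψ₀` and `Ψ₀` primitive, `χ = u w - Ψ₀`, so that the integrand below is the sum
  -- of `u ² w ^ n` and the nonnegative form `-Ψ₀ ∧ Ψ₀ ∧ w ^ (n - 2)`.
  set χ := (2 : ℂ) • (U * w) - Ψ with hχdef
  have hUwf : IsFormField 2 (U * w) := by
    have := hUf.mul hw.isFormField
    rwa [zero_add] at this
  have hχ : IsFormField 2 χ := (hUwf.smul _).sub hΨ
  have hχs : SmoothField χ := ((hUs.mul hw.smooth).smul _).sub hs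
  have hUc : fieldConj n M U = U := funext fun x => by
    ext l
    change starRingEnd ℂ ((u x • (1 : LForm (Model n))) l) = (u x • (1 : LForm (Model n))) l
    have h1 : LForm.conjHom (1 : LForm (Model n)) = 1 := map_one _
    rw [LForm.smul_apply, map_mul, hw.topRatio_real htopc x]
    exact congrArg (u x * ·) (DFunLike.congr_fun h1 l)
  have hUJ : fieldJ n M U = U := funext fun x => by
    rw [fieldJ_apply, hU, map_smul, map_one]
  have hχc : fieldConj n M χ = χ := by
    rw [hχdef, map_sub, fieldConj_smul_real _ (by simp [Complex.conj_ofNat]), map_mul, hUc,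
      hw.fieldConj_eq, hc]
  have hχJ : fieldJ n M χ = χ := by
    rw [hχdef, map_sub, map_smul, map_mul, hUJ, hw.fieldJ_eq, hJ]
  have key (x : M) : ∃ q : ℝ, 0 ≤ q ∧ (q = 0 → Ψ x = u x • w x) ∧
      (Ψ * (w ^ (n - 2) * χ)) x = (((u x).re ^ 2 + q : ℝ) : ℂ) • w x ^ n := by
    have hk := hw.kahler x
    have h1 : Ψ x * w x ^ (n - 1) = u x • w x ^ n := hw.topRatio_smul htop x
    have hw1 : w x ^ (n - 1) = w x * w x ^ (n - 2) := by
      rw [← pow_succ', show n - 2 + 1 = n - 1 by omega]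
    have hw2 : w x ^ n = w x * w x ^ (n - 1) := by
      rw [← pow_succ', Nat.sub_add_cancel (by omega)]
    obtain ⟨q, hq, hq0, hqx⟩ := hk.exists_sq_primitive hn (f := Ψ x - u x • w x)
      ((hΨ x).sub (hk.isAlt.smul _))
      (by
        have h2 : LForm.conjHom (u x • w x) = u x • w x := by
          have h3 : fieldConj n M (U * w) = U * w := by rw [map_mul, hUc, hw.fieldConj_eq]
          rw [← hUw]
          exact congrFun h3 x
        rw [map_sub, h2]
        exact congrArg (· - _) (congrFun hc x))
      (by
        rw [map_sub, map_smul, hk.inv]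
        exact congrArg (· - _) (congrFun hJ x))
      (by rw [sub_mul, h1, smul_mul_assoc, ← hw2, sub_self])
    refine ⟨q, hq, fun h0 => sub_eq_zero.1 (hq0 h0), ?_⟩
    have hcomm : w x ^ (n - 2) * Ψ x = Ψ x * w x ^ (n - 2) := (hk.comm _ _).symm
    have hcw : w x * Ψ x = Ψ x * w x := LForm.mul_comm_of_even hk.even _
    have h5 : Ψ x * (w x * w x ^ (n - 2)) = u x • w x ^ n := by rw [← hw1, h1]
    have h6 : w x * (w x * w x ^ (n - 2)) = w x ^ n := by rw [← hw1, ← hw2]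
    have h7 : Ψ x * Ψ x * w x ^ (n - 2) = (u x * u x - q) • w x ^ n := by
      simp only [sub_mul, mul_sub, smul_mul_assoc, mul_smul_comm, hcw] at hqx
      rw [mul_assoc (Ψ x) (w x), mul_assoc (w x) (w x), h5, h6, smul_smul, smul_sub, smul_smul]
        at hqx
      have h8 : Ψ x * Ψ x * w x ^ (n - 2) = -(q : ℂ) • w x ^ n + (u x * u x) • w x ^ n := by
        rw [← hqx]; module
      rw [h8]; module
    have h8 : χ x = (2 : ℂ) • (u x • w x) - Ψ x := by rw [← hUw]; rfl
    change Ψ x * (w x ^ (n - 2) * χ x) = _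
    have h9 : Ψ x * (w x ^ (n - 2) * w x) = u x • w x ^ n := by rw [← hk.comm, h5]
    rw [h8, mul_sub, mul_sub, hcomm, mul_smul_comm, mul_smul_comm, mul_smul_comm, mul_smul_comm,
      h9, ← mul_assoc, h7]
    push_cast
    rw [huc]
    module
  have hint : IsFormField (2 * n) (Ψ * (w ^ (n - 2) * χ)) := by
    have := hΨ.mul ((hw.isFormField_pow (n - 2)).mul hχ)
    rwa [show 2 + (2 * (n - 2) + 2) = 2 * n by omega] at this
  have hzero := re_eq_zero_of_fieldInt hint (hs.mul ((hw.smooth.pow _).mul hχs)) (fun x => by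
    obtain ⟨q, hq, -, hx⟩ := key x
    rw [hx, re_smul_pow_frame]
    exact mul_nonneg (by positivity) ((hw.kahler x).pow_frame_pos).le) (h χ hχ hχs hχc hχJ)
  funext x
  obtain ⟨q, hq, hq0, hx⟩ := key x
  have h1 := hzero x
  rw [hx, re_smul_pow_frame] at h1
  have h2 := (mul_eq_zero.1 h1).resolve_right ((hw.kahler x).pow_frame_pos).ne'
  have h3 : (u x).re = 0 := by nlinarith [sq_nonneg (u x).re]
  rw [hq0 (by nlinarith [sq_nonneg (u x).re]), ← huc x, h3, Complex.ofReal_zero, zero_smul]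
  rfl

end IsKahlerField

end

/-! ### Smooth fields of bilinear forms -/

section

open Bundle

variable {EB : Type*} [NormedAddCommGroup EB] [NormedSpace ℝ EB]
  {HB : Type*} [TopologicalSpace HB] {IB : ModelWithCorners ℝ EB HB}
  {B : Type*} [TopologicalSpace B] [ChartedSpace HB B]
  {F : Type*} [NormedAddCommGroup F] [NormedSpace ℝ F] [FiniteDimensional ℝ F]

theorem contMDiffOn_clm_of_apply {G : Type*} [NormedAddCommGroup G] [NormedSpace ℝ G]
    {f : B → F →L[ℝ] G} {s : Set B} (h : ∀ v, ContMDiffOn IB 𝓘(ℝ, G) ∞ (fun x => f x v) s) :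
    ContMDiffOn IB 𝓘(ℝ, F →L[ℝ] G) ∞ f s := by
  have hd : Module.finrank ℝ F = Module.finrank ℝ (Fin (Module.finrank ℝ F) → ℝ) :=
    (Module.finrank_fin_fun ℝ).symm
  let e₁ := ContinuousLinearEquiv.ofFinrankEq hd
  let e₂ := (e₁.arrowCongr (1 : G ≃L[ℝ] G)).trans
    (ContinuousLinearEquiv.piRing (Fin (Module.finrank ℝ F)))
  rw [← Function.id_comp f, ← e₂.symm_comp_self]
  exact e₂.symm.contDiff.contMDiff.comp_contMDiffOn (contMDiffOn_pi_space.2 fun i => h _)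

variable {E : B → Type*} [TopologicalSpace (TotalSpace F E)] [∀ x, TopologicalSpace (E x)]
  [∀ x, AddCommGroup (E x)] [∀ x, Module ℝ (E x)]
  [FiberBundle F E] [VectorBundle ℝ F E]
  [ContMDiffVectorBundle ∞ F E IB]

set_option synthInstance.maxHeartbeats 400000 in
set_option maxHeartbeats 1000000 in
/-- A field of bilinear forms on a vector bundle is smooth if and only if its coefficients in a
trivialization are. -/
theorem contMDiffOn_bilin_iff (b : (x : B) → E x →L[ℝ] E x →L[ℝ] ℝ) (c : B) :
    ContMDiffOn IB (IB.prod 𝓘(ℝ, F →L[ℝ] F →L[ℝ] ℝ)) ∞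
      (fun x => TotalSpace.mk' (F →L[ℝ] F →L[ℝ] ℝ) x (b x)) (trivializationAt F E c).baseSet ↔
    ∀ u v : F, ContMDiffOn IB 𝓘(ℝ, ℝ) ∞ (fun x => b x ((trivializationAt F E c).symm x u)
      ((trivializationAt F E c).symm x v)) (trivializationAt F E c).baseSet := by
  have hbase : (trivializationAt (F →L[ℝ] F →L[ℝ] ℝ)
      (fun x : B => E x →L[ℝ] E x →L[ℝ] ℝ) c).baseSet = (trivializationAt F E c).baseSet := by
    simp
  have hcoord (u v : F) : ∀ x ∈ (trivializationAt F E c).baseSet,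
      (trivializationAt (F →L[ℝ] F →L[ℝ] ℝ)
        (fun x : B => E x →L[ℝ] E x →L[ℝ] ℝ) c ⟨x, b x⟩).2 u v =
      b x ((trivializationAt F E c).symm x u) ((trivializationAt F E c).symm x v) := by
    intro x hx
    rw [hom_trivializationAt_apply]
    have h1 := inCoordinates_apply_eq₂ (x₀ := c) (x := x) (ϕ := b x) (v := u) (w := v)
      (F₃ := ℝ) (E₃ := Bundle.Trivial B ℝ) hx hx (by simp)
    refine h1.trans ?_
    simp
  have h := Trivialization.contMDiffOn_section_baseSet_iff (IB := IB) (n := ∞)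
    (F := F →L[ℝ] F →L[ℝ] ℝ) (E := fun x : B => E x →L[ℝ] E x →L[ℝ] ℝ) (s := b)
      (trivializationAt (F →L[ℝ] F →L[ℝ] ℝ) (fun x : B => E x →L[ℝ] E x →L[ℝ] ℝ) c)
  rw [hbase] at h
  rw [h]
  constructor
  · intro h u v
    refine ContMDiffOn.congr ?_ fun x hx => (hcoord u v x hx).symm
    exact (h.clm_apply contMDiffOn_const).clm_apply contMDiffOn_const
  · intro h
    refine contMDiffOn_clm_of_apply fun u => contMDiffOn_clm_of_apply fun v => ?_
    exact (h u v).congr (hcoord u v)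

end

section

open Bundle

variable {n : ℕ} {M : Type*} [TopologicalSpace M] [ChartedSpace (Model n) M]

theorem symm_trivializationAt [IsManifold 𝓘(ℝ, Model n) 1 M] (c : M) {y : Model n}
    (hy : y ∈ (chartAt (Model n) c).target) (u : Model n) :
    (trivializationAt (Model n) (TangentSpace 𝓘(ℝ, Model n)) c).symm
      ((chartAt (Model n) c).symm y) u = chartInvDeriv n c y u := by
  have hx := (chartAt (Model n) c).map_target hy
  have hb : (chartAt (Model n) c).symm y ∈
      (trivializationAt (Model n) (TangentSpace 𝓘(ℝ, Model n)) c).baseSet := by simpa using hx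
  have h := DFunLike.congr_fun (TangentBundle.symmL_trivializationAt (I := 𝓘(ℝ, Model n)) hx) u
  rw [Trivialization.symmL_apply _ hb] at h
  refine h.trans ?_
  simp only [modelWithCornersSelf_coe, Set.range_id, mfderivWithin_univ, extChartAt,
    mfld_simps]
  change chartInvDeriv n c (chartAt (Model n) c ((chartAt (Model n) c).symm y)) u = _
  rw [(chartAt (Model n) c).right_inv hy]

variable [IsManifold 𝓘(ℂ, Model n) ω M]

/-- A field of bilinear forms on the tangent bundle is smooth if and only if its coefficients in
charts are. -/
theorem contMDiff_bilin_iff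
    (b : (x : M) → TangentSpace 𝓘(ℝ, Model n) x →L[ℝ] TangentSpace 𝓘(ℝ, Model n) x →L[ℝ] ℝ) :
    ContMDiff 𝓘(ℝ, Model n) (𝓘(ℝ, Model n).prod 𝓘(ℝ, Model n →L[ℝ] Model n →L[ℝ] ℝ)) ∞
      (fun x => TotalSpace.mk' (Model n →L[ℝ] Model n →L[ℝ] ℝ) x (b x)) ↔
    ∀ (c : M) (u v : Model n), ContDiffOn ℝ ∞ (fun y =>
      b ((chartAt (Model n) c).symm y) (chartInvDeriv n c y u) (chartInvDeriv n c y v))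
        (chartAt (Model n) c).target := by
  have : IsManifold 𝓘(ℝ, Model n) 1 M := IsManifold.of_le (n := ∞) (by exact_mod_cast le_top)
  have hbase (c : M) : (trivializationAt (Model n) (TangentSpace 𝓘(ℝ, Model n)) c).baseSet =
      (chartAt (Model n) c).source := by simp
  have hb (c : M) := contMDiffOn_bilin_iff (IB := 𝓘(ℝ, Model n)) (F := Model n)
    (E := fun x : M => TangentSpace 𝓘(ℝ, Model n) x) b c
  simp only [hbase] at hb
  constructor
  · intro h c u v
    have h1 := (((hb c).1 h.contMDiffOn u v).comp
      (contMDiffOn_chart_symm (I := 𝓘(ℝ, Model n)) (n := ∞) (x := c))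
      fun y hy => (chartAt (Model n) c).map_target hy).contDiffOn
    refine h1.congr fun y hy => ?_
    rw [← symm_trivializationAt c hy, ← symm_trivializationAt c hy]
    rfl
  · intro h c
    refine ((hb c).2 fun u v => ?_).contMDiffAt
      ((chartAt (Model n) c).open_source.mem_nhds (mem_chart_source _ c))
    have h2 := (h c u v).contMDiffOn.comp
      (contMDiffOn_chart (I := 𝓘(ℝ, Model n)) (n := ∞) (x := c))
      fun x hx => (chartAt (Model n) c).map_source hx
    refine h2.congr fun x hx => ?_
    have h3 := symm_trivializationAt c ((chartAt (Model n) c).map_source hx)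
    rw [(chartAt (Model n) c).left_inv hx] at h3
    rw [h3, h3]
    simp only [Function.comp_apply]
    rw [(chartAt (Model n) c).left_inv hx]

end

/-! ### Inner products on `ℂⁿ` -/

section

variable {n : ℕ}

theorem det_gram_ne_zero {B : Model n →L[ℝ] Model n →L[ℝ] ℝ} (hsymm : ∀ u v, B u v = B v u)
    (hpos : ∀ v, v ≠ 0 → 0 < B v v) :
    (Matrix.of fun i j => B (realFrame n i) (realFrame n j)).det ≠ 0 := by
  intro h0
  obtain ⟨ξ, hξ, h1⟩ := Matrix.exists_mulVec_eq_zero_iff.2 h0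
  have hY0 : ∑ j, ξ j • realFrame n j ≠ 0 := by
    intro h
    apply hξ
    funext j
    have hli := (realBasis n).linearIndependent
    rw [coe_realBasis] at hli
    exact Fintype.linearIndependent_iff.1 hli ξ h j
  refine (hpos _ hY0).ne' ?_
  have h2 : ∀ i, B (realFrame n i) (∑ j, ξ j • realFrame n j) = 0 := by
    intro i
    have := congrFun h1 i
    simp only [Matrix.mulVec, dotProduct, Matrix.of_apply, Pi.zero_apply] at this
    rw [map_sum, ← this]
    exact Finset.sum_congr rfl fun j _ => by rw [map_smul, smul_eq_mul, mul_comm]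
  rw [map_sum]
  exact Finset.sum_eq_zero fun i _ => by rw [map_smul, hsymm, h2, smul_zero]

/-- The squared norm of the covector dual to the vector `Y`. -/
theorem sum_gram_inv {B : Model n →L[ℝ] Model n →L[ℝ] ℝ} (hsymm : ∀ u v, B u v = B v u)
    (hpos : ∀ v, v ≠ 0 → 0 < B v v) (Y : Model n) :
    ∑ i, ∑ j, (Matrix.of fun i j => B (realFrame n i) (realFrame n j))⁻¹ i j *
      B Y (realFrame n i) * B Y (realFrame n j) = B Y Y := by
  set G := Matrix.of fun i j => B (realFrame n i) (realFrame n j) with hG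
  have hdet : IsUnit G.det := (det_gram_ne_zero hsymm hpos).isUnit
  set ξ : Fin (2 * n) → ℝ := fun i => (realBasis n).repr Y i with hξ
  have hY : ∑ i, ξ i • realFrame n i = Y := by
    rw [← coe_realBasis]; exact (realBasis n).sum_repr Y
  have ha : (fun i => B Y (realFrame n i)) = G.mulVec ξ := by
    funext i
    rw [hsymm]
    conv_lhs => rw [← hY]
    rw [map_sum]
    exact Finset.sum_congr rfl fun j _ => by rw [map_smul, smul_eq_mul, mul_comm]; rfl
  have h1 : G⁻¹.mulVec (fun j => B Y (realFrame n j)) = ξ := by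
    rw [ha, Matrix.mulVec_mulVec, Matrix.nonsing_inv_mul _ hdet, Matrix.one_mulVec]
  have h2 : ∀ i, ∑ j, G⁻¹ i j * B Y (realFrame n i) * B Y (realFrame n j) =
      ξ i * B Y (realFrame n i) := by
    intro i
    rw [← h1, Matrix.mulVec, dotProduct, Finset.sum_mul]
    exact Finset.sum_congr rfl fun j _ => by ring
  simp only [h2]
  conv_rhs => rw [← hY, map_sum]
  rw [hY]
  exact Finset.sum_congr rfl fun i _ => by rw [map_smul, smul_eq_mul]

end

section

variable {n : ℕ} {M : Type*} [TopologicalSpace M] [ChartedSpace (Model n) M] {k : ℕ}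

/-! ### The operators `∂` and `∂bar` on fields -/

theorem Form.toField_Jinv (α : Form n M k) :
    α.Jinv.toField = (-1 : ℂ) ^ k • fieldJ n M α.toField := by
  funext x
  have h1 : α.Jinv.toField x = LForm.mapHom (-mulI n) (α.toField x) :=
    toL_comp (V := Model n) (W := Model n) (α x) (-mulI n)
  have h2 : α.toField x = (-1 : ℂ) ^ k • LForm.mapHom (mulI n)
      (LForm.mapHom (mulI n) (α.toField x)) := by
    rw [mapHom_mulI_mulI (α.isFormField x), smul_smul, ← mul_pow]; simp
  have h3 (f : LForm (Model n)) : LForm.mapHom (-mulI n) (LForm.mapHom (mulI n) f) = f := by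
    ext l
    simp only [LForm.mapHom_apply, List.map_map]
    congr 1
    conv_rhs => rw [← List.map_id l]
    refine List.map_congr_left fun v _ => ?_
    simp [mulI_mulI]
  rw [h1, h2, map_smul, h3, Pi.smul_apply, fieldJ_apply]

variable [IsManifold 𝓘(ℂ, Model n) ω M]

theorem Form.toField_dc {α : Form n M k} (h : SmoothField α.toField) :
    α.dc.toField = (-1 : ℂ) ^ (k + 1) • fieldJ n M (fieldD (fieldJ n M α.toField)) := by
  have h1 : SmoothField α.J.toField := by rw [toField_J]; exact h.fieldJ
  rw [Form.dc, toField_Jinv, toField_d h1, toField_J]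

theorem Form.toField_del {α : Form n M k} (h : SmoothField α.toField) :
    α.del.toField = (1 / 2 : ℂ) • (fieldD α.toField +
      (Complex.I * (-1 : ℂ) ^ (k + 1)) • fieldJ n M (fieldD (fieldJ n M α.toField))) := by
  rw [Form.del, toField_smul, toField_add, toField_smul, toField_d h, toField_dc h, smul_smul]

theorem Form.toField_delbar {α : Form n M k} (h : SmoothField α.toField) :
    α.delbar.toField = (1 / 2 : ℂ) • (fieldD α.toField -
      (Complex.I * (-1 : ℂ) ^ (k + 1)) • fieldJ n M (fieldD (fieldJ n M α.toField))) := by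
  rw [Form.delbar, toField_smul, toField_sub, toField_smul, toField_d h, toField_dc h, smul_smul]

/-! ### The torsion form of a metric -/

namespace HermitianMetric

/-- The Kähler form of a metric as a field. -/
def kahlerField (g : HermitianMetric n M) : M → LForm (Model n) := g.kahlerForm.toField

/-- The inner product on the tangent space at `x`, as a bilinear form on `ℂⁿ`. -/
def innerModel (g : HermitianMetric n M) (x : M) : Model n →L[ℝ] Model n →L[ℝ] ℝ := g.inner x

theorem innerModel_symm (g : HermitianMetric n M) (x : M) (u v : Model n) :
    g.innerModel x u v = g.innerModel x v u := g.symm x u v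

theorem innerModel_pos (g : HermitianMetric n M) (x : M) (v : Model n) (hv : v ≠ 0) :
    0 < g.innerModel x v v := g.pos x v hv

theorem innerModel_mulI (g : HermitianMetric n M) (x : M) (u v : Model n) :
    g.innerModel x (mulI n u) (mulI n v) = g.innerModel x u v := g.inner_J x u v

theorem kahlerField_pair (g : HermitianMetric n M) (x : M) (u v : Model n) :
    g.kahlerField x [u, v] = g.innerModel x (mulI n u) v :=
  toL_pair (V := Model n) (g.kahlerForm x) u v

theorem isFormField_kahlerField (g : HermitianMetric n M) : IsFormField 2 g.kahlerField :=
  g.kahlerForm.isFormField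

theorem smooth_kahlerField (g : HermitianMetric n M) : SmoothField g.kahlerField := by
  intro c l
  have h1 := (contMDiff_bilin_iff (n := n) (M := M) g.inner).1 g.contMDiff c
  by_cases hl : l.length = 2
  · obtain ⟨u, v, rfl⟩ := List.length_eq_two.1 hl
    refine (Complex.ofRealCLM.contDiff.comp_contDiffOn (h1 (mulI n u) v)).congr fun y hy => ?_
    change g.kahlerField _ [chartInvDeriv n c y u, chartInvDeriv n c y v] = _
    rw [kahlerField_pair, ← chartInvDeriv_mulI c hy]
    rfl
  · have h2 (y : Model n) : chartRep c g.kahlerField y l = 0 :=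
      (g.isFormField_kahlerField.chartRep c y).hasDegree l hl
    simp only [h2]
    exact contDiffOn_const

theorem isKahlerField (g : HermitianMetric n M) : IsKahlerField g.kahlerField where
  kahler x :=
    { isAlt := g.isFormField_kahlerField x
      conj := (g.isFormField_kahlerField x).conj.ext_two (g.isFormField_kahlerField x)
        fun u v => by rw [LForm.conjHom_apply, kahlerField_pair, Complex.conj_ofReal]
      pos := fun v hv => by
        rw [kahlerField_pair, innerModel_mulI, Complex.ofReal_re]
        exact g.innerModel_pos x v hv
      inv := ((g.isFormField_kahlerField x).mapHom (mulI n)).ext_two (g.isFormField_kahlerField x)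
        fun u v => by
          change g.kahlerField x [mulI n u, mulI n v] = _
          rw [kahlerField_pair, kahlerField_pair, innerModel_mulI] }
  smooth := g.smooth_kahlerField

/-- The field `(θ - √-1 J θ) / 2`, the torsion 1-form in terms of the Lee form `θ`. -/
def torsionOneField (g : HermitianMetric n M) : M → LForm (Model n) :=
  (1 / 2 : ℂ) • (leeField g.kahlerField - Complex.I • fieldJ n M (leeField g.kahlerField))

theorem isFormField_torsionOneField (g : HermitianMetric n M) :
    IsFormField 1 g.torsionOneField :=
  (g.isKahlerField.isFormField_lee.sub (g.isKahlerField.isFormField_J_lee.smul _)).smul _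

theorem fieldJ_torsionOneField (g : HermitianMetric n M) :
    fieldJ n M g.torsionOneField = Complex.I • g.torsionOneField := by
  rw [torsionOneField, map_smul, map_sub, map_smul,
    g.isKahlerField.isFormField_lee.fieldJ_fieldJ]
  funext x
  simp only [Pi.smul_apply, Pi.sub_apply, Pi.neg_apply, smul_sub, smul_neg, smul_smul]
  rw [show Complex.I * (1 / 2 * Complex.I) = -(1 / 2) by
    rw [mul_left_comm, Complex.I_mul_I]; ring, mul_comm Complex.I]
  module

theorem toField_del_pow (g : HermitianMetric n M) (hn : 1 ≤ n) :
    (g.kahlerForm.pow (n - 1)).del.toField = -(g.torsionOneField * g.kahlerField ^ (n - 1)) := by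
  have hw := g.isKahlerField
  have h1 : (g.kahlerForm.pow (n - 1)).toField = g.kahlerField ^ (n - 1) := Form.toField_pow _ _
  have h2 : SmoothField (g.kahlerForm.pow (n - 1)).toField := by rw [h1]; exact hw.smooth.pow _
  have h3 := hw.lee_mul hn
  have h4 : fieldD (g.kahlerField ^ (n - 1)) =
      -(leeField g.kahlerField * g.kahlerField ^ (n - 1)) := by rw [h3, neg_neg]
  rw [Form.toField_del h2, h1, hw.fieldJ_pow, h4, map_neg, map_mul, hw.fieldJ_pow, torsionOneField,
    pow_succ, pow_mul, smul_mul_assoc, sub_mul, smul_mul_assoc]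
  simp only [neg_one_sq, one_pow, mul_neg, mul_one]
  module

theorem isTorsionForm_iff (g : HermitianMetric n M) (α : Form n M 1) :
    g.IsTorsionForm α ↔ α.toField = g.torsionOneField := by
  have hw := g.isKahlerField
  have hr : (-((α.wedge (g.kahlerForm.pow (n - 1))).cast (Nat.add_comm _ _))).toField =
      -(α.toField * g.kahlerField ^ (n - 1)) := by
    rw [Form.toField_neg, Form.toField_cast, Form.toField_wedge, Form.toField_pow]; rfl
  constructor
  · rintro ⟨-, h⟩
    rcases Nat.eq_zero_or_pos n with hn | hn
    · rw [α.isFormField.eq_zero_of_dim_zero hn,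
        g.isFormField_torsionOneField.eq_zero_of_dim_zero hn]
    · refine hw.eq_of_mul_pow_eq α.isFormField g.isFormField_torsionOneField ?_
      have h1 := congrArg Form.toField h
      rw [hr, g.toField_del_pow hn] at h1
      exact (neg_injective h1).symm
  · intro h
    refine ⟨fun x v => ?_, Form.toField_injective ?_⟩
    · have h1 := DFunLike.congr_fun (congrFun g.fieldJ_torsionOneField x) [v]
      rw [← h] at h1
      have h2 (u : Model n) : α.toField x [u] = α x (fun _ => u) := by
        have h3 := toL_ofFn (V := Model n) (α x) ![u]
        simp only [List.ofFn_succ, List.ofFn_zero] at h3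
        refine h3.trans (congrArg (α x) ?_)
        funext i
        fin_cases i
        rfl
      exact (h2 (mulI n v)).symm.trans (h1.trans (congrArg (Complex.I * ·) (h2 v)))
    · rcases Nat.eq_zero_or_pos n with hn | hn
      · subst hn
        funext x
        have h1 {f g : LForm (Model 0)} {j : ℕ} (hf : IsAlt (j + 1) f) (hg : IsAlt (j + 1) g) :
            f = g := by
          rw [hf.eq_zero_of_finrank_lt (by rw [finrank_model]; omega),
            hg.eq_zero_of_finrank_lt (by rw [finrank_model]; omega)]
        exact h1 (Form.isFormField _ x) (Form.isFormField _ x)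
      · rw [hr, g.toField_del_pow hn, h]

theorem exists_torsionForm (g : HermitianMetric n M) :
    ∃ α : Form n M 1, α.toField = g.torsionOneField :=
  g.isFormField_torsionOneField.exists_form

theorem existsUnique_torsionForm (g : HermitianMetric n M) :
    ∃! α : Form n M 1, g.IsTorsionForm α := by
  obtain ⟨α, hα⟩ := g.exists_torsionForm
  refine ⟨α, (g.isTorsionForm_iff α).2 hα, fun β hβ => Form.toField_injective ?_⟩
  rw [hα, (g.isTorsionForm_iff β).1 hβ]

theorem toField_torsionForm (g : HermitianMetric n M) :
    g.torsionForm.toField = g.torsionOneField :=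
  (g.isTorsionForm_iff _).1 (Classical.epsilon_spec g.existsUnique_torsionForm.exists)

theorem torsionForm_eq_zero (g : HermitianMetric n M) (h : leeField g.kahlerField = 0) :
    g.torsionForm = 0 := by
  refine Form.toField_injective ?_
  rw [toField_torsionForm, torsionOneField, h, map_zero, smul_zero, sub_zero, smul_zero]
  funext x
  exact (toL_zero (V := Model n)).symm

theorem fieldConj_torsionOneField (g : HermitianMetric n M) :
    fieldConj n M g.torsionOneField = (1 / 2 : ℂ) • (leeField g.kahlerField +
      Complex.I • fieldJ n M (leeField g.kahlerField)) := by
  funext x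
  ext l
  have h1 : starRingEnd ℂ (leeField g.kahlerField x l) = leeField g.kahlerField x l :=
    DFunLike.congr_fun (congrFun g.isKahlerField.fieldConj_lee x) l
  have h2 : starRingEnd ℂ (fieldJ n M (leeField g.kahlerField) x l) =
      fieldJ n M (leeField g.kahlerField) x l :=
    DFunLike.congr_fun (congrFun g.isKahlerField.fieldConj_J_lee x) l
  simp only [fieldConj_apply, LForm.conjHom_apply, torsionOneField, Pi.smul_apply, Pi.sub_apply,
    Pi.add_apply, LForm.smul_apply, LForm.sub_apply, LForm.add_apply, map_mul, map_sub, h1, h2,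
    Complex.conj_I, map_div₀, map_one, Complex.conj_ofNat]
  ring

theorem torsionField_of_gauduchonEquation (g : HermitianMetric n M) {a : ℝ}
    (h : g.GauduchonEquation a) : torsionField g.kahlerField = (a : ℂ) • g.kahlerField := by
  have hw := g.isKahlerField
  set θ := leeField g.kahlerField with hθ
  set ψ := fieldJ n M θ with hψ
  have hJψ : fieldJ n M ψ = -θ := hw.isFormField_lee.fieldJ_fieldJ
  have hθs : SmoothField θ := hw.smooth_lee
  have hψs : SmoothField ψ := hw.smooth_J_lee
  have hη : g.torsionForm.toField = (1 / 2 : ℂ) • (θ - Complex.I • ψ) := g.toField_torsionForm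
  have hηc : g.torsionForm.conj.toField = (1 / 2 : ℂ) • (θ + Complex.I • ψ) := by
    rw [Form.toField_conj, toField_torsionForm, fieldConj_torsionOneField]
  have hηs : SmoothField g.torsionForm.toField := by
    rw [hη]; exact (hθs.sub (hψs.smul _)).smul _
  have hηcs : SmoothField g.torsionForm.conj.toField := by
    rw [hηc]; exact (hθs.add (hψs.smul _)).smul _
  have hdel : g.torsionForm.conj.del.toField = (1 / 4 : ℂ) • (fieldD θ + Complex.I • fieldD ψ +
      Complex.I • fieldJ n M (fieldD ψ) + fieldJ n M (fieldD θ)) := by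
    rw [Form.toField_del hηcs, hηc, map_smul, map_add, map_smul, ← hψ, hJψ, fieldD_smul,
      fieldD_smul, fieldD_add hθs (hψs.smul _), fieldD_add hψs (hθs.neg.smul _), fieldD_smul,
      fieldD_smul, fieldD_neg, map_smul, map_add, map_smul, map_neg]
    have hI : Complex.I * Complex.I = -1 := Complex.I_mul_I
    funext x
    simp only [Pi.smul_apply, Pi.add_apply, Pi.neg_apply]
    ext l
    simp only [LForm.smul_apply, LForm.add_apply, LForm.neg_apply]
    linear_combination (-(1 / 4) * fieldJ n M (fieldD θ) x l) * hI
  have hdelbar : g.torsionForm.delbar.toField = (1 / 4 : ℂ) • (fieldD θ - Complex.I • fieldD ψ -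
      Complex.I • fieldJ n M (fieldD ψ) + fieldJ n M (fieldD θ)) := by
    rw [Form.toField_delbar hηs, hη, map_smul, map_sub, map_smul, ← hψ, hJψ, fieldD_smul,
      fieldD_smul, fieldD_sub hθs (hψs.smul _), fieldD_sub hψs (hθs.neg.smul _), fieldD_smul,
      fieldD_smul, fieldD_neg, map_smul, map_sub, map_smul, map_neg]
    have hI : Complex.I * Complex.I = -1 := Complex.I_mul_I
    funext x
    simp only [Pi.smul_apply, Pi.add_apply, Pi.sub_apply, Pi.neg_apply]
    ext l
    simp only [LForm.smul_apply, LForm.add_apply, LForm.sub_apply, LForm.neg_apply]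
    linear_combination (-(1 / 4) * fieldJ n M (fieldD θ) x l) * hI
  have hprod : (g.torsionForm.wedge g.torsionForm.conj).toField =
      (Complex.I / 2) • (θ * ψ) := by
    rw [Form.toField_wedge, hη, hηc]
    funext x
    have h1 : ψ x * θ x = -(θ x * ψ x) := by
      rw [LForm.mul_comm_of_odd (hw.isFormField_J_lee x).hat_one, (hw.isFormField_lee x).hat_one,
        neg_mul]
    have h2 : θ x * θ x = 0 := LForm.mul_self_of_odd (hw.isFormField_lee x).hat_one
    have h3 : ψ x * ψ x = 0 := LForm.mul_self_of_odd (hw.isFormField_J_lee x).hat_one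
    simp only [Pi.smul_apply, Pi.mul_apply, Pi.sub_apply, Pi.add_apply,
      sub_mul, mul_add, smul_mul_assoc, mul_smul_comm, h1, h2, h3]
    module
  have h1 := congrArg Form.toField h
  rw [Form.toField_smul, Form.toField_sub, Form.toField_sub, hdel, hdelbar, hprod,
    Form.toField_smul] at h1
  change _ = (a : ℂ) • g.kahlerField at h1
  rw [← h1, torsionField]
  have hI : Complex.I * Complex.I = -1 := Complex.I_mul_I
  funext x
  ext l
  simp only [Pi.smul_apply, Pi.add_apply, Pi.sub_apply, LForm.smul_apply, LForm.add_apply,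
    LForm.sub_apply]
  linear_combination ((1 / 2) * (θ * ψ) x l - (1 / 2) * fieldD ψ x l -
    (1 / 2) * fieldJ n M (fieldD ψ) x l) * hI

end HermitianMetric

end

/-! ### The Gauduchon functional in terms of the Kähler form -/

section

variable {n : ℕ} {M : Type*} [TopologicalSpace M] [ChartedSpace (Model n) M]
  [IsManifold 𝓘(ℂ, Model n) ω M]

namespace HermitianMetric

theorem normSq_torsionForm (g : HermitianMetric n M) {x : M} {X : Model n}
    (hX : ∀ v, leeField g.kahlerField x [v] = g.kahlerField x [X, mulI n v]) :
    g.normSq g.torsionForm x = g.innerModel x X X / 2 := by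
  set B := g.innerModel x with hB
  have hθ (v : Model n) : leeField g.kahlerField x [v] = (B X v : ℂ) := by
    rw [hX, kahlerField_pair, innerModel_mulI]
  have hη (v : Model n) : g.torsionForm x (fun _ => v) =
      (1 / 2 : ℂ) * (B X v + Complex.I * B (mulI n X) v) := by
    have h1 : g.torsionForm x (fun _ => v) = g.torsionForm.toField x [v] := by
      have h3 := toL_ofFn (V := Model n) (g.torsionForm x) ![v]
      simp only [List.ofFn_succ, List.ofFn_zero] at h3
      refine Eq.trans (congrArg (g.torsionForm x) ?_) h3.symm
      funext i
      fin_cases i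
      rfl
    have h2 : B X (mulI n v) = -B (mulI n X) v := by
      rw [hB, ← innerModel_mulI, mulI_mulI, map_neg]
    rw [h1, toField_torsionForm]
    change (1 / 2 : ℂ) * (leeField g.kahlerField x [v] -
      Complex.I * leeField g.kahlerField x [mulI n v]) = _
    rw [hθ, hθ, h2]
    push_cast
    ring
  have hterm (i j : Fin (2 * n)) : (((g.gram x)⁻¹ i j : ℂ) *
      g.torsionForm x (fun _ => realFrame n i) *
      (starRingEnd ℂ) (g.torsionForm x (fun _ => realFrame n j))).re =
      (1 / 4) * ((g.gram x)⁻¹ i j * B X (realFrame n i) * B X (realFrame n j) +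
        (g.gram x)⁻¹ i j * B (mulI n X) (realFrame n i) * B (mulI n X) (realFrame n j)) := by
    have h (v : Model n) : (1 / 2 : ℂ) * (B X v + Complex.I * B (mulI n X) v) =
        ⟨B X v / 2, B (mulI n X) v / 2⟩ := by
      apply Complex.ext <;> simp <;> ring
    rw [hη, hη, h, h, mul_assoc, Complex.re_ofReal_mul, Complex.mul_re]
    simp only [Complex.conj_re, Complex.conj_im]
    ring
  have hgram : g.gram x = Matrix.of fun i j => B (realFrame n i) (realFrame n j) := rfl
  rw [normSq, Complex.re_sum]
  simp only [Complex.re_sum, hterm, ← Finset.mul_sum, Finset.sum_add_distrib]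
  rw [hgram, sum_gram_inv (g.innerModel_symm x) (g.innerModel_pos x),
    sum_gram_inv (g.innerModel_symm x) (g.innerModel_pos x), hB, innerModel_mulI]
  ring

theorem normSq_smul_pow (g : HermitianMetric n M) (hn : 1 ≤ n) (x : M) :
    (g.normSq g.torsionForm x : ℂ) • g.kahlerField x ^ n =
      (n / 2 : ℂ) • (-(leeField g.kahlerField * fieldJ n M (leeField g.kahlerField) *
        g.kahlerField ^ (n - 1))) x := by
  have hk := g.isKahlerField.kahler x
  obtain ⟨X, hX⟩ := hk.exists_sharp (g.isKahlerField.isFormField_lee x)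
    (congrFun g.isKahlerField.fieldConj_lee x)
  have h := hk.mul_J_mul_pow hn (g.isKahlerField.isFormField_lee x) hX
  change _ = (n / 2 : ℂ) • (-(leeField g.kahlerField x * LForm.mapHom (mulI n)
    (leeField g.kahlerField x) * g.kahlerField x ^ (n - 1)))
  rw [div_eq_inv_mul, mul_smul, smul_neg, h, neg_smul, neg_neg, g.normSq_torsionForm hX,
    kahlerField_pair, innerModel_mulI, smul_smul]
  congr 1
  push_cast
  ring

variable [CompactSpace M] [T2Space M]

theorem integral_eq_fieldInt (g : HermitianMetric n M) (f : M → ℝ) :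
    g.integral f = (n ! : ℝ)⁻¹ * (fieldInt fun x => (f x : ℂ) • g.kahlerField x ^ n).re := by
  have h : Form.toField (fun x => (f x : ℂ) • g.volumeForm x) =
      (n ! : ℂ)⁻¹ • fun x => (f x : ℂ) • g.kahlerField x ^ n := by
    funext x
    have h1 := toL_smul (V := Model n) (f x : ℂ) (g.volumeForm x)
    have h2 := toL_smul (V := Model n) ((n ! : ℂ)⁻¹) (g.kahlerForm.pow n x)
    have h3 : toL (V := Model n) (g.kahlerForm.pow n x) = g.kahlerField x ^ n :=
      congrFun (Form.toField_pow g.kahlerForm n) x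
    refine h1.trans ?_
    rw [Pi.smul_apply, smul_comm, ← h3, ← h2]
    rfl
  rw [integral, Form.integral_eq_fieldInt, h, fieldInt_smul, ← Complex.ofReal_natCast,
    ← Complex.ofReal_inv, Complex.re_ofReal_mul]

theorem gauduchonFunctional_eq (g : HermitianMetric n M) (hn : 1 ≤ n) :
    g.gauduchonFunctional = (((n ! : ℝ)⁻¹) ^ ((1 - n : ℝ) / n) * ((n ! : ℝ)⁻¹ * (n / 2))) *
      gauduchonField g.kahlerField := by
  have h1 : (fun x => (g.normSq g.torsionForm x : ℂ) • g.kahlerField x ^ n) = (n / 2 : ℂ) •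
      (-(leeField g.kahlerField * fieldJ n M (leeField g.kahlerField) *
        g.kahlerField ^ (n - 1))) := funext fun x => g.normSq_smul_pow hn x
  have h2 : (fun x => ((1 : ℝ) : ℂ) • g.kahlerField x ^ n) = g.kahlerField ^ n := by
    funext x
    rw [Complex.ofReal_one, one_smul, Pi.pow_apply]
  rw [gauduchonFunctional, volume, integral_eq_fieldInt, integral_eq_fieldInt, h1, h2,
    fieldInt_smul, Real.mul_rpow (by positivity) g.isKahlerField.fieldInt_pow_re_nonneg,
    gauduchonField, show (n / 2 : ℂ) = ((n / 2 : ℝ) : ℂ) by push_cast; rfl, Complex.re_ofReal_mul]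
  ring

end HermitianMetric

end

/-! ### Variations of a metric -/

section

/-- A positive definite bilinear form on a finite dimensional space is bounded from below. -/
theorem exists_le_of_pos {E : Type*} [NormedAddCommGroup E] [NormedSpace ℝ E]
    [FiniteDimensional ℝ E] {B : E →L[ℝ] E →L[ℝ] ℝ} (hpos : ∀ v, v ≠ 0 → 0 < B v v) :
    ∃ m > 0, ∀ v, m * ‖v‖ ^ 2 ≤ B v v := by
  rcases subsingleton_or_nontrivial E with hE | hE
  · exact ⟨1, one_pos, fun v => by rw [Subsingleton.elim v 0]; simp⟩
  have : ProperSpace E := FiniteDimensional.proper ℝ E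
  have hcont : Continuous fun v => B v v := by fun_prop
  obtain ⟨v₀, hv₀, hmin⟩ := (isCompact_sphere (0 : E) 1).exists_isMinOn
    (NormedSpace.sphere_nonempty.2 zero_le_one) hcont.continuousOn
  have hv₀0 : v₀ ≠ 0 := by
    rintro rfl
    simp at hv₀
  refine ⟨B v₀ v₀, hpos v₀ hv₀0, fun v => ?_⟩
  by_cases hv : v = 0
  · simp [hv]
  have hn : ‖v‖ ≠ 0 := norm_ne_zero_iff.2 hv
  have h1 : ‖v‖⁻¹ • v ∈ Metric.sphere (0 : E) 1 := by
    simp [norm_smul, hn]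
  have h2 := isMinOn_iff.1 hmin _ h1
  rw [map_smul, map_smul, smul_apply, smul_eq_mul, smul_eq_mul] at h2
  have h3 : ‖v‖⁻¹ * (‖v‖⁻¹ * B v v) * ‖v‖ ^ 2 = B v v := by field_simp
  rw [← h3]
  exact mul_le_mul_of_nonneg_right h2 (by positivity)

variable {n : ℕ} {M : Type*} [TopologicalSpace M] [ChartedSpace (Model n) M]
  [IsManifold 𝓘(ℂ, Model n) ω M]

/-- The real bilinear form `(u, v) ↦ -f (√-1 u, v)` associated to a 2-form `f`; it recovers the
inner product from its Kähler form. -/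
theorem exists_bilin {f : LForm (Model n)} (hf : IsAlt 2 f) :
    ∃ b : Model n →L[ℝ] Model n →L[ℝ] ℝ, ∀ u v, b u v = -(f [mulI n u, v]).re := by
  let b : LinearMap.BilinForm ℝ (Model n) := LinearMap.mk₂ ℝ (fun u v => -(f [mulI n u, v]).re)
    (fun u u' v => by
      have h := DFunLike.congr_fun (hf.ι_add (mulI n u) (mulI n u')) [v]
      rw [← map_add] at h
      change f [mulI n (u + u'), v] = f [mulI n u, v] + f [mulI n u', v] at h
      rw [h, Complex.add_re, neg_add])
    (fun c u v => by
      have h := DFunLike.congr_fun (hf.ι_smul c (mulI n u)) [v]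
      rw [← map_smul] at h
      change f [mulI n (c • u), v] = (c : ℂ) * f [mulI n u, v] at h
      rw [h, Complex.re_ofReal_mul, smul_eq_mul, mul_neg])
    (fun u v v' => by
      have h := DFunLike.congr_fun ((hf.ι (mulI n u)).ι_add v v') []
      change f [mulI n u, v + v'] = f [mulI n u, v] + f [mulI n u, v'] at h
      rw [h, Complex.add_re, neg_add])
    (fun c u v => by
      have h := DFunLike.congr_fun ((hf.ι (mulI n u)).ι_smul c v) []
      change f [mulI n u, c • v] = (c : ℂ) * f [mulI n u, v] at h
      rw [h, Complex.re_ofReal_mul, smul_eq_mul, mul_neg])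
  exact ⟨LinearMap.toContinuousLinearMap
    ((LinearMap.toContinuousLinearMap (𝕜 := ℝ) (E := Model n) (F' := ℝ)).toLinearMap ∘ₗ b),
      fun u v => rfl⟩

theorem eventually_norm_sub_lt {X F G : Type*} [TopologicalSpace X] [NormedAddCommGroup F]
    [NormedSpace ℝ F] [NormedAddCommGroup G] [NormedSpace ℝ G] {r : ℝ} (hr : 0 < r)
    {f : X → F →L[ℝ] G} {x : X} (hf : ContinuousAt f x) : ∀ᶠ y in 𝓝 x, ‖f y - f x‖ < r :=
  (hf.sub continuousAt_const).norm.eventually_lt continuousAt_const (by simpa using hr)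

theorem eventually_abs_sub_le {X F : Type*} [TopologicalSpace X] [NormedAddCommGroup F]
    [NormedSpace ℝ F] {r : ℝ} (hr : 0 < r) {f : X → F →L[ℝ] F →L[ℝ] ℝ} {x : X}
    (hf : ContinuousAt f x) : ∀ᶠ y in 𝓝 x, ∀ u, |f y u u - f x u u| ≤ r * ‖u‖ ^ 2 := by
  filter_upwards [eventually_norm_sub_lt hr hf] with y hy u
  have h1 := (f y - f x).le_opNorm₂ u u
  rw [mul_assoc, ← pow_two] at h1
  exact h1.trans (mul_le_mul_of_nonneg_right hy.le (sq_nonneg _))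

theorem abs_apply_self_le {F : Type*} [NormedAddCommGroup F] [NormedSpace ℝ F]
    (f : F →L[ℝ] F →L[ℝ] ℝ) (u : F) : |f u u| ≤ ‖f‖ * ‖u‖ ^ 2 := by
  have h := f.le_opNorm₂ u u
  rwa [mul_assoc, ← pow_two] at h

variable [CompactSpace M]

/-- On a compact manifold, a smooth field of bilinear forms is bounded by a metric. -/
theorem exists_bound (g : HermitianMetric n M) {b : M → Model n →L[ℝ] Model n →L[ℝ] ℝ}
    (hb : ∀ (c : M) (u v : Model n), ContDiffOn ℝ ∞ (fun y => b ((chartAt (Model n) c).symm y)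
      (chartInvDeriv n c y u) (chartInvDeriv n c y v)) (chartAt (Model n) c).target) :
    ∃ C : ℝ, 0 < C ∧ ∀ x v, |b x v v| ≤ C * g.innerModel x v v := by
  have hg : ∀ (c : M) (u v : Model n), ContDiffOn ℝ ∞
      (fun y => g.innerModel ((chartAt (Model n) c).symm y)
      (chartInvDeriv n c y u) (chartInvDeriv n c y v)) (chartAt (Model n) c).target :=
    (contMDiff_bilin_iff (n := n) (M := M) g.inner).1 g.contMDiff
  let pull (β : M → Model n →L[ℝ] Model n →L[ℝ] ℝ) (c : M) (y : Model n) :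
      Model n →L[ℝ] Model n →L[ℝ] ℝ :=
    (β ((chartAt (Model n) c).symm y)).bilinearComp (chartInvDeriv n c y) (chartInvDeriv n c y)
  have hcont {β : M → Model n →L[ℝ] Model n →L[ℝ] ℝ} (hβ : ∀ (c : M) (u v : Model n),
      ContDiffOn ℝ ∞ (fun y => β ((chartAt (Model n) c).symm y)
        (chartInvDeriv n c y u) (chartInvDeriv n c y v)) (chartAt (Model n) c).target) (c : M) :
      ContinuousAt (pull β c) (chartAt (Model n) c c) := by
    have h1 : ContDiffOn ℝ ∞ (pull β c) (chartAt (Model n) c).target :=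
      contDiffOn_clm_apply.2 fun u => contDiffOn_clm_apply.2 fun v => hβ c u v
    exact h1.continuousOn.continuousAt
      ((chartAt (Model n) c).open_target.mem_nhds (mem_chart_target _ c))
  have hloc (c : M) : ∃ C : ℝ, 0 < C ∧ ∀ᶠ x in 𝓝 c, ∀ v, |b x v v| ≤ C * g.innerModel x v v := by
    have hpos : ∀ v, v ≠ 0 → 0 < pull g.innerModel c (chartAt (Model n) c c) v v := by
      intro v hv
      refine g.innerModel_pos _ (chartInvDeriv n c (chartAt (Model n) c c) v) fun h0 => hv ?_
      have h1 := chartDeriv_chartInvDeriv c (mem_chart_target _ c) v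
      rw [h0, map_zero] at h1
      exact h1.symm
    obtain ⟨m, hm, hmv⟩ := exists_le_of_pos hpos
    have hG := eventually_abs_sub_le (half_pos hm) (hcont hg c)
    have hb' := eventually_abs_sub_le one_pos (hcont hb c)
    set C' := ‖pull b c (chartAt (Model n) c c)‖ + 1 with hC'
    have hC'pos : 0 < C' := by positivity
    refine ⟨C' / (m / 2), by positivity, ?_⟩
    have hx := ((chartAt (Model n) c).continuousAt (mem_chart_source _ c)).eventually (hG.and hb')
    filter_upwards [hx, (chartAt (Model n) c).open_source.mem_nhds (mem_chart_source _ c)]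
      with x ⟨hx1, hx2⟩ hxs v
    set y := chartAt (Model n) c x with hy
    have hxy : (chartAt (Model n) c).symm y = x := (chartAt (Model n) c).left_inv hxs
    set u := chartDeriv n c x v with hu
    have huv : chartInvDeriv n c y u = v := chartInvDeriv_chartDeriv c hxs v
    have e1 : pull b c y u u = b x v v := by
      change b ((chartAt (Model n) c).symm y) (chartInvDeriv n c y u) (chartInvDeriv n c y u) = _
      rw [huv, hxy]
    have e2 : pull g.innerModel c y u u = g.innerModel x v v := by
      change g.innerModel ((chartAt (Model n) c).symm y) (chartInvDeriv n c y u)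
        (chartInvDeriv n c y u) = _
      rw [huv, hxy]
    rw [← e1, ← e2]
    have h1 : |pull b c y u u| ≤ C' * ‖u‖ ^ 2 := by
      have h2 := abs_sub_abs_le_abs_sub (pull b c y u u)
        (pull b c (chartAt (Model n) c c) u u)
      have h3 := abs_apply_self_le (pull b c (chartAt (Model n) c c)) u
      rw [hC', add_mul]
      linarith [hx2 u]
    have h2 : m / 2 * ‖u‖ ^ 2 ≤ pull g.innerModel c y u u := by
      linarith [neg_le_of_abs_le (hx1 u), hmv u]
    calc |pull b c y u u| ≤ C' * ‖u‖ ^ 2 := h1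
      _ = C' / (m / 2) * (m / 2 * ‖u‖ ^ 2) := by field_simp
      _ ≤ _ := mul_le_mul_of_nonneg_left h2 (by positivity)
  choose C hC hCx using hloc
  obtain ⟨s, hs⟩ := (isCompact_univ (X := M)).elim_nhds_subcover
    (fun c => {x | ∀ v, |b x v v| ≤ C c * g.innerModel x v v}) fun c _ => hCx c
  have hnn (x : M) (v : Model n) : 0 ≤ g.innerModel x v v := by
    by_cases hv : v = 0
    · simp [hv]
    · exact (g.innerModel_pos x v hv).le
  refine ⟨∑ c ∈ s, C c + 1, add_pos_of_nonneg_of_pos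
    (Finset.sum_nonneg fun c _ => (hC c).le) one_pos, fun x v => ?_⟩
  obtain ⟨c, hc, hxc⟩ := Set.mem_iUnion₂.1 (hs.2 (Set.mem_univ x))
  refine (hxc v).trans (mul_le_mul_of_nonneg_right ?_ (hnn x v))
  have := Finset.single_le_sum (f := C) (fun c _ => (hC c).le) hc
  linarith

/-- The metric whose inner products are given by a smooth field of Hermitian inner products. -/
def HermitianMetric.ofBilin (b : M → Model n →L[ℝ] Model n →L[ℝ] ℝ)
    (hb : ∀ (c : M) (u v : Model n), ContDiffOn ℝ ∞ (fun y => b ((chartAt (Model n) c).symm y)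
      (chartInvDeriv n c y u) (chartInvDeriv n c y v)) (chartAt (Model n) c).target)
    (hsymm : ∀ x u v, b x u v = b x v u) (hpos : ∀ x v, v ≠ 0 → 0 < b x v v)
    (hJ : ∀ x u v, b x (mulI n u) (mulI n v) = b x u v) : HermitianMetric n M where
  inner x := b x
  symm x := hsymm x
  pos x := hpos x
  isVonNBounded x := by
    change Bornology.IsVonNBounded ℝ {v : Model n | b x v v < 1}
    obtain ⟨m, hm, hmv⟩ := exists_le_of_pos (hpos x)
    refine (NormedSpace.isVonNBounded_iff ℝ).2 ((Metric.isBounded_closedBall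
      (x := (0 : Model n)) (r := m⁻¹ + 1)).subset fun v hv => ?_)
    rw [mem_closedBall_zero_iff]
    have h1 : m * ‖v‖ ^ 2 < 1 := (hmv v).trans_lt hv
    have h2 : ‖v‖ ^ 2 < m⁻¹ := by rw [← one_div, lt_div_iff₀ hm]; linarith
    nlinarith [sq_nonneg (‖v‖ - 1)]
  contMDiff := (contMDiff_bilin_iff (n := n) (M := M) fun x => b x).2 hb
  inner_J x := hJ x

/-- For every real form `χ` of type `(1, 1)`, there is a variation of the metric such that the
variation of its Kähler form is `χ`. -/
theorem HermitianMetric.exists_variation (g : HermitianMetric n M) {χ : M → LForm (Model n)}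
    (hχ : IsFormField 2 χ) (hs : SmoothField χ) (hc : fieldConj n M χ = χ)
    (hJ : fieldJ n M χ = χ) : ∃ (γ : ℝ → HermitianMetric n M)
      (h : (x : M) → TangentSpace 𝓘(ℝ, Model n) x → TangentSpace 𝓘(ℝ, Model n) x → ℝ),
      (∀ᶠ t in 𝓝 (0 : ℝ), ∀ x u v, (γ t).inner x u v = g.inner x u v + t * h x u v) ∧
      ∀ᶠ t in 𝓝 (0 : ℝ), (γ t).kahlerField = g.kahlerField + (t : ℂ) • χ := by
  choose b hb using fun x => exists_bilin (hχ x)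
  have hJx (x : M) : LForm.mapHom (mulI n) (χ x) = χ x := congrFun hJ x
  have hbs : ∀ (c : M) (u v : Model n), ContDiffOn ℝ ∞ (fun y =>
      b ((chartAt (Model n) c).symm y) (chartInvDeriv n c y u) (chartInvDeriv n c y v))
        (chartAt (Model n) c).target := by
    intro c u v
    refine (Complex.reCLM.contDiff.comp_contDiffOn (hs c [mulI n u, v])).neg.congr fun y hy => ?_
    rw [hb, ← chartInvDeriv_mulI c hy]
    rfl
  have hbsymm (x : M) (u v : Model n) : b x u v = b x v u := by
    rw [hb, hb, inv_apply_left (hχ x) (hJx x), (hχ x).apply_two_swap u]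
    simp
  have hbJ (x : M) (u v : Model n) : b x (mulI n u) (mulI n v) = b x u v := by
    rw [hb, hb, inv_apply (hJx x)]
  obtain ⟨C, hC, hbC⟩ := exists_bound g hbs
  -- For `|t| < ε`, the variation `t b` is bounded by half of the metric.
  let ε := C⁻¹ / 2
  have hε : 0 < ε := by positivity
  let γ (t : ℝ) : HermitianMetric n M := if ht : |t| < ε then
    HermitianMetric.ofBilin (fun x => g.innerModel x + t • b x)
      (fun c u v => by
        have h1 := (contMDiff_bilin_iff (n := n) (M := M) g.inner).1 g.contMDiff c u v
        exact h1.add (contDiffOn_const.mul (hbs c u v)))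
      (fun x u v => by
        change g.innerModel x u v + t * b x u v = g.innerModel x v u + t * b x v u
        rw [innerModel_symm, hbsymm])
      (fun x v hv => by
        change 0 < g.innerModel x v v + t * b x v v
        have h1 := g.innerModel_pos x v hv
        have h2 : |t * b x v v| ≤ ε * (C * g.innerModel x v v) := by
          rw [abs_mul]
          exact mul_le_mul ht.le (hbC x v) (abs_nonneg _) hε.le
        have h3 : ε * (C * g.innerModel x v v) = g.innerModel x v v / 2 := by
          simp only [ε]; field_simp
        have h4 := neg_le_of_abs_le h2
        linarith)
      (fun x u v => by
        change g.innerModel x (mulI n u) (mulI n v) + t * b x (mulI n u) (mulI n v) =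
          g.innerModel x u v + t * b x u v
        rw [innerModel_mulI, hbJ])
    else g
  have hev : ∀ᶠ t in 𝓝 (0 : ℝ), |t| < ε := by
    have := Metric.ball_mem_nhds (0 : ℝ) hε
    filter_upwards [this] with t ht
    simpa using ht
  have hγ : ∀ᶠ t in 𝓝 (0 : ℝ), ∀ x u v, (γ t).innerModel x u v =
      g.innerModel x u v + t * b x u v := by
    filter_upwards [hev] with t ht x u v
    have h : γ t = _ := dif_pos ht
    rw [h]
    rfl
  refine ⟨γ, fun x u v => b x u v, hγ, hγ.mono fun t ht => funext fun x => ?_⟩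
  refine ((γ t).isFormField_kahlerField x).ext_two
    ((g.isFormField_kahlerField x).add ((hχ x).smul _)) fun u v => ?_
  rw [kahlerField_pair, ht, hb, mulI_mulI]
  have h1 : χ x [-u, v] = -χ x [u, v] := DFunLike.congr_fun ((hχ x).ι_neg u) [v]
  have h2 : ((χ x [u, v]).re : ℂ) = χ x [u, v] := LForm.ofReal_re (congrFun hc x) _
  rw [h1, Complex.neg_re, neg_neg, Complex.ofReal_add, Complex.ofReal_mul, h2, ← kahlerField_pair]
  rfl

variable [T2Space M]

/-- The torsion field of a critical metric is a constant multiple of the Kähler form. The constant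
comes from the derivative of the power of the volume in the functional. -/
theorem HermitianMetric.lee_eq_zero_of_critical (g : HermitianMetric n M)
    (h : g.IsCriticalPoint HermitianMetric.gauduchonFunctional) : leeField g.kahlerField = 0 := by
  have hw := g.isKahlerField
  rcases isEmpty_or_nonempty M with hM | hM
  · exact Subsingleton.elim _ _
  rcases Nat.lt_or_ge n 2 with hn | hn
  · rcases Nat.eq_zero_or_pos n with hn0 | hn0
    · exact hw.isFormField_lee.eq_zero_of_dim_zero hn0
    · -- In dimension one, the form `w ^ (n - 1) = 1` is closed.
      have hn1 : n - 1 = 0 := by omega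
      refine hw.eq_of_mul_pow_eq hw.isFormField_lee isFormField_zero ?_
      have h1 := fieldD_mul (smoothField_one (n := n) (M := M)) smoothField_one
      rw [(isFormField_one (n := n) (M := M)).fieldHat] at h1
      rw [hw.lee_mul hn0, zero_mul, hn1, pow_zero, neg_eq_zero]
      simpa using h1
  · set a : ℝ := (fieldInt (-(leeField g.kahlerField * fieldJ n M (leeField g.kahlerField) *
      g.kahlerField ^ (n - 1)))).re / (2 * (fieldInt (g.kahlerField ^ n)).re) with ha
    refine hw.lee_eq_zero_of_torsion (a := a) (sub_eq_zero.1 ?_)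
    refine hw.eq_zero_of_fieldInt_pairing hn
      (hw.isFormField_torsion.sub (hw.isFormField.smul _))
      (hw.smooth_torsion.sub (hw.smooth.smul _)) ?_ ?_ fun χ hχ hs hc hJ => ?_
    · rw [map_sub, hw.fieldConj_torsion, fieldConj_smul_real _ (Complex.conj_ofReal a),
        hw.fieldConj_eq]
    · rw [map_sub, hw.fieldJ_torsion, map_smul, hw.fieldJ_eq]
    · obtain ⟨γ, h', hγ, hγw⟩ := g.exists_variation hχ hs hc hJ
      have hD := h γ h' hγ
      simp only [HermitianMetric.gauduchonFunctional_eq _ (show 1 ≤ n by omega)] at hD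
      have hCne : (((n ! : ℝ)⁻¹) ^ ((1 - n : ℝ) / n) * ((n ! : ℝ)⁻¹ * (n / 2))) ≠ 0 := by
        have : 0 < n := by omega
        positivity
      have hD2 := hD.const_mul ((((n ! : ℝ)⁻¹) ^ ((1 - n : ℝ) / n) * ((n ! : ℝ)⁻¹ * (n / 2))))⁻¹
      simp only [inv_mul_cancel_left₀ hCne, mul_zero] at hD2
      exact hw.fieldInt_torsion_of_critical hn hχ hs hJ (fun t => (γ t).isKahlerField) hγw hD2

end

end HermitianGeometry

end

theorem proposition1 (n : ℕ) (M : Type*) [TopologicalSpace M] [CompactSpace M] [T2Space M]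
    [ChartedSpace (Model n) M] [IsManifold 𝓘(ℂ, Model n) ω M] (g : HermitianMetric n M) :
    (∃! η : Form n M 1, g.IsTorsionForm η) ∧
    (∀ a : ℝ, g.GauduchonEquation a → g.torsionForm = 0) ∧
    (g.IsCriticalPoint HermitianMetric.gauduchonFunctional → g.IsBalanced) :=
  ⟨g.existsUnique_torsionForm,
    fun _ h => g.torsionForm_eq_zero
      (g.isKahlerField.lee_eq_zero_of_torsion (g.torsionField_of_gauduchonEquation h)),
    fun h => g.torsionForm_eq_zero (g.lee_eq_zero_of_critical h)⟩
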